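/- **Polynomials.** Let $\mathbf{Cat}$ be the category of small categories. A functor is exponentiable if pulling back along it has a right adjoint. A polynomial from $I$ to $J$ in $\mathbf{Cat}$ is a diagram of functors $I \xleftarrow{s} E \xrightarrow{p} B \xrightarrow{t} J$ with $p$ exponentiable. A 2-cell $(s_1,p_1,t_1)\to(s_2,p_2,t_2)$ is a pair of functors $f_1:B_1\to B_2$, $f_2:E_1\to E_2$ with $s_2f_2=s_1$, $t_2f_1=t_1$ and such that the square $p_2f_2=f_1p_1$ is a pullback. Polynomials compose by pullback, distributivity pullback and pullback, and small categories, polynomials and these 2-cells form a bicategory. A polynomial monad $(I,P)$ is a monad $P$ on a small category $I$ in this bicategory. A morphism $(I,P)\to(J,Q)$ of polynomial monads is a functor $f:I\to J$ together with a 2-cell $\phi:(fs_P,p_P,ft_P)=f^\bullet\circ P\circ f_\bullet\to Q$ whose mate $P\to f_\bullet\circ Q\circ f^\bullet$ is a morphism of monads on $I$; here $f^\bullet=(1_I,1_I,f)$ and $f_\bullet=(f,1_I,1_I)$, and $f^\bullet\dashv f_\bullet$. Morphisms compose by stacking diagrams. This gives the category $\mathbf{PolyMnd}(\mathbf{Cat})$.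 **The monad $\mathbf S$.** Let $\mathbb P$ be the category of natural numbers and permutations, let $\mathbb P_*$ be the category of pairs $(n,j)$ with $1\le j\le n$ and permutations preserving the chosen element, and let $U:\mathbb P_*\to\mathbb P$ be the forgetful functor. The polynomial $1\leftarrow\mathbb P_*\xrightarrow{U}\mathbb P\to 1$ carries a monad structure, with unit given by $1\in\mathbb P$ and multiplication given by $(n,(m_j)_j)\mapsto m_1+\dots+m_n$ and by substitution of permutations. The resulting polynomial monad $\mathbf S$ is the one for symmetric monoidal categories. **Operads.** A collection $T$ consists of a set $I$ of colours, sets $T((i_j)_{1\le j\le n};i)$ of arrows $\alpha:(i_j)_j\to i$, and for $\rho\in\Sigma_n$ an arrow $\alpha\rho:(i_{\rho j})_j\to i$, with $\alpha 1=\alpha$ and $(\alpha\rho_1)\rho_2=\alpha(\rho_1\rho_2)$. An operad (coloured, symmetric) is a collection with identities $1_i:(i)\to i$ and composites $\alpha\circ(\beta_j)_j:(i_{jk})_{jk}\to i$ for $\alpha:(i_j)_j\to i$ and $\beta_j:(i_{jk})_{1\le k\le m_j}\to i_j$, the source being the concatenation of the sources of the $\beta_j$. Composition is required to be unital and associative,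 and equivariant: $(\alpha\circ(\beta_j)_j)(\rho(\rho_j)_j)=(\alpha\rho)\circ(\beta_{\rho j}\rho_{\rho j})_j$ for $\rho\in\Sigma_n$ and $\rho_j\in\Sigma_{m_j}$, where $\rho(\rho_j)_j$ sends the $k$-th element of the $j$-th block to the $\rho_{\rho j}(k)$-th element of the $\rho(j)$-th block. Morphisms of operads consist of a map of colours and equivariant maps of arrows which preserve identities and composites. This gives the category $\mathbf{Opd}$. **The functor $\overline{\mathcal N}$.** For an operad $T$ with set of colours $I$, let $B_T$ be the category whose objects are the arrows of $T$ and whose morphisms $\alpha\to\beta$ are the permutations $\rho$ with $\alpha=\beta\rho$. Let $E_T$ be the category of pairs $(\alpha,j)$ with $1\le j\le n$, where $n$ is the length of the source of $\alpha$, a morphism $(\alpha,j)\to(\beta,k)$ being a morphism $\rho:\alpha\to\beta$ of $B_T$ with $\rho j=k$. Let $P_T$ be the polynomial $I\xleftarrow{s_T}E_T\xrightarrow{p_T}B_T\xrightarrow{t_T}I$ with $s_T(\alpha,j)=i_j$, $p_T(\alpha,j)=\alpha$ and $t_T(\alpha)=i$ for $\alpha:(i_j)_j\to i$. The identities and composites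 of $T$ make $P_T$ a polynomial monad on the discrete category $I$, and the functors $e_T(\alpha,j)=(n,j)$ and $b_T(\alpha)=n$ are the components of a morphism of polynomial monads from $P_T$ to $\mathbf S$. A morphism of operads acts on colours, on arrows and on pairs $(\alpha,j)$. This defines a functor $\overline{\mathcal N}:\mathbf{Opd}\to\mathbf{PolyMnd}(\mathbf{Cat})/\mathbf S$ with $\overline{\mathcal N}(T)=(e_T,b_T)$. **Theorem.** The functor $\overline{\mathcal N}$ takes values in the full subcategory of $\mathbf{PolyMnd}(\mathbf{Cat})/\mathbf S$ consisting of those morphisms of polynomial monads $(e,b):(I\xleftarrow{s}E\xrightarrow{p}B\xrightarrow{t}I)\to(1\leftarrow\mathbb P_*\xrightarrow{U}\mathbb P\to1)$ for which $I$ is discrete (its only morphisms are identities) and $b:B\to\mathbb P$ is a discrete fibration (every morphism $u:a\to b(x)$ is the image under $b$ of a unique morphism with codomain $x$), and it restricts to an equivalence of categories between $\mathbf{Opd}$ and this full subcategory. -/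

import Mathlib

open CategoryTheory CategoryTheory.Limits

namespace PolyOpd

universe w v u

section Exponentiable

variable {C : Type u} [Category.{v} C] [HasPullbacks C]

/-- A morphism is exponentiable when pulling back along it has a right adjoint. -/
def Exponentiable {X Y : C} (f : X ⟶ Y) : Prop :=
  (Over.pullback f).IsLeftAdjoint

/-- Distributivity pullbacks around `(p, g)`: terminal pullbacks around `(p, g)`. -/
structure IsDistribPullback {E B W P Q : C} (p : E ⟶ B) (g : W ⟶ E)
    (e : P ⟶ W) (q : P ⟶ Q) (r : Q ⟶ B) : Prop where
  isPullback : IsPullback (e ≫ g) q p r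
  univ : ∀ {A A' : C} (a : A ⟶ W) (x : A ⟶ A') (y : A' ⟶ B), IsPullback (a ≫ g) x p y →
    ∃! k : (A ⟶ P) × (A' ⟶ Q), k.1 ≫ e = a ∧ k.1 ≫ q = x ≫ k.2 ∧ k.2 ≫ r = y

theorem Exponentiable.exists_distribPullback {E B W : C} {p : E ⟶ B} (hp : Exponentiable p)
    (g : W ⟶ E) : ∃ (P Q : C) (e : P ⟶ W) (q : P ⟶ Q) (r : Q ⟶ B),
      IsDistribPullback p g e q r := by
  have : (Over.pullback p).IsLeftAdjoint := hp
  let adj := Adjunction.ofIsLeftAdjoint (Over.pullback p)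
  let R := (Over.pullback p).rightAdjoint.obj (Over.mk g)
  let ε := adj.counit.app (Over.mk g)
  have hε : ε.left ≫ g = pullback.snd R.hom p := Over.w ε
  refine ⟨pullback R.hom p, R.left, ε.left, pullback.fst _ _, R.hom, ⟨?_, ?_⟩⟩
  · rw [hε]; exact (IsPullback.of_hasPullback R.hom p).flip
  · intro A A' a x y h
    let i : A ≅ pullback y p := h.flip.isoPullback
    have hi1 : i.hom ≫ pullback.fst y p = x := h.flip.isoPullback_hom_fst
    have hi2 : i.hom ≫ pullback.snd y p = a ≫ g := h.flip.isoPullback_hom_snd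
    let t : (Over.pullback p).obj (Over.mk y) ⟶ Over.mk g :=
      Over.homMk (i.inv ≫ a) (by
        change (i.inv ≫ a) ≫ g = pullback.snd y p
        rw [Category.assoc, ← hi2, Iso.inv_hom_id_assoc])
    let β := adj.homEquiv _ _ t
    have hβ : (Over.pullback p).map β ≫ ε = t := by
      have := (adj.homEquiv _ _).symm_apply_apply t
      rwa [adj.homEquiv_counit] at this
    have hβ' := congrArg Over.Hom.left hβ
    have hw : β.left ≫ R.hom = y := Over.w β
    have key : ∀ (b : Over.mk y ⟶ R), ((Over.pullback p).map b).left ≫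
        pullback.fst R.hom p = pullback.fst y p ≫ b.left := fun b ↦ pullback.lift_fst _ _ _
    have key2 : ∀ (b : Over.mk y ⟶ R), ((Over.pullback p).map b).left ≫
        pullback.snd R.hom p = pullback.snd y p := fun b ↦ pullback.lift_snd _ _ _
    refine ⟨(i.hom ≫ ((Over.pullback p).map β).left, β.left), ⟨?_, ?_, hw⟩, ?_⟩
    · change (i.hom ≫ ((Over.pullback p).map β).left) ≫ ε.left = a
      rw [Category.assoc]
      exact (congrArg (i.hom ≫ ·) hβ').trans (i.hom_inv_id_assoc a)
    · change (i.hom ≫ ((Over.pullback p).map β).left) ≫ pullback.fst R.hom p = x ≫ β.left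
      rw [Category.assoc, key, ← hi1, Category.assoc]
    · rintro ⟨k, l⟩ ⟨h1, h2, h3⟩
      dsimp only at h1 h2 h3
      let b : Over.mk y ⟶ R := Over.homMk l h3
      have hk : k = i.hom ≫ ((Over.pullback p).map b).left := by
        apply pullback.hom_ext
        · rw [Category.assoc, key, h2, ← hi1, Category.assoc]; rfl
        · rw [Category.assoc, key2, hi2, ← hε, ← h1, Category.assoc]
      have hb : (Over.pullback p).map b ≫ ε = t := by
        ext
        change ((Over.pullback p).map b).left ≫ ε.left = i.inv ≫ a
        rw [← h1, hk, Category.assoc, Iso.inv_hom_id_assoc]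
      have : b = β := by
        have h4 : adj.homEquiv _ _ ((adj.homEquiv _ _).symm b) = β := by
          rw [adj.homEquiv_counit]; exact congrArg _ hb
        rwa [Equiv.apply_symm_apply] at h4
      rw [hk, ← this]; rfl

theorem exponentiable_of_distribPullback {E B : C} {p : E ⟶ B}
    (h : ∀ {W : C} (g : W ⟶ E), ∃ (P Q : C) (e : P ⟶ W) (q : P ⟶ Q) (r : Q ⟶ B),
      IsDistribPullback p g e q r) : Exponentiable p := by
  have : ∀ g : Over E, HasTerminal (CostructuredArrow (Over.pullback p) g) := by
    intro g
    obtain ⟨P, Q, e, q, r, hd⟩ := h g.hom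
    let i : P ≅ pullback r p := hd.isPullback.flip.isoPullback
    have hi1 : i.hom ≫ pullback.fst r p = q := hd.isPullback.flip.isoPullback_hom_fst
    have hi2 : i.hom ≫ pullback.snd r p = e ≫ g.hom := hd.isPullback.flip.isoPullback_hom_snd
    let t : (Over.pullback p).obj (Over.mk r) ⟶ g :=
      Over.homMk (i.inv ≫ e) (by
        change (i.inv ≫ e) ≫ g.hom = pullback.snd r p
        rw [Category.assoc, ← hi2, Iso.inv_hom_id_assoc])
    let T : CostructuredArrow (Over.pullback p) g := CostructuredArrow.mk t
    have hw : ∀ X : CostructuredArrow (Over.pullback p) g,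
        X.hom.left ≫ g.hom = pullback.snd X.left.hom p := fun X ↦ Over.w X.hom
    have hu := fun X : CostructuredArrow (Over.pullback p) g ↦
      hd.univ X.hom.left (pullback.fst X.left.hom p) X.left.hom (by
        rw [hw]; exact (IsPullback.of_hasPullback _ _).flip)
    have hex : ∀ X : CostructuredArrow (Over.pullback p) g, Nonempty (X ⟶ T) := by
      intro X
      obtain ⟨⟨k, l⟩, ⟨h1, h2, h3⟩, -⟩ := hu X
      dsimp only at h1 h2 h3
      refine ⟨CostructuredArrow.homMk (Over.homMk l h3) ?_⟩
      ext
      let b : X.left ⟶ Over.mk r := Over.homMk l h3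
      change ((Over.pullback p).map b).left ≫ (show pullback r p ⟶ P from i.inv) ≫ e = X.hom.left
      rw [← h1, ← Category.assoc]
      congr 1
      rw [Iso.comp_inv_eq]
      apply pullback.hom_ext
      · rw [Category.assoc]
        exact ((pullback.lift_fst _ _ _).trans h2.symm).trans (congrArg (k ≫ ·) hi1.symm)
      · rw [Category.assoc]
        refine (pullback.lift_snd _ _ _).trans (.trans ?_ (congrArg (k ≫ ·) hi2.symm))
        rw [← Category.assoc, h1, hw]
    have hun : ∀ (X : CostructuredArrow (Over.pullback p) g) (a b : X ⟶ T), a = b := by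
      intro X
      have key : ∀ a : X ⟶ T, (((Over.pullback p).map a.left).left ≫ (show pullback r p ⟶ P from i.inv)) ≫ e =
            X.hom.left ∧
          (((Over.pullback p).map a.left).left ≫ (show pullback r p ⟶ P from i.inv)) ≫ q =
            pullback.fst X.left.hom p ≫ a.left.left ∧ a.left.left ≫ r = X.left.hom := by
        intro a
        refine ⟨?_, ?_, Over.w a.left⟩
        · rw [Category.assoc]
          exact congrArg Over.Hom.left (CostructuredArrow.w a)
        · rw [Category.assoc, ← hi1, Iso.inv_hom_id_assoc]
          exact pullback.lift_fst _ _ _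
      intro a b
      have := (hu X).unique (y₁ := (_, _)) (y₂ := (_, _)) (key a) (key b)
      ext
      exact congrArg Prod.snd this
    exact IsTerminal.hasTerminal (X := T)
      (IsTerminal.ofUniqueHom (fun X ↦ (hex X).some) (fun X m ↦ hun X _ _))
  exact isLeftAdjoint_of_costructuredArrowTerminals (Over.pullback p)

theorem Exponentiable.comp {X Y Z : C} {f : X ⟶ Y} {g : Y ⟶ Z} (hf : Exponentiable f)
    (hg : Exponentiable g) : Exponentiable (f ≫ g) := by
  have : (Over.pullback f).IsLeftAdjoint := hf
  have : (Over.pullback g).IsLeftAdjoint := hg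
  exact Functor.isLeftAdjoint_of_iso (Over.pullbackComp f g).symm

theorem Exponentiable.id (X : C) : Exponentiable (𝟙 X) :=
  Functor.isLeftAdjoint_of_iso (Over.pullbackId (X := X)).symm

theorem Exponentiable.of_isPullback {E B E' B' : C} {p : E ⟶ B} {p' : E' ⟶ B'} {v : E' ⟶ E}
    {u : B' ⟶ B} (sq : IsPullback v p' p u) (hp : Exponentiable p) : Exponentiable p' := by
  refine exponentiable_of_distribPullback fun {W} g ↦ ?_
  obtain ⟨P₁, Q₁, e₁, q₁, r₁, d₁⟩ := hp.exists_distribPullback (g ≫ v)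
  obtain ⟨P₂, Q₂, e₂, q₂, r₂, d₂⟩ := hp.exists_distribPullback v
  obtain ⟨⟨n, m⟩, ⟨hn1, hn2, hm⟩, -⟩ := d₂.univ (e₁ ≫ g) q₁ r₁ (by simpa using d₁.isPullback)
  obtain ⟨⟨j, i⟩, ⟨hj1, hj2, hi⟩, -⟩ := d₂.univ (𝟙 E') p' u (by simpa using sq)
  dsimp only at hn1 hn2 hm hj1 hj2 hi
  let Q := pullback m i
  let c : Q ⟶ Q₁ := pullback.fst m i
  let r : Q ⟶ B' := pullback.snd m i
  have hcr : c ≫ m = r ≫ i := pullback.condition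
  have hru : r ≫ u = c ≫ r₁ := by rw [← hi, ← hm, ← Category.assoc, ← hcr, Category.assoc]
  let P := pullback p' r
  let x : P ⟶ E' := pullback.fst p' r
  let q : P ⟶ Q := pullback.snd p' r
  have hP : IsPullback x q p' r := IsPullback.of_hasPullback _ _
  have hP' : IsPullback (x ≫ v) q p (r ≫ u) := (hP.flip.paste_vert sq.flip).flip
  obtain ⟨d, hd1, hd2⟩ := d₁.isPullback.exists_lift (x ≫ v) (q ≫ c) (by
    rw [hP'.w, hru, Category.assoc])
  have hde : d ≫ n = x ≫ j := by
    apply d₂.isPullback.hom_ext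
    · simp only [Category.assoc, reassoc_of% hn1, reassoc_of% hj1, hd1]
    · rw [Category.assoc, hn2, ← Category.assoc, hd2, Category.assoc, Category.assoc, hj2, hcr,
        ← Category.assoc, ← Category.assoc, hP.w]
  have hde' : d ≫ e₁ ≫ g = x := by
    have := congrArg (· ≫ e₂) hde
    simpa [hn1, hj1] using this
  refine ⟨P, Q, d ≫ e₁, q, r, ⟨by simpa [hde'] using hP, ?_⟩⟩
  intro A A' a y z hA
  have hA' : IsPullback (a ≫ g ≫ v) y p (z ≫ u) := by
    simpa using (hA.flip.paste_vert sq.flip).flip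
  obtain ⟨⟨k, l⟩, ⟨hk1, hk2, hl⟩, huniq⟩ := d₁.univ a y (z ≫ u) hA'
  dsimp only at hk1 hk2 hl
  have hlz : l ≫ m = z ≫ i := by
    have h2 := d₂.univ (a ≫ g) y (z ≫ u) (by simpa using hA')
    have := h2.unique (y₁ := (k ≫ n, l ≫ m)) (y₂ := (a ≫ g ≫ j, z ≫ i))
      ⟨by simp [hn1, ← hk1], by simp [hn2, ← reassoc_of% hk2], by simp [hm, hl]⟩
      ⟨by simp [hj1], by
        have := hA.w
        simp only [Category.assoc] at this
        simp [hj2, reassoc_of% this], by simp [hi]⟩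
    exact congrArg Prod.snd this
  let L : A' ⟶ Q := pullback.lift l z hlz
  have hLc : L ≫ c = l := pullback.lift_fst _ _ _
  have hLr : L ≫ r = z := pullback.lift_snd _ _ _
  obtain ⟨K, hK1, hK2⟩ := hP.exists_lift (a ≫ g) (y ≫ L) (by
    rw [hA.w, Category.assoc, hLr])
  have hKd : K ≫ d = k := by
    apply d₁.isPullback.hom_ext
    · simp only [Category.assoc, hd1, reassoc_of% hK1, reassoc_of% hk1]
    · simp only [Category.assoc, hd2, reassoc_of% hK2, hk2, hLc]
  refine ⟨(K, L), ⟨by simp [reassoc_of% hKd, hk1], hK2, hLr⟩, ?_⟩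
  rintro ⟨K', L'⟩ ⟨h1, h2, h3⟩
  dsimp only at h1 h2 h3
  have hu := huniq (K' ≫ d, L' ≫ c) ⟨by simpa using h1, by
    simp only [Category.assoc, hd2, reassoc_of% h2], by
    simp only [Category.assoc, ← hru, reassoc_of% h3]⟩
  have hu2 : L' ≫ c = l := congrArg Prod.snd hu
  have hL : L' = L := by
    apply pullback.hom_ext
    · exact hu2.trans hLc.symm
    · exact h3.trans hLr.symm
  have hKK : K' = K := by
    apply hP.hom_ext
    · rw [hK1, ← hde', ← h1]; simp
    · rw [hK2, h2, hL]
  rw [hL, hKK]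

end Exponentiable

end PolyOpd

namespace PolyOpd

universe w v u

section Polynomials

variable {C : Type u} [Category.{v} C] [HasPullbacks C]

/-- A polynomial `I ⟵ E ⟶ B ⟶ J` from `I` to `J`, the middle morphism being exponentiable. -/
structure Poly (I J : C) where
  E : C
  B : C
  s : E ⟶ I
  p : E ⟶ B
  t : B ⟶ J
  exponentiable : Exponentiable p

/-- Morphisms (2-cells) of polynomials: commuting diagrams with a pullback in the middle. -/
@[ext]
structure Poly.Hom {I J : C} (P Q : Poly I J) where
  f₁ : P.B ⟶ Q.B
  f₂ : P.E ⟶ Q.E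
  w_s : f₂ ≫ Q.s = P.s
  w_t : f₁ ≫ Q.t = P.t
  isPullback : IsPullback f₂ P.p Q.p f₁

instance {I J : C} : Category (Poly I J) where
  Hom P Q := Poly.Hom P Q
  id P := ⟨𝟙 _, 𝟙 _, by simp, by simp, IsPullback.of_horiz_isIso ⟨by simp⟩⟩
  comp f g := ⟨f.f₁ ≫ g.f₁, f.f₂ ≫ g.f₂, by rw [Category.assoc, g.w_s, f.w_s],
    by rw [Category.assoc, g.w_t, f.w_t], f.isPullback.paste_horiz g.isPullback⟩
  id_comp f := Poly.Hom.ext (Category.id_comp _) (Category.id_comp _)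
  comp_id f := Poly.Hom.ext (Category.comp_id _) (Category.comp_id _)
  assoc f g h := Poly.Hom.ext (Category.assoc _ _ _) (Category.assoc _ _ _)

namespace Poly

variable {I J K L : C}

@[ext]
theorem hom_ext {P Q : Poly I J} {f g : P ⟶ Q} (h₁ : f.f₁ = g.f₁) (h₂ : f.f₂ = g.f₂) : f = g :=
  Poly.Hom.ext h₁ h₂

@[simp] theorem id_f₁ (P : Poly I J) : Hom.f₁ (𝟙 P) = 𝟙 P.B := rfl
@[simp] theorem id_f₂ (P : Poly I J) : Hom.f₂ (𝟙 P) = 𝟙 P.E := rfl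
@[simp] theorem comp_f₁ {P Q R : Poly I J} (f : P ⟶ Q) (g : Q ⟶ R) :
    (f ≫ g).f₁ = f.f₁ ≫ g.f₁ := rfl
@[simp] theorem comp_f₂ {P Q R : Poly I J} (f : P ⟶ Q) (g : Q ⟶ R) :
    (f ≫ g).f₂ = f.f₂ ≫ g.f₂ := rfl

/-- A `P`-structure on a morphism `y`: a pullback square from `y` to the middle morphism of `P`. -/
@[ext]
structure Cell (P : Poly I J) {X Y : C} (y : X ⟶ Y) where
  e : X ⟶ P.E
  b : Y ⟶ P.B
  isPullback : IsPullback e y P.p b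

/-- The identity square. -/
def idCell (P : Poly I J) : P.Cell P.p := ⟨𝟙 _, 𝟙 _, IsPullback.of_horiz_isIso ⟨by simp⟩⟩

/-- Postcomposition of a square with a 2-cell. -/
@[simps]
def Cell.map {P Q : Poly I J} {X Y : C} {y : X ⟶ Y} (c : P.Cell y) (f : P ⟶ Q) : Q.Cell y :=
  ⟨c.e ≫ f.f₂, c.b ≫ f.f₁, c.isPullback.paste_horiz f.isPullback⟩

/-- Precomposition of a square with a pullback square. -/
@[simps]
def Cell.base {P : Poly I J} {X Y X' Y' : C} {y : X ⟶ Y} {y' : X' ⟶ Y'} (c : P.Cell y)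
    {h : X' ⟶ X} {k : Y' ⟶ Y} (sq : IsPullback h y' y k) : P.Cell y' :=
  ⟨h ≫ c.e, k ≫ c.b, sq.paste_horiz c.isPullback⟩

/-- A 2-cell from a square which is compatible with the outer legs. -/
@[simps]
def Cell.toHom {P Q : Poly I J} (c : Q.Cell P.p) (hs : c.e ≫ Q.s = P.s) (ht : c.b ≫ Q.t = P.t) :
    P ⟶ Q :=
  Hom.mk c.b c.e hs ht c.isPullback

theorem hom_ext_cell {P Q : Poly I J} {f g : P ⟶ Q} (h : P.idCell.map f = P.idCell.map g) :
    f = g := by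
  have h1 := congrArg Cell.b h
  have h2 := congrArg Cell.e h
  ext
  · simpa [idCell] using h1
  · simpa [idCell] using h2

/-! ### Composition of polynomials -/

/-- A chosen distributivity pullback around `(Q.p, pullback.snd P.t Q.s)`. -/
structure CompData (P : Poly I J) (Q : Poly J K) where
  F : C
  B : C
  e : F ⟶ pullback P.t Q.s
  q : F ⟶ B
  r : B ⟶ Q.B
  isDistrib : IsDistribPullback Q.p (pullback.snd P.t Q.s) e q r

theorem nonempty_compData (P : Poly I J) (Q : Poly J K) : Nonempty (CompData P Q) := by
  obtain ⟨F, B, e, q, r, h⟩ := Q.exponentiable.exists_distribPullback (pullback.snd P.t Q.s)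
  exact ⟨⟨F, B, e, q, r, h⟩⟩

noncomputable def compData (P : Poly I J) (Q : Poly J K) : CompData P Q :=
  (nonempty_compData P Q).some

/-- The composite polynomial, formed from a pullback, a distributivity pullback and a pullback. -/
noncomputable def comp (P : Poly I J) (Q : Poly J K) : Poly I K where
  E := pullback P.p ((compData P Q).e ≫ pullback.fst P.t Q.s)
  B := (compData P Q).B
  s := pullback.fst _ _ ≫ P.s
  p := pullback.snd P.p ((compData P Q).e ≫ pullback.fst P.t Q.s) ≫ (compData P Q).q
  t := (compData P Q).r ≫ Q.t
  exponentiable := Exponentiable.comp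
    (P.exponentiable.of_isPullback (IsPullback.of_hasPullback _ _))
    (Q.exponentiable.of_isPullback (compData P Q).isDistrib.isPullback)

/-- The middle object of the composite. -/
noncomputable def compMid (P : Poly I J) (Q : Poly J K) : C := (compData P Q).F

noncomputable def compLeft (P : Poly I J) (Q : Poly J K) : (comp P Q).E ⟶ compMid P Q :=
  pullback.snd P.p ((compData P Q).e ≫ pullback.fst P.t Q.s)

noncomputable def compRight (P : Poly I J) (Q : Poly J K) : compMid P Q ⟶ (comp P Q).B :=
  (compData P Q).q

theorem compLeft_compRight (P : Poly I J) (Q : Poly J K) :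
    compLeft P Q ≫ compRight P Q = (comp P Q).p := (rfl)

/-- The two tautological structures on the two halves of the composite. -/
noncomputable def compCell₁ (P : Poly I J) (Q : Poly J K) : P.Cell (compLeft P Q) where
  e := pullback.fst P.p ((compData P Q).e ≫ pullback.fst P.t Q.s)
  b := (compData P Q).e ≫ pullback.fst P.t Q.s
  isPullback := IsPullback.of_hasPullback _ _

noncomputable def compCell₂ (P : Poly I J) (Q : Poly J K) : Q.Cell (compRight P Q) where
  e := (compData P Q).e ≫ pullback.snd P.t Q.s
  b := (compData P Q).r
  isPullback := (compData P Q).isDistrib.isPullback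

theorem comp_s (P : Poly I J) (Q : Poly J K) : (comp P Q).s = (compCell₁ P Q).e ≫ P.s := (rfl)

theorem comp_t (P : Poly I J) (Q : Poly J K) : (comp P Q).t = (compCell₂ P Q).b ≫ Q.t := (rfl)

theorem comp_condition (P : Poly I J) (Q : Poly J K) :
    (compCell₁ P Q).b ≫ P.t = (compCell₂ P Q).e ≫ Q.s := by
  change ((compData P Q).e ≫ pullback.fst P.t Q.s) ≫ P.t =
    ((compData P Q).e ≫ pullback.snd P.t Q.s) ≫ Q.s
  rw [Category.assoc, Category.assoc, pullback.condition]

/-- The identity polynomial. -/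
abbrev idPoly (I : C) : Poly I I := ⟨I, I, 𝟙 I, 𝟙 I, 𝟙 I, Exponentiable.id I⟩

section Cells

variable {P P' : Poly I J} {Q Q' : Poly J K} {R : Poly K L}
variable {X Y Z W : C} {x : X ⟶ Y} {y : Y ⟶ Z} {z : X ⟶ Z}

theorem exists_lift (c : P.Cell x) (d : Q.Cell y) (h : c.b ≫ P.t = d.e ≫ Q.s) :
    ∃! k : (X ⟶ (comp P Q).E) × (Y ⟶ compMid P Q) × (Z ⟶ (comp P Q).B),
      k.1 ≫ (compCell₁ P Q).e = c.e ∧ k.1 ≫ compLeft P Q = x ≫ k.2.1 ∧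
      k.2.1 ≫ (compCell₁ P Q).b = c.b ∧ k.2.1 ≫ (compCell₂ P Q).e = d.e ∧
      k.2.1 ≫ compRight P Q = y ≫ k.2.2 ∧ k.2.2 ≫ (compCell₂ P Q).b = d.b := by
  obtain ⟨⟨m, n⟩, ⟨h1, h2, h3⟩, hu⟩ :=
    (compData P Q).isDistrib.univ (pullback.lift c.b d.e h) y d.b
      (by rw [pullback.lift_snd]; exact d.isPullback)
  dsimp only at h1 h2 h3
  have hm : m ≫ (compCell₁ P Q).b = c.b := by
    change m ≫ (compData P Q).e ≫ _ = _
    rw [← Category.assoc, h1, pullback.lift_fst]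
  have hm' : m ≫ (compCell₂ P Q).e = d.e := by
    change m ≫ (compData P Q).e ≫ _ = _
    rw [← Category.assoc, h1, pullback.lift_snd]
  change Y ⟶ compMid P Q at m
  change Z ⟶ (comp P Q).B at n
  obtain ⟨k, hk1, hk2⟩ := (compCell₁ P Q).isPullback.exists_lift c.e (x ≫ m)
    (by rw [c.isPullback.w, Category.assoc]; exact congrArg _ hm.symm)
  refine ⟨(k, m, n), ⟨hk1, hk2, hm, hm', h2, h3⟩, ?_⟩
  rintro ⟨k', m', n'⟩ ⟨g1, g2, g3, g4, g5, g6⟩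
  dsimp only at g1 g2 g3 g4 g5 g6
  have : (m', n') = (m, n) := hu _ ⟨by
    apply pullback.hom_ext
    · rw [pullback.lift_fst, Category.assoc]; exact g3
    · rw [pullback.lift_snd, Category.assoc]; exact g4, g5, g6⟩
  obtain ⟨rfl, rfl⟩ := Prod.mk.inj this
  congr 1
  apply (compCell₁ P Q).isPullback.hom_ext
  · rw [hk1]; exact g1
  · rw [hk2]; exact g2

/-- The middle component of the map into the composite polynomial. -/
noncomputable def liftMid (c : P.Cell x) (d : Q.Cell y) (h : c.b ≫ P.t = d.e ≫ Q.s) :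
    Y ⟶ compMid P Q :=
  (exists_lift c d h).choose.2.1

theorem isPullback_liftMid₁ (c : P.Cell x) (d : Q.Cell y) (h : c.b ≫ P.t = d.e ≫ Q.s) :
    IsPullback (exists_lift c d h).choose.1 x (compLeft P Q) (liftMid c d h) := by
  obtain ⟨h1, h2, h3, -⟩ := (exists_lift c d h).choose_spec.1
  refine IsPullback.of_right ?_ h2 (compCell₁ P Q).isPullback
  rw [h1, liftMid, h3]
  exact c.isPullback

theorem isPullback_liftMid₂ (c : P.Cell x) (d : Q.Cell y) (h : c.b ≫ P.t = d.e ≫ Q.s) :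
    IsPullback (liftMid c d h) y (compRight P Q) (exists_lift c d h).choose.2.2 := by
  obtain ⟨-, -, -, h4, h5, h6⟩ := (exists_lift c d h).choose_spec.1
  refine IsPullback.of_right ?_ h5 (compCell₂ P Q).isPullback
  rw [liftMid, h4, h6]
  exact d.isPullback

/-- Pasting of a `P`-structure and a `Q`-structure to a structure for the composite. -/
noncomputable def Cell.comp (c : P.Cell x) (d : Q.Cell y) (h : c.b ≫ P.t = d.e ≫ Q.s)
    (hz : x ≫ y = z) : (Poly.comp P Q).Cell z where
  e := (exists_lift c d h).choose.1
  b := (exists_lift c d h).choose.2.2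
  isPullback := by
    rw [← hz]
    exact (isPullback_liftMid₁ c d h).paste_vert (isPullback_liftMid₂ c d h)

theorem Cell.comp_spec (c : P.Cell x) (d : Q.Cell y) (h : c.b ≫ P.t = d.e ≫ Q.s)
    (hz : x ≫ y = z) :
    (c.comp d h hz).e ≫ (compCell₁ P Q).e = c.e ∧
      (c.comp d h hz).e ≫ compLeft P Q = x ≫ liftMid c d h ∧
      liftMid c d h ≫ (compCell₁ P Q).b = c.b ∧ liftMid c d h ≫ (compCell₂ P Q).e = d.e ∧
      liftMid c d h ≫ compRight P Q = y ≫ (c.comp d h hz).b ∧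
      (c.comp d h hz).b ≫ (compCell₂ P Q).b = d.b :=
  (exists_lift c d h).choose_spec.1

theorem Cell.eq_comp (c : P.Cell x) (d : Q.Cell y) (h : c.b ≫ P.t = d.e ≫ Q.s)
    (hz : x ≫ y = z) (f : (Poly.comp P Q).Cell z) (m : Y ⟶ compMid P Q)
    (h1 : f.e ≫ (compCell₁ P Q).e = c.e)
    (h2 : f.e ≫ compLeft P Q = x ≫ m) (h3 : m ≫ (compCell₁ P Q).b = c.b)
    (h4 : m ≫ (compCell₂ P Q).e = d.e) (h5 : m ≫ compRight P Q = y ≫ f.b)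
    (h6 : f.b ≫ (compCell₂ P Q).b = d.b) : f = c.comp d h hz := by
  have := (exists_lift c d h).unique (y₁ := (f.e, m, f.b)) ⟨h1, h2, h3, h4, h5, h6⟩
    (y₂ := ((c.comp d h hz).e, liftMid c d h, (c.comp d h hz).b)) (c.comp_spec d h hz)
  ext
  · exact congrArg Prod.fst this
  · exact congrArg (fun k ↦ k.2.2) this

theorem Cell.comp_s (c : P.Cell x) (d : Q.Cell y) (h : c.b ≫ P.t = d.e ≫ Q.s)
    (hz : x ≫ y = z) : (c.comp d h hz).e ≫ (Poly.comp P Q).s = c.e ≫ P.s := by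
  rw [← (c.comp_spec d h hz).1, Category.assoc, Poly.comp_s]

theorem Cell.comp_t (c : P.Cell x) (d : Q.Cell y) (h : c.b ≫ P.t = d.e ≫ Q.s)
    (hz : x ≫ y = z) : (c.comp d h hz).b ≫ (Poly.comp P Q).t = d.b ≫ Q.t := by
  rw [← (c.comp_spec d h hz).2.2.2.2.2, Category.assoc, Poly.comp_t]

theorem Cell.comp_base (c : P.Cell x) (d : Q.Cell y) (h : c.b ≫ P.t = d.e ≫ Q.s)
    (hz : x ≫ y = z) {X' Y' Z' : C} {x' : X' ⟶ Y'} {y' : Y' ⟶ Z'} {z' : X' ⟶ Z'}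
    {k : X' ⟶ X} {l : Y' ⟶ Y} {m : Z' ⟶ Z} (sq₁ : IsPullback k x' x l)
    (sq₂ : IsPullback l y' y m) (sq : IsPullback k z' z m) (hz' : x' ≫ y' = z') :
    (c.comp d h hz).base sq =
      (c.base sq₁).comp (d.base sq₂) (by simp [h]) hz' := by
  obtain ⟨h1, h2, h3, h4, h5, h6⟩ := c.comp_spec d h hz
  apply Cell.eq_comp (m := l ≫ liftMid c d h)
  · simp [h1]
  · simp [h2, reassoc_of% sq₁.w]
  · simp [h3]
  · simp [h4]
  · simp [h5, reassoc_of% sq₂.w]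
  · simp [h6]

theorem idCell_comp (P : Poly I J) (Q : Poly J K) :
    (Poly.comp P Q).idCell = (compCell₁ P Q).comp (compCell₂ P Q) (comp_condition P Q)
      (compLeft_compRight P Q) := by
  apply Cell.eq_comp (m := 𝟙 _) <;> simp [idCell]

theorem Cell.idCell_base {P : Poly I J} {X Y : C} {y : X ⟶ Y} (c : P.Cell y) :
    P.idCell.base c.isPullback = c := by
  ext <;> simp [idCell]

/-- Every structure for a composite polynomial is a pasting. -/
theorem Cell.exists_eq_comp (f : (Poly.comp P Q).Cell z) :
    ∃ (M : C) (x : X ⟶ M) (y : M ⟶ Z) (c : P.Cell x) (d : Q.Cell y)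
      (h : c.b ≫ P.t = d.e ≫ Q.s) (hz : x ≫ y = z), f = c.comp d h hz := by
  have sq₂ : IsPullback (pullback.fst (compRight P Q) f.b) (pullback.snd _ _)
    (compRight P Q) f.b := IsPullback.of_hasPullback _ _
  obtain ⟨x, h1, h2⟩ := sq₂.exists_lift (f.e ≫ compLeft P Q) z (by
    have := f.isPullback.w
    rwa [← compLeft_compRight, ← Category.assoc] at this)
  have sq : IsPullback f.e (x ≫ pullback.snd (compRight P Q) f.b)
      (compLeft P Q ≫ compRight P Q) f.b := by
    rw [h2]; exact f.isPullback
  have sq₁ : IsPullback f.e x (compLeft P Q)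
      (pullback.fst (compRight P Q) f.b) := IsPullback.of_bot sq h1.symm sq₂
  refine ⟨_, x, pullback.snd _ _, (compCell₁ P Q).base sq₁, (compCell₂ P Q).base sq₂, ?_, h2, ?_⟩
  · simp [comp_condition]
  · rw [← Cell.comp_base _ _ (comp_condition P Q) (compLeft_compRight P Q) sq₁ sq₂ f.isPullback]
    have := f.idCell_base
    rw [idCell_comp] at this
    exact this.symm

end Cells

/-- Horizontal composition of 2-cells. -/
noncomputable def hcomp {P P' : Poly I J} {Q Q' : Poly J K} (f : P ⟶ P') (g : Q ⟶ Q') :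
    comp P Q ⟶ comp P' Q' :=
  (((compCell₁ P Q).map f).comp ((compCell₂ P Q).map g) (by
    simp [f.w_t, g.w_s, comp_condition]) (compLeft_compRight P Q)).toHom
    (by rw [Cell.comp_s]; simp [f.w_s, comp_s]) (by rw [Cell.comp_t]; simp [g.w_t, comp_t])

theorem Cell.base_map {P Q : Poly I J} {X Y X' Y' : C} {y : X ⟶ Y} {y' : X' ⟶ Y'} (c : P.Cell y)
    {h : X' ⟶ X} {k : Y' ⟶ Y} (sq : IsPullback h y' y k) (f : P ⟶ Q) :
    (c.base sq).map f = (c.map f).base sq := by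
  ext <;> simp

theorem idCell_map_toHom {P Q : Poly I J} (c : Q.Cell P.p) (hs : c.e ≫ Q.s = P.s)
    (ht : c.b ≫ Q.t = P.t) : P.idCell.map (c.toHom hs ht) = c := by
  ext <;> simp [idCell]

theorem Cell.map_id {P : Poly I J} {X Y : C} {y : X ⟶ Y} (c : P.Cell y) : c.map (𝟙 P) = c := by
  ext <;> simp

theorem Cell.map_comp {P Q R : Poly I J} {X Y : C} {y : X ⟶ Y} (c : P.Cell y) (f : P ⟶ Q)
    (g : Q ⟶ R) : c.map (f ≫ g) = (c.map f).map g := by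
  ext <;> simp

end Poly

end Polynomials

end PolyOpd

namespace PolyOpd

universe w v u

section PolyBicategory

variable {C : Type u} [Category.{v} C] [HasPullbacks C]

namespace Poly

variable {I J K L M : C}

section Cells

variable {P P' : Poly I J} {Q Q' : Poly J K} {R R' : Poly K L} {S : Poly I K}
variable {X Y Z W : C} {x : X ⟶ Y} {y : Y ⟶ Z} {z : X ⟶ Z}

theorem Cell.base_id {P : Poly I J} (c : P.Cell x) (sq : IsPullback (𝟙 X) x x (𝟙 Y)) :
    c.base sq = c := by
  ext <;> simp

theorem Cell.comp_cancel {X' Y' Z' : C} {x' : X' ⟶ Y'} {y' : Y' ⟶ Z'} {z' : X' ⟶ Z'}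
    (c : P.Cell x) (d : Q.Cell y) (h : c.b ≫ P.t = d.e ≫ Q.s) (hz : x ≫ y = z)
    (c' : P.Cell x') (d' : Q.Cell y') (h' : c'.b ≫ P.t = d'.e ≫ Q.s) (hz' : x' ≫ y' = z')
    {k : X ⟶ X'} {m : Z ⟶ Z'} (sq : IsPullback k z z' m)
    (heq : c.comp d h hz = (c'.comp d' h' hz').base sq) :
    ∃ (l : Y ⟶ Y') (sq₁ : IsPullback k x x' l) (sq₂ : IsPullback l y y' m),
      c = c'.base sq₁ ∧ d = d'.base sq₂ := by
  obtain ⟨h1, h2, h3, h4, h5, h6⟩ := c.comp_spec d h hz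
  obtain ⟨g1, g2, g3, g4, g5, g6⟩ := c'.comp_spec d' h' hz'
  have he : (c.comp d h hz).e = k ≫ (c'.comp d' h' hz').e := congrArg Cell.e heq
  have hb : (c.comp d h hz).b = m ≫ (c'.comp d' h' hz').b := congrArg Cell.b heq
  have p2 : IsPullback (liftMid c' d' h') y' (compRight P Q) (c'.comp d' h' hz').b :=
    isPullback_liftMid₂ c' d' h'
  have q2 : IsPullback (liftMid c d h) y (compRight P Q) (c.comp d h hz).b :=
    isPullback_liftMid₂ c d h
  obtain ⟨l, hl1, hl2⟩ := p2.exists_lift (liftMid c d h) (y ≫ m) (by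
    rw [h5, hb, Category.assoc])
  have sq₂ : IsPullback l y y' m := by
    refine IsPullback.of_right ?_ hl2 p2
    rw [hl1, ← hb]; exact q2
  have sq₁ : IsPullback k x x' l := by
    refine IsPullback.of_bot (by rw [hz, hz']; exact sq) ?_ sq₂
    apply p2.hom_ext
    · rw [Category.assoc, Category.assoc, hl1, ← h2, ← g2, he, Category.assoc]
    · rw [Category.assoc, Category.assoc, hl2, hz', ← Category.assoc, hz, sq.w]
  refine ⟨l, sq₁, sq₂, ?_, ?_⟩
  · ext
    · rw [← h1, he, Category.assoc, g1]; rfl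
    · rw [← h3, ← hl1, Category.assoc, g3]; rfl
  · ext
    · rw [← h4, ← hl1, Category.assoc, g4]; rfl
    · rw [← h6, hb, Category.assoc, g6]; rfl

theorem Cell.map_toHom (c : P.Cell x) (d : P'.Cell P.p) (hs : d.e ≫ P'.s = P.s)
    (ht : d.b ≫ P'.t = P.t) : c.map (d.toHom hs ht) = d.base c.isPullback := by
  ext <;> simp

theorem Cell.exists_base (c : P.Cell x) (d : Q.Cell y) (h : c.b ≫ P.t = d.e ≫ Q.s)
    (hz : x ≫ y = z) :
    ∃ (sq₁ : IsPullback (c.comp d h hz).e x (compLeft P Q) (liftMid c d h))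
      (sq₂ : IsPullback (liftMid c d h) y (compRight P Q) (c.comp d h hz).b),
      c = (compCell₁ P Q).base sq₁ ∧ d = (compCell₂ P Q).base sq₂ := by
  obtain ⟨h1, h2, h3, h4, h5, h6⟩ := c.comp_spec d h hz
  refine ⟨isPullback_liftMid₁ c d h, isPullback_liftMid₂ c d h, ?_, ?_⟩
  · ext
    · exact h1.symm
    · exact h3.symm
  · ext
    · exact h4.symm
    · exact h6.symm

theorem Cell.map_hcomp (c : P.Cell x) (d : Q.Cell y) (h : c.b ≫ P.t = d.e ≫ Q.s)
    (hz : x ≫ y = z) (f : P ⟶ P') (g : Q ⟶ Q') :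
    (c.comp d h hz).map (hcomp f g) =
      (c.map f).comp (d.map g) (by simp [f.w_t, g.w_s, h]) hz := by
  obtain ⟨sq₁, sq₂, h1, h2⟩ := c.exists_base d h hz
  rw [hcomp, Cell.map_toHom, Cell.comp_base _ _ _ _ sq₁ sq₂ _ hz]
  simp only [← Cell.base_map, ← h1, ← h2]

theorem hom_ext₂ {f g : comp P Q ⟶ S}
    (H : ∀ {X Y Z : C} {x : X ⟶ Y} {y : Y ⟶ Z} {z : X ⟶ Z} (c : P.Cell x) (d : Q.Cell y)
      (h : c.b ≫ P.t = d.e ≫ Q.s) (hz : x ≫ y = z),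
      (c.comp d h hz).map f = (c.comp d h hz).map g) : f = g := by
  apply hom_ext_cell
  rw [idCell_comp]
  exact H _ _ _ _

/-! ### The associator -/

/-- A decomposition of a structure for a composite polynomial. -/
structure Split (f : (Poly.comp P Q).Cell z) where
  M : C
  x : X ⟶ M
  y : M ⟶ Z
  c : P.Cell x
  d : Q.Cell y
  h : c.b ≫ P.t = d.e ≫ Q.s
  hz : x ≫ y = z
  eq : f = c.comp d h hz

noncomputable def split (f : (Poly.comp P Q).Cell z) : Split f := by
  refine Nonempty.some ?_
  obtain ⟨M, x, y, c, d, h, hz, e⟩ := f.exists_eq_comp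
  exact ⟨⟨M, x, y, c, d, h, hz, e⟩⟩

theorem Split.w_s {f : (Poly.comp P Q).Cell z} (s : Split f) :
    s.c.e ≫ P.s = f.e ≫ (Poly.comp P Q).s := by
  have := congrArg (fun g ↦ g.e ≫ (Poly.comp P Q).s) s.eq
  rw [this, Cell.comp_s]

theorem Split.w_t {f : (Poly.comp P Q).Cell z} (s : Split f) :
    s.d.b ≫ Q.t = f.b ≫ (Poly.comp P Q).t := by
  have := congrArg (fun g ↦ g.b ≫ (Poly.comp P Q).t) s.eq
  rw [this, Cell.comp_t]

/-- The associativity 2-cell `(PQ)R ⟶ P(QR)`, which repastes the three constituent squares. -/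
noncomputable def assocHom (P : Poly I J) (Q : Poly J K) (R : Poly K L) :
    comp (comp P Q) R ⟶ comp P (comp Q R) :=
  let s := split (compCell₁ (comp P Q) R)
  (s.c.comp (s.d.comp (compCell₂ (comp P Q) R) (by rw [s.w_t, comp_condition]) rfl)
    (by rw [Cell.comp_s, s.h]) (by rw [← Category.assoc, s.hz, compLeft_compRight])).toHom
    (by rw [Cell.comp_s, comp_s, s.w_s])
    (by rw [Cell.comp_t, Cell.comp_t, comp_t])

/-- The inverse associativity 2-cell. -/
noncomputable def assocInv (P : Poly I J) (Q : Poly J K) (R : Poly K L) :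
    comp P (comp Q R) ⟶ comp (comp P Q) R :=
  let s := split (compCell₂ P (comp Q R))
  (((compCell₁ P (comp Q R)).comp s.c (by rw [s.w_s, comp_condition]) rfl).comp s.d
    (by rw [Cell.comp_t, s.h]) (by rw [Category.assoc, s.hz, compLeft_compRight])).toHom
    (by rw [Cell.comp_s, Cell.comp_s, comp_s])
    (by rw [Cell.comp_t, comp_t, s.w_t])

section

variable {U : C} {w : Z ⟶ U} {xy : X ⟶ Z} {yw : Y ⟶ U} {t : X ⟶ U}

theorem Cell.map_assocHom (c : P.Cell x) (d : Q.Cell y) (e : R.Cell w)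
    (h : c.b ≫ P.t = d.e ≫ Q.s) (hxy : x ≫ y = xy)
    (h' : (c.comp d h hxy).b ≫ (Poly.comp P Q).t = e.e ≫ R.s) (ht : xy ≫ w = t)
    (hyw : y ≫ w = yw) :
    ((c.comp d h hxy).comp e h' ht).map (assocHom P Q R) =
      c.comp (d.comp e (by rw [← h', Cell.comp_t]) hyw) (by rw [h, Cell.comp_s])
        (by rw [← ht, ← hxy, ← hyw, Category.assoc]) := by
  obtain ⟨sq₁, sq₂, h1, h2⟩ := (c.comp d h hxy).exists_base e h' ht
  have h3 := h1.trans (congrArg (fun f ↦ Cell.base f sq₁) (split (compCell₁ (Poly.comp P Q) R)).eq)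
  obtain ⟨l, sqa, sqb, ha, hb⟩ := Cell.comp_cancel _ _ _ _ _ _ _ _ sq₁ h3
  subst hyw
  rw [assocHom, Cell.map_toHom]
  rw [Cell.comp_base _ _ _ _ sqa (sqb.paste_vert sq₂) _ (by
    rw [← ht, ← hxy, Category.assoc])]
  simp only [Cell.comp_base _ _ _ _ sqb sq₂ _ rfl, ← ha, ← hb, ← h2]

theorem Cell.map_assocInv (c : P.Cell x) (d : Q.Cell y) (e : R.Cell w) (hxy : x ≫ y = xy)
    (h' : d.b ≫ Q.t = e.e ≫ R.s) (hyw : y ≫ w = yw)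
    (h'' : c.b ≫ P.t = (d.comp e h' hyw).e ≫ (Poly.comp Q R).s) (ht : x ≫ yw = t) :
    (c.comp (d.comp e h' hyw) h'' ht).map (assocInv P Q R) =
      (c.comp d (by rw [h'', Cell.comp_s]) hxy).comp e (by rw [← h', Cell.comp_t])
        (by rw [← ht, ← hxy, ← hyw, Category.assoc]) := by
  obtain ⟨sq₁, sq₂, h1, h2⟩ := c.exists_base (d.comp e h' hyw) h'' ht
  have h3 := h2.trans (congrArg (fun f ↦ Cell.base f sq₂) (split (compCell₂ P (Poly.comp Q R))).eq)
  obtain ⟨l, sqa, sqb, ha, hb⟩ := Cell.comp_cancel _ _ _ _ _ _ _ _ sq₂ h3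
  subst hxy
  rw [assocInv, Cell.map_toHom]
  rw [Cell.comp_base _ _ _ _ (sq₁.paste_vert sqa) sqb _ (by
    rw [← ht, ← hyw, Category.assoc])]
  simp only [Cell.comp_base _ _ _ _ sq₁ sqa _ rfl, ← ha, ← hb, ← h1]

theorem Cell.comp_comp_eq (c : P.Cell x) (d : Q.Cell y) (e : R.Cell w) {yw' : Y ⟶ U}
    (h' : d.b ≫ Q.t = e.e ≫ R.s) (hyw : y ≫ w = yw) (hyw' : y ≫ w = yw')
    (h : c.b ≫ P.t = (d.comp e h' hyw).e ≫ (Poly.comp Q R).s)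
    (h'' : c.b ≫ P.t = (d.comp e h' hyw').e ≫ (Poly.comp Q R).s) (ht : x ≫ yw = t)
    (ht' : x ≫ yw' = t) :
    c.comp (d.comp e h' hyw) h ht = c.comp (d.comp e h' hyw') h'' ht' := by
  subst hyw hyw'
  rfl

end

theorem hom_ext₃ {S : Poly I L} {f g : comp (comp P Q) R ⟶ S}
    (H : ∀ {X Y Z W : C} {x : X ⟶ Y} {y : Y ⟶ Z} {z : Z ⟶ W} (c : P.Cell x) (d : Q.Cell y)
      (e : R.Cell z) (h : c.b ≫ P.t = d.e ≫ Q.s) (h' : d.b ≫ Q.t = e.e ≫ R.s),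
      ((c.comp d h rfl).comp e (by rw [Cell.comp_t, h']) rfl).map f =
        ((c.comp d h rfl).comp e (by rw [Cell.comp_t, h']) rfl).map g) : f = g := by
  apply hom_ext₂
  intro X Y Z x y z c e h hz
  obtain ⟨M, x', y', c', d', h', hx', rfl⟩ := c.exists_eq_comp
  subst hz hx'
  exact H c' d' e h' (by rw [← h, Cell.comp_t])

theorem hom_ext₃' {S : Poly I L} {f g : comp P (comp Q R) ⟶ S}
    (H : ∀ {X Y Z W : C} {x : X ⟶ Y} {y : Y ⟶ Z} {z : Z ⟶ W} (c : P.Cell x) (d : Q.Cell y)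
      (e : R.Cell z) (h : c.b ≫ P.t = d.e ≫ Q.s) (h' : d.b ≫ Q.t = e.e ≫ R.s),
      (c.comp (d.comp e h' rfl) (by rw [Cell.comp_s, h]) rfl).map f =
        (c.comp (d.comp e h' rfl) (by rw [Cell.comp_s, h]) rfl).map g) : f = g := by
  apply hom_ext₂
  intro X Y Z x y z c e h hz
  obtain ⟨M, x', y', c', d', h', hx', rfl⟩ := e.exists_eq_comp
  subst hz hx'
  exact H c c' d' (by rw [h, Cell.comp_s]) h'

/-- The associator. -/
@[simps]
noncomputable def associator (P : Poly I J) (Q : Poly J K) (R : Poly K L) :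
    comp (comp P Q) R ≅ comp P (comp Q R) where
  hom := assocHom P Q R
  inv := assocInv P Q R
  hom_inv_id := by
    apply hom_ext₃
    intro X Y Z W x y z c d e h h'
    rw [Cell.map_comp, Cell.map_assocHom _ _ _ _ _ _ _ rfl,
      Cell.map_assocInv _ _ _ rfl, Cell.map_id]
  inv_hom_id := by
    apply hom_ext₃'
    intro X Y Z W x y z c d e h h'
    rw [Cell.map_comp, Cell.map_assocInv _ _ _ rfl, Cell.map_assocHom _ _ _ _ _ _ _ rfl,
      Cell.map_id]

/-! ### The unitors -/

theorem Cell.isIso_of_idPoly (c : (idPoly I).Cell x) : IsIso x := by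
  have h : IsPullback c.e x (𝟙 I) c.b := c.isPullback
  exact h.isIso_snd_of_isIso

/-- A structure for an identity polynomial on the left can be absorbed. -/
@[simps]
def Cell.unitL (c : (idPoly I).Cell x) (d : P.Cell y) (hz : x ≫ y = z) : P.Cell z where
  e := x ≫ d.e
  b := d.b
  isPullback := by
    have := c.isIso_of_idPoly
    rw [← hz]
    have h : IsPullback (x ≫ d.e) x (𝟙 _) d.e := IsPullback.of_vert_isIso ⟨by simp⟩
    simpa using h.paste_vert d.isPullback

/-- A structure for an identity polynomial on the right can be absorbed. -/
@[simps]
noncomputable def Cell.unitR (c : P.Cell x) (d : (idPoly J).Cell y) (hz : x ≫ y = z) :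
    P.Cell z where
  e := c.e
  b := haveI := d.isIso_of_idPoly; inv y ≫ c.b
  isPullback := by
    have := d.isIso_of_idPoly
    rw [← hz]
    have h : IsPullback c.b y (𝟙 _) (inv y ≫ c.b) := IsPullback.of_vert_isIso ⟨by simp⟩
    simpa using c.isPullback.paste_vert h

/-- The trivial structure on an identity morphism. -/
@[simps]
def unitCell (f : X ⟶ I) : (idPoly I).Cell (𝟙 X) := ⟨f, f, IsPullback.of_vert_isIso ⟨by simp⟩⟩

noncomputable def leftUnitorHom (P : Poly I J) : comp (idPoly I) P ⟶ P :=
  ((compCell₁ (idPoly I) P).unitL (compCell₂ (idPoly I) P) (compLeft_compRight _ _)).toHom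
    (by
      have h1 := comp_condition (idPoly I) P
      have h2 := (compCell₁ (idPoly I) P).isPullback.w
      simp only [Category.comp_id] at h1 h2
      simp [comp_s, ← h1, h2])
    (by simp [comp_t])

noncomputable def leftUnitorInv (P : Poly I J) : P ⟶ comp (idPoly I) P :=
  ((unitCell P.s).comp P.idCell (by simp [idCell]) (Category.id_comp _)).toHom
    (by simp [Cell.comp_s]) (by simp [Cell.comp_t, idCell])

noncomputable def rightUnitorHom (P : Poly I J) : comp P (idPoly J) ⟶ P :=
  ((compCell₁ P (idPoly J)).unitR (compCell₂ P (idPoly J)) (compLeft_compRight _ _)).toHom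
    (by simp [comp_s])
    (by
      have := (compCell₂ P (idPoly J)).isIso_of_idPoly
      have h1 := comp_condition P (idPoly J)
      have h2 := (compCell₂ P (idPoly J)).isPullback.w
      simp only [Category.comp_id] at h1 h2
      simp [comp_t, h1, h2])

noncomputable def rightUnitorInv (P : Poly I J) : P ⟶ comp P (idPoly J) :=
  (P.idCell.comp (unitCell P.t) (by simp [idCell]) (Category.comp_id _)).toHom
    (by simp [Cell.comp_s, idCell]) (by simp [Cell.comp_t])

theorem Cell.map_leftUnitorHom (c : (idPoly I).Cell x) (d : P.Cell y)
    (h : c.b ≫ (idPoly I).t = d.e ≫ P.s) (hz : x ≫ y = z) :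
    (c.comp d h hz).map (leftUnitorHom P) = c.unitL d hz := by
  obtain ⟨sq₁, sq₂, h1, h2⟩ := c.exists_base d h hz
  rw [leftUnitorHom, Cell.map_toHom]
  ext
  · have := sq₁.w
    simp only [base_e, unitL_e]
    conv_rhs => rw [h2, base_e, ← Category.assoc, ← this, Category.assoc]
  · conv_rhs => rw [unitL_b, h2]
    simp

theorem Cell.map_rightUnitorHom (c : P.Cell x) (d : (idPoly J).Cell y)
    (h : c.b ≫ P.t = d.e ≫ (idPoly J).s) (hz : x ≫ y = z) :
    (c.comp d h hz).map (rightUnitorHom P) = c.unitR d hz := by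
  obtain ⟨sq₁, sq₂, h1, h2⟩ := c.exists_base d h hz
  have := d.isIso_of_idPoly
  have := (compCell₂ P (idPoly J)).isIso_of_idPoly
  rw [rightUnitorHom, Cell.map_toHom]
  ext
  · conv_rhs => rw [unitR_e, h1]
    simp
  · conv_rhs => rw [unitR_b, h1]
    simp [← reassoc_of% sq₂.w]

theorem Cell.map_leftUnitorInv (d : P.Cell x) :
    d.map (leftUnitorInv P) = (unitCell (d.e ≫ P.s)).comp d (by simp) (Category.id_comp _) := by
  rw [leftUnitorInv, Cell.map_toHom, Cell.comp_base _ _ _ _ (IsPullback.of_vert_isIso ⟨by simp⟩)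
    d.isPullback _ (Category.id_comp _)]
  congr 1 <;> (ext <;> simp [idCell])

theorem Cell.map_rightUnitorInv (c : P.Cell x) :
    c.map (rightUnitorInv P) = c.comp (unitCell (c.b ≫ P.t)) (by simp) (Category.comp_id _) := by
  rw [rightUnitorInv, Cell.map_toHom, Cell.comp_base _ _ _ _ c.isPullback
    (IsPullback.of_vert_isIso ⟨by simp⟩) _ (Category.comp_id _)]
  congr 1 <;> (ext <;> simp [idCell])

theorem Cell.unitCell_comp_unitL (c : (idPoly I).Cell x) (d : P.Cell y)
    (h : c.b ≫ (idPoly I).t = d.e ≫ P.s) (hz : x ≫ y = z) {f : X ⟶ I}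
    (hf : (unitCell f).b ≫ (idPoly I).t = (c.unitL d hz).e ≫ P.s) :
    (unitCell f).comp (c.unitL d hz) hf (Category.id_comp _) = c.comp d h hz := by
  have := c.isIso_of_idPoly
  rw [← Cell.base_id (c.comp d h hz) (IsPullback.of_horiz_isIso ⟨by simp⟩),
    Cell.comp_base _ _ _ _ (l := x) (x' := 𝟙 X) (y' := z) (IsPullback.of_vert_isIso ⟨by simp⟩)
      (by rw [← hz]; exact IsPullback.of_horiz_isIso ⟨by simp⟩) _ (Category.id_comp _)]
  have hw := c.isPullback.w
  simp only [Category.comp_id] at hw h hf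
  have hf' : f = x ≫ c.b := by
    rw [h]; simpa using hf
  congr 1
  · ext
    · simp [hf', hw]
    · simp [hf']
  · ext <;> simp

theorem Cell.comp_unitCell_unitR (c : P.Cell x) (d : (idPoly J).Cell y)
    (h : c.b ≫ P.t = d.e ≫ (idPoly J).s) (hz : x ≫ y = z) {f : Z ⟶ J}
    (hf : (c.unitR d hz).b ≫ P.t = (unitCell f).e ≫ (idPoly J).s) :
    (c.unitR d hz).comp (unitCell f) hf (Category.comp_id _) = c.comp d h hz := by
  have := d.isIso_of_idPoly
  have hw := d.isPullback.w
  simp only [Category.comp_id] at hw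
  have hf' : f = d.b := by
    have h' := h
    have hf' := hf
    simp only [Category.comp_id] at h' hf'
    rw [← cancel_epi y]
    refine .trans ?_ hw
    rw [← h']
    simp at hf'
    simp [← hf']
  rw [← Cell.base_id (c.comp d h hz) (IsPullback.of_horiz_isIso ⟨by simp⟩),
    Cell.comp_base _ _ _ _ (l := inv y) (x' := z) (y' := 𝟙 Z)
      (IsPullback.of_horiz_isIso ⟨by simp [← hz]⟩)
      (IsPullback.of_vert_isIso ⟨by simp⟩) _ (Category.comp_id _)]
  congr 1
  · ext <;> simp
  · ext
    · simp [hf', hw]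
    · simp [hf']

theorem Cell.comp_unitL (c : P.Cell x) (d : (idPoly J).Cell y) {w : Z ⟶ W} (e : Q.Cell w)
    {xy : X ⟶ Z} {yw : Y ⟶ W} {t : X ⟶ W} (hxy : x ≫ y = xy) (hyw : y ≫ w = yw) (ht : xy ≫ w = t)
    (h : (c.unitR d hxy).b ≫ P.t = e.e ≫ Q.s) (h' : c.b ≫ P.t = (d.unitL e hyw).e ≫ Q.s)
    (ht' : x ≫ yw = t) :
    c.comp (d.unitL e hyw) h' ht' = (c.unitR d hxy).comp e h ht := by
  have := d.isIso_of_idPoly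
  rw [← Cell.base_id ((c.unitR d hxy).comp e h ht) (IsPullback.of_horiz_isIso ⟨by simp⟩),
    Cell.comp_base _ _ _ _ (l := y) (x' := x) (y' := yw)
      (IsPullback.of_horiz_isIso ⟨by simp [← hxy]⟩)
      (by rw [← hyw]; exact IsPullback.of_horiz_isIso ⟨by simp⟩) _ ht']
  congr 1
  · ext <;> simp
  · ext <;> simp

/-- The left unitor. -/
@[simps]
noncomputable def leftUnitor (P : Poly I J) : comp (idPoly I) P ≅ P where
  hom := leftUnitorHom P
  inv := leftUnitorInv P
  hom_inv_id := by
    apply hom_ext₂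
    intro X Y Z x y z c d h hz
    rw [Cell.map_comp, Cell.map_leftUnitorHom, Cell.map_leftUnitorInv,
      Cell.unitCell_comp_unitL _ _ h, Cell.map_id]
  inv_hom_id := by
    apply hom_ext_cell
    rw [Cell.map_comp, Cell.map_leftUnitorInv, Cell.map_leftUnitorHom, Cell.map_id]
    ext <;> simp

/-- The right unitor. -/
@[simps]
noncomputable def rightUnitor (P : Poly I J) : comp P (idPoly J) ≅ P where
  hom := rightUnitorHom P
  inv := rightUnitorInv P
  hom_inv_id := by
    apply hom_ext₂
    intro X Y Z x y z c d h hz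
    rw [Cell.map_comp, Cell.map_rightUnitorHom, Cell.map_rightUnitorInv,
      Cell.comp_unitCell_unitR _ _ h, Cell.map_id]
  inv_hom_id := by
    apply hom_ext_cell
    rw [Cell.map_comp, Cell.map_rightUnitorInv, Cell.map_rightUnitorHom, Cell.map_id]
    ext <;> simp

end Cells

end Poly

end PolyBicategory

end PolyOpd

namespace PolyOpd

universe w v u

section PolyBicat

variable {C : Type u} [Category.{v} C] [HasPullbacks C]

/-- The objects of the bicategory of polynomials in `C` are the objects of `C`. -/
structure PolyBicat (C : Type u) where
  obj : C

namespace Poly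

/-- The bicategory of polynomials in `C`; `P ≫ Q` is the composite of `P` followed by `Q`. -/
noncomputable instance : Bicategory (PolyBicat C) where
  Hom I J := Poly I.obj J.obj
  id I := idPoly I.obj
  comp P Q := Poly.comp P Q
  homCategory I J := inferInstanceAs (Category (Poly I.obj J.obj))
  whiskerLeft P _ _ g := hcomp (𝟙 P) g
  whiskerRight f Q := hcomp f (𝟙 Q)
  associator P Q R := Poly.associator P Q R
  leftUnitor P := Poly.leftUnitor P
  rightUnitor P := Poly.rightUnitor P
  whiskerLeft_id P Q := by
    apply hom_ext₂
    intro X Y Z x y z c d h hz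
    rw [Cell.map_hcomp]
    simp only [Cell.map_id]
  whiskerLeft_comp P Q Q' Q'' f g := by
    apply hom_ext₂
    intro X Y Z x y z c d h hz
    simp only [Cell.map_comp, Cell.map_hcomp, Cell.map_id]
  id_whiskerLeft {I J P Q} f := by
    apply hom_ext₂
    intro X Y Z x y z c d h hz
    have key : (c.unitL d hz).map f = c.unitL (d.map f) hz := by ext <;> simp
    simp only [Cell.map_comp, Cell.map_hcomp, Cell.map_id, leftUnitor_hom, leftUnitor_inv,
      Cell.map_leftUnitorHom, Cell.map_leftUnitorInv, key]
    rw [Cell.unitCell_comp_unitL]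
  comp_whiskerLeft P Q R R' f := by
    apply hom_ext₃
    intro X Y Z W x y z c d e h h'
    simp only [Cell.map_comp, Cell.map_hcomp, Cell.map_id, associator_hom, associator_inv,
      Cell.map_assocHom _ _ _ _ _ _ _ rfl, Cell.map_assocInv _ _ _ rfl]
  id_whiskerRight P Q := by
    apply hom_ext₂
    intro X Y Z x y z c d h hz
    rw [Cell.map_hcomp]
    simp only [Cell.map_id]
  comp_whiskerRight f g Q := by
    apply hom_ext₂
    intro X Y Z x y z c d h hz
    simp only [Cell.map_comp, Cell.map_hcomp, Cell.map_id]
  whiskerRight_id {I J P Q} f := by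
    apply hom_ext₂
    intro X Y Z x y z c d h hz
    have key : (c.unitR d hz).map f = (c.map f).unitR d hz := by ext <;> simp
    simp only [Cell.map_comp, Cell.map_hcomp, Cell.map_id, rightUnitor_hom, rightUnitor_inv,
      Cell.map_rightUnitorHom, Cell.map_rightUnitorInv, key]
    rw [Cell.comp_unitCell_unitR]
  whiskerRight_comp f Q R := by
    apply hom_ext₃'
    intro X Y Z W x y z c d e h h'
    simp only [Cell.map_comp, Cell.map_hcomp, Cell.map_id, associator_hom, associator_inv,
      Cell.map_assocHom _ _ _ _ _ _ _ rfl, Cell.map_assocInv _ _ _ rfl]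
  whisker_assoc P Q Q' f R := by
    apply hom_ext₃
    intro X Y Z W x y z c d e h h'
    simp only [Cell.map_comp, Cell.map_hcomp, Cell.map_id, associator_hom, associator_inv,
      Cell.map_assocHom _ _ _ _ _ _ _ rfl, Cell.map_assocInv _ _ _ rfl]
  whisker_exchange f g := by
    apply hom_ext₂
    intro X Y Z x y z c d h hz
    simp only [Cell.map_comp, Cell.map_hcomp, Cell.map_id]
  pentagon P Q R S := by
    apply hom_ext₃
    intro X Z U W z u v c e k h h'
    obtain ⟨Y, x, y, c, d, h'', hz, rfl⟩ := c.exists_eq_comp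
    simp only [Cell.map_comp, associator_hom, Cell.map_hcomp, Cell.map_id,
      Cell.map_assocHom _ _ _ _ _ _ _ rfl]
    apply Cell.comp_comp_eq
  triangle P Q := by
    apply hom_ext₃
    intro X Y Z W x y z c d e h h'
    simp only [Cell.map_comp, Cell.map_hcomp, Cell.map_id, associator_hom, leftUnitor_hom,
      rightUnitor_hom]
    rw [Cell.map_assocHom _ _ _ _ _ _ _ rfl, Cell.map_hcomp]
    simp only [Cell.map_id, Cell.map_leftUnitorHom, Cell.map_rightUnitorHom]
    apply Cell.comp_unitL

end Poly

end PolyBicat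

end PolyOpd

namespace PolyOpd

universe w v u

section PolyMnd

variable {C : Type u} [Category.{v} C]

namespace Poly

variable [HasPullbacks C] {I J K I' J' K' : C}

/-- Postcomposition of the outer legs of a polynomial with `f` and `g`: the composite polynomial
`g^• ∘ P ∘ f_•`. -/
abbrev push (P : Poly I J) (f : I ⟶ I') (g : J ⟶ J') : Poly I' J' where
  E := P.E
  B := P.B
  s := P.s ≫ f
  p := P.p
  t := P.t ≫ g
  exponentiable := P.exponentiable

/-- Whiskering of a 2-cell `φ` to `g^• ∘ φ ∘ f_•`. -/
@[simps!]
def pushMap {P Q : Poly I J} (φ : P ⟶ Q) (f : I ⟶ I') (g : J ⟶ J') : P.push f g ⟶ Q.push f g :=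
  Hom.mk φ.f₁ φ.f₂ (by rw [← Category.assoc, φ.w_s]) (by rw [← Category.assoc, φ.w_t]) φ.isPullback

/-- The 2-cell `f^• ∘ f_• ⟶ 1` induced by a morphism `f`. -/
@[simps!]
def pushId (f : I ⟶ J) : (idPoly I).push f f ⟶ idPoly J :=
  Hom.mk f f (by simp) (by simp) (IsPullback.of_vert_isIso ⟨by simp⟩)

/-- A structure for `P` is a structure for `P.push f g`. -/
@[simps]
def Cell.push {P : Poly I J} {X Y : C} {x : X ⟶ Y} (c : P.Cell x) (f : I ⟶ I') (g : J ⟶ J') :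
    (P.push f g).Cell x :=
  ⟨c.e, c.b, c.isPullback⟩

/-- The 2-cell `h^• ∘ Q ∘ P ∘ f_• ⟶ (h^• ∘ Q ∘ g_•) ∘ (g^• ∘ P ∘ f_•)` induced by a morphism `g`. -/
noncomputable def pushComp (P : Poly I J) (Q : Poly J K) (f : I ⟶ I') (g : J ⟶ J') (h : K ⟶ K') :
    (comp P Q).push f h ⟶ comp (P.push f g) (Q.push g h) :=
  Cell.toHom (P := (comp P Q).push f h) (((compCell₁ P Q).push f g).comp
      ((compCell₂ P Q).push g h) (by simp [reassoc_of% comp_condition P Q])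
      (compLeft_compRight P Q))
    (by rw [Cell.comp_s]; simp [comp_s]) (by rw [Cell.comp_t]; simp [comp_t])

theorem Cell.map_pushComp {P : Poly I J} {Q : Poly J K} {X Y Z : C} {x : X ⟶ Y} {y : Y ⟶ Z}
    {z : X ⟶ Z} (c : P.Cell x) (d : Q.Cell y) (w : c.b ≫ P.t = d.e ≫ Q.s) (hz : x ≫ y = z)
    (f : I ⟶ I') (g : J ⟶ J') (h : K ⟶ K') :
    ((c.comp d w hz).push f h).map (pushComp P Q f g h) =
      (c.push f g).comp (d.push g h) (by simp [reassoc_of% w]) hz := by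
  obtain ⟨sq₁, sq₂, h1, h2⟩ := c.exists_base d w hz
  rw [pushComp, Cell.map_toHom]
  refine (Cell.comp_base (P := P.push f g) (Q := Q.push g h) _ _ _ _ sq₁ sq₂ _ hz).trans ?_
  congr 1
  · conv_rhs => rw [h1]
    rfl
  · conv_rhs => rw [h2]
    rfl

end Poly

/-- Polynomial endomorphisms in `C`. -/
structure PolyEnd (C : Type u) [Category.{v} C] [HasPullbacks C] where
  I : C
  P : Poly I I

variable [HasPullbacks C]

/-- A morphism `(I, P) ⟶ (J, Q)` is a morphism `f : I ⟶ J` with a 2-cell `f^• ∘ P ∘ f_• ⟶ Q`. -/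
@[ext]
structure PolyEnd.Hom (X Y : PolyEnd C) where
  f : X.I ⟶ Y.I
  φ : X.P.push f f ⟶ Y.P

/-- The action of a morphism of polynomial endomorphisms on structures. -/
@[simps!]
def PolyEnd.Hom.app {X Y : PolyEnd C} (F : PolyEnd.Hom X Y) {A B : C} {x : A ⟶ B}
    (c : X.P.Cell x) : Y.P.Cell x :=
  (c.push F.f F.f).map F.φ

theorem PolyEnd.Hom.app_s {X Y : PolyEnd C} (F : PolyEnd.Hom X Y) {A B : C} {x : A ⟶ B}
    (c : X.P.Cell x) : (F.app c).e ≫ Y.P.s = c.e ≫ X.P.s ≫ F.f := by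
  simp [F.φ.w_s]

theorem PolyEnd.Hom.app_t {X Y : PolyEnd C} (F : PolyEnd.Hom X Y) {A B : C} {x : A ⟶ B}
    (c : X.P.Cell x) : (F.app c).b ≫ Y.P.t = c.b ≫ X.P.t ≫ F.f := by
  simp [F.φ.w_t]

theorem PolyEnd.Hom.ext_app {X Y : PolyEnd C} {F G : PolyEnd.Hom X Y} (hf : F.f = G.f)
    (h : F.app X.P.idCell = G.app X.P.idCell) : F = G := by
  obtain ⟨f, φ⟩ := F
  obtain ⟨g, ψ⟩ := G
  obtain rfl : f = g := hf
  congr 1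
  have h1 := congrArg Poly.Cell.b h
  have h2 := congrArg Poly.Cell.e h
  ext
  · simpa [Poly.idCell] using h1
  · simpa [Poly.idCell] using h2

/-- Morphisms compose by stacking diagrams. -/
instance : Category (PolyEnd C) where
  Hom := PolyEnd.Hom
  id X := ⟨𝟙 X.I, Poly.Hom.mk (𝟙 _) (𝟙 _) (by simp) (by simp) X.P.idCell.isPullback⟩
  comp F G := ⟨F.f ≫ G.f, Poly.Hom.mk (F.φ.f₁ ≫ G.φ.f₁) (F.φ.f₂ ≫ G.φ.f₂)
    (by
      have h1 := F.φ.w_s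
      have h2 := G.φ.w_s
      simp [h2, reassoc_of% h1])
    (by
      have h1 := F.φ.w_t
      have h2 := G.φ.w_t
      simp [h2, reassoc_of% h1])
    (F.φ.isPullback.paste_horiz G.φ.isPullback)⟩
  id_comp F := PolyEnd.Hom.ext_app (by simp) (by ext <;> simp)
  comp_id F := PolyEnd.Hom.ext_app (by simp) (by ext <;> simp)
  assoc F G H := PolyEnd.Hom.ext_app (by simp) (by ext <;> simp)

namespace PolyEnd

@[simp] theorem id_f (X : PolyEnd C) : PolyEnd.Hom.f (𝟙 X) = 𝟙 X.I := rfl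

@[simp] theorem comp_f {X Y Z : PolyEnd C} (F : X ⟶ Y) (G : Y ⟶ Z) :
    PolyEnd.Hom.f (F ≫ G) = F.f ≫ G.f := rfl

theorem id_app {X : PolyEnd C} {A B : C} {x : A ⟶ B} (c : X.P.Cell x) :
    PolyEnd.Hom.app (𝟙 X) c = c := by
  ext
  · exact Category.comp_id _
  · exact Category.comp_id _

theorem comp_app {X Y Z : PolyEnd C} (F : X ⟶ Y) (G : Y ⟶ Z) {A B : C} {x : A ⟶ B}
    (c : X.P.Cell x) : PolyEnd.Hom.app (F ≫ G) c = G.app (F.app c) := by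
  ext
  · exact (Category.assoc _ _ _).symm
  · exact (Category.assoc _ _ _).symm

end PolyEnd

/-- Polynomial monads in `C`: an object `I` with a monad on `I` in the bicategory of polynomials,
that is, a monoid for the composition of polynomials from `I` to `I`. -/
structure PolyMnd (C : Type u) [Category.{v} C] [HasPullbacks C] where
  I : PolyBicat C
  P : I ⟶ I
  [mon : MonObj P]

namespace PolyMnd

/-- The underlying polynomial endomorphism. -/
abbrev toEnd (M : PolyMnd C) : PolyEnd C := ⟨M.I.obj, M.P⟩

/-- The unit. -/
def one (M : PolyMnd C) : Poly.idPoly M.I.obj ⟶ M.toEnd.P := M.mon.one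

/-- The multiplication. -/
def mul (M : PolyMnd C) : Poly.comp M.toEnd.P M.toEnd.P ⟶ M.toEnd.P := M.mon.mul

/-- Morphisms of polynomial monads: morphisms `(f, φ)` of polynomial endomorphisms whose mate
`P ⟶ f_• ∘ Q ∘ f^•` is a morphism of monads. Here the two conditions are transposed along the
adjunction `f^• ⊣ f_•`: the counit of the adjunction is `pushId`, and `pushComp` inserts its unit. -/
@[ext]
structure Hom (M N : PolyMnd C) extends PolyEnd.Hom M.toEnd N.toEnd where
  map_one : Poly.pushMap M.one f f ≫ φ = Poly.pushId f ≫ N.one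
  map_mul : Poly.pushMap M.mul f f ≫ φ =
    Poly.pushComp M.toEnd.P M.toEnd.P f f f ≫ Poly.hcomp φ φ ≫ N.mul

end PolyMnd

namespace PolyMnd


/-- The action on structures of the multiplication of a polynomial monad. -/
noncomputable def mulCell (M : PolyMnd C) {X Y Z : C} {x : X ⟶ Y} {y : Y ⟶ Z} {z : X ⟶ Z}
    (c : M.toEnd.P.Cell x) (d : M.toEnd.P.Cell y) (h : c.b ≫ M.toEnd.P.t = d.e ≫ M.toEnd.P.s)
    (hz : x ≫ y = z) : M.toEnd.P.Cell z :=
  (c.comp d h hz).map M.mul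

/-- The action on structures of the unit of a polynomial monad. -/
def oneCell (M : PolyMnd C) {X : C} (f : X ⟶ M.I.obj) : M.toEnd.P.Cell (𝟙 X) :=
  (Poly.unitCell f).map M.one

theorem mulCell_s (M : PolyMnd C) {X Y Z : C} {x : X ⟶ Y} {y : Y ⟶ Z} {z : X ⟶ Z}
    (c : M.toEnd.P.Cell x) (d : M.toEnd.P.Cell y) (h : c.b ≫ M.toEnd.P.t = d.e ≫ M.toEnd.P.s)
    (hz : x ≫ y = z) : (M.mulCell c d h hz).e ≫ M.toEnd.P.s = c.e ≫ M.toEnd.P.s := by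
  have := c.comp_s d h hz
  rw [← this]
  simp [mulCell, M.mul.w_s]

theorem mulCell_t (M : PolyMnd C) {X Y Z : C} {x : X ⟶ Y} {y : Y ⟶ Z} {z : X ⟶ Z}
    (c : M.toEnd.P.Cell x) (d : M.toEnd.P.Cell y) (h : c.b ≫ M.toEnd.P.t = d.e ≫ M.toEnd.P.s)
    (hz : x ≫ y = z) : (M.mulCell c d h hz).b ≫ M.toEnd.P.t = d.b ≫ M.toEnd.P.t := by
  have := c.comp_t d h hz
  rw [← this]
  simp [mulCell, M.mul.w_t]

/-- A morphism of polynomial endomorphisms which preserves units and products of structures is a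
morphism of polynomial monads. -/
def Hom.ofApp {M N : PolyMnd C} (F : PolyEnd.Hom M.toEnd N.toEnd)
    (h₁ : ∀ {X : C} (x : X ⟶ M.I.obj), F.app (M.oneCell x) = N.oneCell (x ≫ F.f))
    (h₂ : ∀ {X Y Z : C} {x : X ⟶ Y} {y : Y ⟶ Z} {z : X ⟶ Z}
      (c : M.toEnd.P.Cell x) (d : M.toEnd.P.Cell y)
      (h : c.b ≫ M.toEnd.P.t = d.e ≫ M.toEnd.P.s) (hz : x ≫ y = z),
      F.app (M.mulCell c d h hz) =
        N.mulCell (F.app c) (F.app d) (by rw [F.app_s, F.app_t, reassoc_of% h]) hz) :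
    Hom M N where
  toHom := F
  map_one := by
    apply Poly.hom_ext_cell
    rw [Poly.Cell.map_comp, Poly.Cell.map_comp]
    exact h₁ (𝟙 M.I.obj)
  map_mul := by
    apply Poly.hom_ext_cell
    have h := Poly.idCell_comp M.toEnd.P M.toEnd.P
    have h' : ((Poly.comp M.toEnd.P M.toEnd.P).push F.f F.f).idCell =
      (Poly.Cell.push ((Poly.compCell₁ M.toEnd.P M.toEnd.P).comp (Poly.compCell₂ M.toEnd.P M.toEnd.P)
        (Poly.comp_condition _ _) (Poly.compLeft_compRight _ _)) F.f F.f) := by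
      rw [← h]; rfl
    rw [h', Poly.Cell.map_comp, Poly.Cell.map_comp, Poly.Cell.map_comp, Poly.Cell.map_pushComp,
      Poly.Cell.map_hcomp]
    exact h₂ _ _ (Poly.comp_condition _ _) (Poly.compLeft_compRight _ _)

theorem Hom.app_oneCell {M N : PolyMnd C} (F : Hom M N) {X : C} (x : X ⟶ M.I.obj) :
    F.app (M.oneCell x) = N.oneCell (x ≫ F.f) := by
  have := congrArg (fun k ↦ ((Poly.unitCell x).push F.f F.f).map k) F.map_one
  dsimp only at this
  rw [Poly.Cell.map_comp, Poly.Cell.map_comp] at this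
  refine Eq.trans ?_ (this.trans ?_)
  · rfl
  · rfl

theorem Hom.app_mulCell {M N : PolyMnd C} (F : Hom M N) {X Y Z : C} {x : X ⟶ Y} {y : Y ⟶ Z}
    {z : X ⟶ Z} (c : M.toEnd.P.Cell x) (d : M.toEnd.P.Cell y)
    (h : c.b ≫ M.toEnd.P.t = d.e ≫ M.toEnd.P.s) (hz : x ≫ y = z) :
    F.app (M.mulCell c d h hz) =
      N.mulCell (F.app c) (F.app d) (by rw [F.app_s, F.app_t, reassoc_of% h]) hz := by
  have := congrArg (fun k ↦ ((c.comp d h hz).push F.f F.f).map k) F.map_mul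
  dsimp only at this
  rw [Poly.Cell.map_comp, Poly.Cell.map_comp, Poly.Cell.map_comp, Poly.Cell.map_pushComp,
    Poly.Cell.map_hcomp] at this
  exact this

theorem hom_ext_toHom {M N : PolyMnd C} {F G : Hom M N} (h : F.toHom = G.toHom) : F = G := by
  obtain ⟨F, h₁, h₂⟩ := F
  obtain ⟨G, h₃, h₄⟩ := G
  obtain rfl : F = G := h
  rfl

/-- The category of polynomial monads. -/
instance : Category (PolyMnd C) where
  Hom := Hom
  id M := Hom.ofApp (𝟙 M.toEnd)
    (fun x ↦ by rw [PolyEnd.id_app, PolyEnd.id_f, Category.comp_id])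
    (fun c d h hz ↦ by simp only [PolyEnd.id_app])
  comp F G := Hom.ofApp (CategoryStruct.comp (obj := PolyEnd C) F.toHom G.toHom)
    (fun x ↦ by rw [PolyEnd.comp_app, F.app_oneCell, G.app_oneCell, PolyEnd.comp_f, Category.assoc])
    (fun c d h hz ↦ by simp only [PolyEnd.comp_app, F.app_mulCell, G.app_mulCell])
  id_comp F := hom_ext_toHom (Category.id_comp (obj := PolyEnd C) F.toHom)
  comp_id F := hom_ext_toHom (Category.comp_id (obj := PolyEnd C) F.toHom)
  assoc F G H := hom_ext_toHom (Category.assoc (obj := PolyEnd C) F.toHom G.toHom H.toHom)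

/-- A monoid in the category of endomorphisms of an object of the bicategory of polynomials, from
a unit and a multiplication whose action on structures is unital and associative. -/
abbrev monOfCell {I : C} (P : Poly I I) (η : Poly.idPoly I ⟶ P) (μ : Poly.comp P P ⟶ P)
    (h₁ : ∀ {X Y : C} {x : X ⟶ Y} (c : P.Cell x), (((Poly.unitCell (c.e ≫ P.s)).map η).comp c
      (by simp [η.w_t]) (Category.id_comp _)).map μ = c)
    (h₂ : ∀ {X Y : C} {x : X ⟶ Y} (c : P.Cell x), (c.comp ((Poly.unitCell (c.b ≫ P.t)).map η)
      (by simp [η.w_s]) (Category.comp_id _)).map μ = c)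
    (h₃ : ∀ {X Y Z W : C} {x : X ⟶ Y} {y : Y ⟶ Z} {z : Z ⟶ W} (c : P.Cell x)
      (d : P.Cell y) (e : P.Cell z) (w : c.b ≫ P.t = d.e ≫ P.s)
      (w' : d.b ≫ P.t = e.e ≫ P.s),
      (((c.comp d w rfl).map μ).comp e (by simp [μ.w_t, Poly.Cell.comp_t, w']) rfl).map μ =
        (c.comp ((d.comp e w' rfl).map μ) (by simp [μ.w_s, Poly.Cell.comp_s, w])
          (by rw [Category.assoc])).map μ) :
    @MonObj (PolyBicat.mk I ⟶ PolyBicat.mk I) _ _ P where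
  one := η
  mul := μ
  one_mul := by
    refine (Iso.inv_comp_eq (Poly.leftUnitor P)).1 ?_ |>.trans (Category.comp_id _)
    apply Poly.hom_ext_cell
    refine (Poly.Cell.map_comp _ _ _).trans ?_
    refine (congrArg (fun f ↦ Poly.Cell.map f _) (Poly.Cell.map_leftUnitorInv _)).trans ?_
    refine (Poly.Cell.map_comp _ _ _).trans ?_
    refine (congrArg (fun f ↦ Poly.Cell.map f _) (Poly.Cell.map_hcomp _ _ _ _ _ _)).trans ?_
    simp only [Poly.Cell.map_id]
    exact h₁ _
  mul_one := by
    refine (Iso.inv_comp_eq (Poly.rightUnitor P)).1 ?_ |>.trans (Category.comp_id _)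
    apply Poly.hom_ext_cell
    refine (Poly.Cell.map_comp _ _ _).trans ?_
    refine (congrArg (fun f ↦ Poly.Cell.map f _) (Poly.Cell.map_rightUnitorInv _)).trans ?_
    refine (Poly.Cell.map_comp _ _ _).trans ?_
    refine (congrArg (fun f ↦ Poly.Cell.map f _) (Poly.Cell.map_hcomp _ _ _ _ _ _)).trans ?_
    simp only [Poly.Cell.map_id]
    exact h₂ _
  mul_assoc := by
    apply Poly.hom_ext₃
    intro X Y Z W x y z c d e h h'
    refine (Poly.Cell.map_comp _ _ _).trans ?_
    refine (congrArg (fun f ↦ Poly.Cell.map f _) (Poly.Cell.map_hcomp _ _ _ _ _ _)).trans ?_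
    refine Eq.trans ?_ (Poly.Cell.map_comp _ _ _).symm
    refine Eq.trans ?_ (congrArg (fun f ↦ Poly.Cell.map f _)
      (Poly.Cell.map_assocHom _ _ _ h rfl _ rfl rfl)).symm
    refine Eq.trans ?_ (Poly.Cell.map_comp _ _ _).symm
    refine Eq.trans ?_ (congrArg (fun f ↦ Poly.Cell.map f _)
      (Poly.Cell.map_hcomp _ _ _ _ _ _)).symm
    simp only [Poly.Cell.map_id]
    exact h₃ c d e h h'

end PolyMnd

end PolyMnd

end PolyOpd

namespace PolyOpd

universe u

section Perms

/-- The objects of the category `ℙ` of natural numbers and permutations. -/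
@[ext]
structure PermCat : Type u where
  n : ℕ

/-- The arrows of `ℙ`: there is one from `m` to `n` only if `m = n`. -/
@[ext]
structure PermCat.Hom (a b : PermCat.{u}) : Type u where
  perm : Fin a.n ≃ Fin b.n

instance : Category.{u} PermCat.{u} where
  Hom := PermCat.Hom
  id a := ⟨Equiv.refl _⟩
  comp f g := ⟨f.perm.trans g.perm⟩

@[ext]
theorem PermCat.hom_ext {a b : PermCat.{u}} {f g : a ⟶ b} (h : ∀ j, f.perm j = g.perm j) : f = g :=
  PermCat.Hom.ext (Equiv.ext h)

@[simp] theorem PermCat.id_perm (a : PermCat.{u}) (j : Fin a.n) :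
    PermCat.Hom.perm (𝟙 a) j = j := rfl

@[simp] theorem PermCat.comp_perm {a b c : PermCat.{u}} (f : a ⟶ b) (g : b ⟶ c) (j : Fin a.n) :
    (f ≫ g).perm j = g.perm (f.perm j) := rfl

variable {Y : Type u} [Category.{u} Y]

/-- For a functor `b` to `ℙ`, the category of pairs `(y, j)` with `1 ≤ j ≤ b y`. -/
@[ext]
structure Pointed (b : Y ⥤ PermCat.{u}) : Type u where
  base : Y
  pt : Fin (b.obj base).n

/-- The arrows `(y, j) ⟶ (y', j')` are the arrows `v : y ⟶ y'` such that `b v` sends `j` to `j'`. -/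
@[ext]
structure Pointed.Hom {b : Y ⥤ PermCat.{u}} (a a' : Pointed b) : Type u where
  val : a.base ⟶ a'.base
  map_pt : (b.map val).perm a.pt = a'.pt

instance (b : Y ⥤ PermCat.{u}) : Category.{u} (Pointed b) where
  Hom := Pointed.Hom
  id a := ⟨𝟙 _, by simp⟩
  comp f g := ⟨f.val ≫ g.val, by simp [f.map_pt, g.map_pt]⟩
  id_comp f := Pointed.Hom.ext (Category.id_comp _)
  comp_id f := Pointed.Hom.ext (Category.comp_id _)
  assoc f g h := Pointed.Hom.ext (Category.assoc _ _ _)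

namespace Pointed

@[ext]
theorem hom_ext {b : Y ⥤ PermCat.{u}} {a a' : Pointed b} {f g : a ⟶ a'} (h : f.val = g.val) :
    f = g :=
  Pointed.Hom.ext h

@[simp] theorem id_val {b : Y ⥤ PermCat.{u}} (a : Pointed b) : Hom.val (𝟙 a) = 𝟙 a.base := rfl

@[simp] theorem comp_val {b : Y ⥤ PermCat.{u}} {a a' a'' : Pointed b} (f : a ⟶ a') (g : a' ⟶ a'') :
    (f ≫ g).val = f.val ≫ g.val := rfl

/-- The projection `(y, j) ↦ y`. -/
@[simps]
def proj (b : Y ⥤ PermCat.{u}) : Pointed b ⥤ Y where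
  obj a := a.base
  map f := f.val

theorem ext_val {b : Y ⥤ PermCat.{u}} {a a' : Pointed b} (h : a.base = a'.base)
    (h' : (a.pt : ℕ) = a'.pt) : a = a' := by
  obtain ⟨a, j⟩ := a
  obtain ⟨a', j'⟩ := a'
  obtain rfl : a = a' := h
  obtain rfl : j = j' := Fin.ext h'
  rfl

theorem eqToHom_val {b : Y ⥤ PermCat.{u}} {a a' : Pointed b} (h : a = a') :
    (eqToHom h).val = eqToHom (congrArg base h) := by
  subst h
  rfl

theorem functor_ext {b : Y ⥤ PermCat.{u}} {X : Type u} [Category.{u} X] {F G : X ⥤ Pointed b}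
    (h : F ⋙ proj b = G ⋙ proj b) (h' : ∀ x, ((F.obj x).pt : ℕ) = (G.obj x).pt) : F = G := by
  have ho : ∀ x, F.obj x = G.obj x := fun x ↦ ext_val (Functor.congr_obj h x) (h' x)
  refine CategoryTheory.Functor.ext ho fun x x' f ↦ ?_
  ext
  rw [comp_val, comp_val, eqToHom_val, eqToHom_val]
  exact Functor.congr_hom h f

end Pointed

/-- The category `ℙ_*` of pointed natural numbers and base point preserving permutations. -/
abbrev PermStar : Type u := Pointed (𝟭 PermCat.{u})

/-- The forgetful functor `ℙ_* ⟶ ℙ`. -/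
abbrev permU : Cat.of PermStar.{u} ⟶ Cat.of PermCat.{u} := (Pointed.proj (𝟭 PermCat.{u})).toCatHom

theorem permFunctor_ext {b b' : Y ⥤ PermCat.{u}} (h : ∀ y, (b.obj y).n = (b'.obj y).n)
    (h' : ∀ {y y' : Y} (v : y ⟶ y') (j : Fin (b.obj y).n) (j' : Fin (b'.obj y).n),
      (j : ℕ) = j' → ((b.map v).perm j : ℕ) = (b'.map v).perm j') : b = b' := by
  have ho : ∀ y, b.obj y = b'.obj y := fun y ↦ PermCat.ext (h y)
  have key : ∀ {p q p' q' : PermCat.{u}} (hp : p = p') (hq : q = q') (f : p ⟶ q) (g : p' ⟶ q'),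
      (∀ (j : Fin p.n) (j' : Fin p'.n), (j : ℕ) = j' → (f.perm j : ℕ) = g.perm j') →
      HEq f g := by
    intro p q p' q' hp hq f g hfg
    subst hp hq
    refine heq_of_eq ?_
    ext j
    exact hfg j j rfl
  exact CategoryTheory.Functor.hext ho fun y y' v ↦ key (ho y) (ho y') _ _ (h' v)

/-- The functor `(y, j) ↦ (b y, j)`. -/
@[simps]
def Pointed.star (b : Y ⥤ PermCat.{u}) : Pointed b ⥤ PermStar.{u} where
  obj a := ⟨b.obj a.base, a.pt⟩
  map f := ⟨b.map f.val, f.map_pt⟩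

theorem permFunctor_congr {b b' : Y ⥤ PermCat.{u}} (h : b = b') {y y' : Y} (v : y ⟶ y')
    {j : Fin (b.obj y).n} {j' : Fin (b'.obj y).n} (hj : (j : ℕ) = j') :
    ((b.map v).perm j : ℕ) = (b'.map v).perm j' := by
  subst h
  rw [Fin.ext hj]

section

variable {W : Type u} [Category.{u} W]

/-- Functors into `Pointed b`. -/
@[simps]
def Pointed.lift {b : Y ⥤ PermCat.{u}} (t : W ⥤ Y) (p : ∀ w, Fin (b.obj (t.obj w)).n)
    (hp : ∀ {w w' : W} (v : w ⟶ w'), (b.map (t.map v)).perm (p w) = p w') : W ⥤ Pointed b where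
  obj w := ⟨t.obj w, p w⟩
  map v := ⟨t.map v, hp v⟩

theorem Pointed.exists_lift {b : Y ⥤ PermCat.{u}} (s : W ⥤ PermStar.{u}) (t : W ⥤ Y)
    (h : s ⋙ proj _ = t ⋙ b) : ∃ L : W ⥤ Pointed b, L ⋙ star b = s ∧ L ⋙ proj b = t := by
  have hn : ∀ w, (s.obj w).base.n = (b.obj (t.obj w)).n := fun w ↦
    congrArg PermCat.n (CategoryTheory.Functor.congr_obj h w)
  refine ⟨Pointed.lift t (fun w ↦ Fin.cast (hn w) (s.obj w).pt) ?_, ?_, rfl⟩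
  · intro w w' v
    have h1 := (s.map v).map_pt
    have h2 := permFunctor_congr h v (j := (s.obj w).pt) (j' := Fin.cast (hn w) (s.obj w).pt) rfl
    ext
    exact h2.symm.trans (congrArg Fin.val h1)
  · refine Pointed.functor_ext h.symm (fun w ↦ rfl)

end

theorem Pointed.isPullback (b : Y ⥤ PermCat.{u}) :
    IsPullback (Pointed.star b).toCatHom (Pointed.proj b).toCatHom permU.{u} b.toCatHom := by
  have hex : ∀ s : PullbackCone permU.{u} b.toCatHom, ∃ L : s.pt ⟶ Cat.of (Pointed b),
      L ≫ (Pointed.star b).toCatHom = s.fst ∧ L ≫ (Pointed.proj b).toCatHom = s.snd := by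
    intro s
    obtain ⟨L, h1, h2⟩ := Pointed.exists_lift (b := b) s.fst.toFunctor s.snd.toFunctor
      (congrArg Cat.Hom.toFunctor s.condition)
    exact ⟨L.toCatHom, Cat.ext h1, Cat.ext h2⟩
  choose L h1 h2 using hex
  have w : (Pointed.star b).toCatHom ≫ permU.{u} = (Pointed.proj b).toCatHom ≫ b.toCatHom := rfl
  refine ⟨⟨w⟩, ⟨PullbackCone.IsLimit.mk w L h1 h2 ?_⟩⟩
  intro s m hm1 hm2
  have e1 := congrArg Cat.Hom.toFunctor (hm1.trans (h1 s).symm)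
  have e2 := congrArg Cat.Hom.toFunctor (hm2.trans (h2 s).symm)
  refine Cat.ext (Pointed.functor_ext e2 fun x ↦ ?_)
  have h3 : ∀ {p q : PermStar.{u}}, p = q → (p.pt : ℕ) = q.pt := by rintro p _ rfl; rfl
  exact h3 (CategoryTheory.Functor.congr_obj e1 x)

end Perms

end PolyOpd

namespace PolyOpd

universe u

section Fibrations

variable {X Y Z : Type u} [Category.{u} X] [Category.{u} Y] [Category.{u} Z]

theorem isIso_toCatHom (F : X ⥤ Y) [F.Full] [F.Faithful] (h : Function.Bijective F.obj) :
    IsIso F.toCatHom := by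
  choose g hg using h.2
  have hg' : ∀ x, g (F.obj x) = x := fun x ↦ h.1 (hg _)
  let G : Y ⥤ X :=
    { obj := g
      map := fun {y y'} v ↦ F.preimage (eqToHom (hg y) ≫ v ≫ eqToHom (hg y').symm)
      map_id := fun y ↦ F.map_injective (by simp)
      map_comp := fun v v' ↦ F.map_injective (by simp) }
  have h1 : F ⋙ G = 𝟭 X := by
    refine CategoryTheory.Functor.ext hg' fun x x' v ↦ F.map_injective ?_
    simp [G, eqToHom_map]
  have h2 : G ⋙ F = 𝟭 Y := by
    refine CategoryTheory.Functor.ext hg fun x x' v ↦ ?_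
    simp [G]
  exact ⟨⟨G.toCatHom, Cat.ext h1, Cat.ext h2⟩⟩

/-- `Lift y v x x'` says that `v` is the image under `y` of some arrow `x ⟶ x'`. -/
def Lift (y : X ⥤ Y) {β β' : Y} (v : β ⟶ β') (x x' : X) : Prop :=
  ∃ w : x ⟶ x', y.obj x = β ∧ y.obj x' = β' ∧ HEq (y.map w) v

theorem Lift.mk (y : X ⥤ Y) {x x' : X} (w : x ⟶ x') : Lift y (y.map w) x x' :=
  ⟨w, rfl, rfl, HEq.rfl⟩

theorem Lift.src {y : X ⥤ Y} {β β' : Y} {v : β ⟶ β'} {x x' : X} (h : Lift y v x x') :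
    y.obj x = β :=
  h.choose_spec.1

theorem Lift.tgt {y : X ⥤ Y} {β β' : Y} {v : β ⟶ β'} {x x' : X} (h : Lift y v x x') :
    y.obj x' = β' :=
  h.choose_spec.2.1

theorem Lift.id (y : X ⥤ Y) {x : X} {β : Y} (h : y.obj x = β) : Lift y (𝟙 β) x x := by
  subst h
  exact ⟨𝟙 x, rfl, rfl, heq_of_eq (y.map_id x)⟩

theorem Lift.comp {y : X ⥤ Y} {β β' β'' : Y} {v : β ⟶ β'} {v' : β' ⟶ β''} {x x' x'' : X}
    (h : Lift y v x x') (h' : Lift y v' x' x'') : Lift y (v ≫ v') x x'' := by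
  obtain ⟨w, rfl, rfl, hw⟩ := h
  obtain ⟨w', _, rfl, hw'⟩ := h'
  obtain rfl := eq_of_heq hw
  obtain rfl := eq_of_heq hw'
  exact ⟨w ≫ w', rfl, rfl, heq_of_eq (y.map_comp w w')⟩

theorem Lift.exists_map {y : X ⥤ Y} {x x' : X} {v : y.obj x ⟶ y.obj x'} (h : Lift y v x x') :
    ∃ w : x ⟶ x', y.map w = v := by
  obtain ⟨w, _, _, hw⟩ := h
  exact ⟨w, eq_of_heq hw⟩

/-- Discrete fibrations which are also discrete opfibrations. -/
structure IsDiscBifib (y : X ⥤ Y) : Prop where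
  ex_tgt : ∀ {β β' : Y} (v : β ⟶ β') (x : X), y.obj x = β → ∃ x', Lift y v x x'
  ex_src : ∀ {β β' : Y} (v : β ⟶ β') (x' : X), y.obj x' = β' → ∃ x, Lift y v x x'
  uniq_tgt : ∀ {β β' : Y} {v : β ⟶ β'} {x x' x'' : X}, Lift y v x x' → Lift y v x x'' → x' = x''
  uniq_src : ∀ {β β' : Y} {v : β ⟶ β'} {x x' x'' : X}, Lift y v x' x → Lift y v x'' x → x' = x''
  faithful : ∀ {x x' : X} {w w' : x ⟶ x'}, y.map w = y.map w' → w = w'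

theorem Lift.of_comp {x : X ⥤ Y} {y : Y ⥤ Z} {ζ ζ' : Z} {v : ζ ⟶ ζ'} {a a' : X}
    (h : Lift (x ⋙ y) v a a') : ∃ w : x.obj a ⟶ x.obj a', Lift x w a a' ∧
      Lift y v (x.obj a) (x.obj a') ∧ HEq (y.map w) v := by
  obtain ⟨w, rfl, rfl, hw⟩ := h
  exact ⟨x.map w, Lift.mk x w, ⟨x.map w, rfl, rfl, hw⟩, hw⟩

theorem Lift.trans {x : X ⥤ Y} {y : Y ⥤ Z} {ζ ζ' : Z} {v : ζ ⟶ ζ'} {a a' : X} {b b' : Y}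
    {w : b ⟶ b'} (h : Lift x w a a') (hw : HEq (y.map w) v)
    (h1 : y.obj b = ζ) (h2 : y.obj b' = ζ') : Lift (x ⋙ y) v a a' := by
  subst h1 h2
  obtain rfl := eq_of_heq hw
  obtain ⟨u, rfl, rfl, hu⟩ := h
  obtain rfl := eq_of_heq hu
  exact Lift.mk (x ⋙ y) u

theorem IsDiscBifib.comp {x : X ⥤ Y} {y : Y ⥤ Z} (hx : IsDiscBifib x) (hy : IsDiscBifib y) :
    IsDiscBifib (x ⋙ y) where
  ex_tgt v a ha := by
    obtain ⟨b', hb⟩ := hy.ex_tgt v (x.obj a) ha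
    obtain ⟨w, h1, h2, hw⟩ := hb
    obtain ⟨a', h⟩ := hx.ex_tgt w a rfl
    exact ⟨a', h.trans hw h1 h2⟩
  ex_src v a' ha := by
    obtain ⟨b, hb⟩ := hy.ex_src v (x.obj a') ha
    obtain ⟨w, h1, h2, hw⟩ := hb
    obtain ⟨a, h⟩ := hx.ex_src w a' rfl
    exact ⟨a, h.trans hw h1 h2⟩
  uniq_tgt := by
    intro ζ ζ' v a a' a'' h h'
    obtain ⟨w, h1, h2, hw⟩ := h.of_comp
    obtain ⟨w', h1', h2', hw'⟩ := h'.of_comp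
    have e := hy.uniq_tgt h2 h2'
    have : ∀ {b b' b'' : Y} (e : b' = b'') (w : b ⟶ b') (w' : b ⟶ b''), HEq (y.map w) (y.map w') →
        Lift x w a a' → Lift x w' a a'' → a' = a'' := by
      intro b b' b'' e w w' hw h h'
      subst e
      obtain rfl := hy.faithful (eq_of_heq hw)
      exact hx.uniq_tgt h h'
    exact this e w w' (hw.trans hw'.symm) h1 h1'
  uniq_src := by
    intro ζ ζ' v a a' a'' h h'
    obtain ⟨w, h1, h2, hw⟩ := h.of_comp
    obtain ⟨w', h1', h2', hw'⟩ := h'.of_comp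
    have e := hy.uniq_src h2 h2'
    have : ∀ {b b' b'' : Y} (e : b' = b'') (w : b' ⟶ b) (w' : b'' ⟶ b), HEq (y.map w) (y.map w') →
        Lift x w a' a → Lift x w' a'' a → a' = a'' := by
      intro b b' b'' e w w' hw h h'
      subst e
      obtain rfl := hy.faithful (eq_of_heq hw)
      exact hx.uniq_src h h'
    exact this e w w' (hw.trans hw'.symm) h1 h1'
  faithful h := hx.faithful (hy.faithful h)

theorem IsDiscBifib.of_isIso {A B : Cat.{u, u}} (f : A ⟶ B) [IsIso f] :
    IsDiscBifib f.toFunctor := by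
  have h1 : f.toFunctor ⋙ (inv f).toFunctor = 𝟭 A :=
    congrArg Cat.Hom.toFunctor (IsIso.hom_inv_id f)
  have h2 : (inv f).toFunctor ⋙ f.toFunctor = 𝟭 B :=
    congrArg Cat.Hom.toFunctor (IsIso.inv_hom_id f)
  have inj : ∀ {a a' : A}, f.toFunctor.obj a = f.toFunctor.obj a' → a = a' := by
    intro a a' h
    have := congrArg (inv f).toFunctor.obj h
    exact ((CategoryTheory.Functor.congr_obj h1 a).symm.trans this).trans
      (CategoryTheory.Functor.congr_obj h1 a')
  have lift : ∀ {β β' : B} (v : β ⟶ β'),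
      Lift f.toFunctor v ((inv f).toFunctor.obj β) ((inv f).toFunctor.obj β') := fun {β β'} v ↦
    ⟨(inv f).toFunctor.map v, CategoryTheory.Functor.congr_obj h2 β,
      CategoryTheory.Functor.congr_obj h2 β', CategoryTheory.Functor.hcongr_hom h2 v⟩
  refine ⟨?_, ?_, ?_, ?_, ?_⟩
  · intro β β' v x hx
    obtain rfl : (inv f).toFunctor.obj β = x := inj ((lift v).src.trans hx.symm)
    exact ⟨_, lift v⟩
  · intro β β' v x hx
    obtain rfl : (inv f).toFunctor.obj β' = x := inj ((lift v).tgt.trans hx.symm)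
    exact ⟨_, lift v⟩
  · intro β β' v x x' x'' h h'
    exact inj (h.tgt.trans h'.tgt.symm)
  · intro β β' v x x' x'' h h'
    exact inj (h.src.trans h'.src.symm)
  · intro x x' w w' h
    have h3 := CategoryTheory.Functor.hcongr_hom h1 w
    have h4 := CategoryTheory.Functor.hcongr_hom h1 w'
    have h5 := congrArg (inv f).toFunctor.map h
    exact eq_of_heq (h3.symm.trans ((heq_of_eq h5).trans h4))

theorem IsDiscBifib.proj (b : Y ⥤ PermCat.{u}) : IsDiscBifib (Pointed.proj b) where
  ex_tgt := by
    rintro β β' v ⟨_, j⟩ rfl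
    exact ⟨⟨β', (b.map v).perm j⟩, ⟨v, rfl⟩, rfl, rfl, HEq.rfl⟩
  ex_src := by
    rintro β β' v ⟨_, j⟩ rfl
    exact ⟨⟨β, (b.map v).perm.symm j⟩, ⟨v, Equiv.apply_symm_apply _ _⟩, rfl, rfl, HEq.rfl⟩
  uniq_tgt := by
    rintro β β' v ⟨x, j⟩ ⟨x', j'⟩ ⟨x'', j''⟩ ⟨⟨w, hw⟩, rfl, rfl, h⟩ ⟨⟨w', hw'⟩, _, e, h'⟩
    dsimp only at hw hw' h h' e
    change x'' = x' at e
    subst e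
    obtain rfl := eq_of_heq (h.trans h'.symm)
    obtain rfl : j' = j'' := hw.symm.trans hw'
    rfl
  uniq_src := by
    rintro β β' v ⟨x, j⟩ ⟨x', j'⟩ ⟨x'', j''⟩ ⟨⟨w, hw⟩, rfl, rfl, h⟩ ⟨⟨w', hw'⟩, e, _, h'⟩
    dsimp only at hw hw' h h' e
    change x'' = x' at e
    subst e
    obtain rfl := eq_of_heq (h.trans h'.symm)
    obtain rfl : j' = j'' := (b.map _).perm.injective (hw.trans hw'.symm)
    rfl
  faithful h := Pointed.Hom.ext h

end Fibrations

section Numberings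

variable {X Y Z : Cat.{u, u}}

/-- A numbering of the fibres of `y`. -/
structure Numbering (y : X ⟶ Y) where
  arity : Y → ℕ
  pos : X → ℕ
  bifib : IsDiscBifib y.toFunctor
  lt : ∀ x, pos x < arity (y.toFunctor.obj x)
  inj : ∀ {x x'}, y.toFunctor.obj x = y.toFunctor.obj x' → pos x = pos x' → x = x'
  surj : ∀ β, ∀ j < arity β, ∃ x, y.toFunctor.obj x = β ∧ pos x = j

/-- The functor underlying a morphism to `ℙ`. -/
abbrev toP (b : Y ⟶ Cat.of PermCat.{u}) : Y ⥤ PermCat.{u} := b.toFunctor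

/-- The functor underlying a morphism to `ℙ_*`. -/
abbrev toS (e : X ⟶ Cat.of PermStar.{u}) : X ⥤ PermStar.{u} := e.toFunctor

namespace Numbering

section

variable {y : X ⟶ Y} (N : Numbering y)

theorem lt' {x : X} {β : Y} (h : y.toFunctor.obj x = β) : N.pos x < N.arity β :=
  h ▸ N.lt x

theorem inj' {x x' : X} {β : Y} (h : y.toFunctor.obj x = β) (h' : y.toFunctor.obj x' = β)
    (hp : N.pos x = N.pos x') : x = x' :=
  N.inj (h.trans h'.symm) hp

/-- The permutation induced by an arrow of the base. -/
theorem exists_perm {β β' : Y} (v : β ⟶ β') : ∃ ρ : Fin (N.arity β) ≃ Fin (N.arity β'),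
    ∀ {x x' : X}, Lift y.toFunctor v x x' → ∀ j : Fin (N.arity β), (j : ℕ) = N.pos x → (ρ j : ℕ) = N.pos x' := by
  have h1 : ∀ j : Fin (N.arity β), ∃ j' : Fin (N.arity β'), ∃ x x', Lift y.toFunctor v x x' ∧
      N.pos x = j ∧ N.pos x' = j' := by
    intro j
    obtain ⟨x, hx, hj⟩ := N.surj β j j.2
    obtain ⟨x', h⟩ := N.bifib.ex_tgt v x hx
    exact ⟨⟨N.pos x', N.lt' h.tgt⟩, x, x', h, hj, rfl⟩
  choose f hf using h1
  refine ⟨Equiv.ofBijective f ⟨?_, ?_⟩, ?_⟩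
  · intro j k hjk
    obtain ⟨x, x', h, e1, e2⟩ := hf j
    obtain ⟨z, z', h', e1', e2'⟩ := hf k
    have : x' = z' := N.inj' h.tgt h'.tgt (by rw [e2, e2', hjk])
    subst this
    have := N.bifib.uniq_src h h'
    subst this
    exact Fin.ext (e1.symm.trans e1')
  · intro j
    obtain ⟨x', hx, hj⟩ := N.surj β' j j.2
    obtain ⟨x, h⟩ := N.bifib.ex_src v x' hx
    refine ⟨⟨N.pos x, N.lt' h.src⟩, ?_⟩
    obtain ⟨z, z', h', e1', e2'⟩ := hf ⟨N.pos x, N.lt' h.src⟩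
    have : z = x := N.inj' h'.src h.src e1'
    subst this
    have := N.bifib.uniq_tgt h h'
    subst this
    exact Fin.ext (e2'.symm.trans hj)
  · intro x x' h j hj
    obtain ⟨z, z', h', e1', e2'⟩ := hf j
    have : z = x := N.inj' h'.src h.src (e1'.trans hj)
    subst this
    have := N.bifib.uniq_tgt h h'
    subst this
    exact e2'.symm

noncomputable def perm {β β' : Y} (v : β ⟶ β') : Fin (N.arity β) ≃ Fin (N.arity β') :=
  (N.exists_perm v).choose

theorem perm_eq {β β' : Y} {v : β ⟶ β'} {x x' : X} (h : Lift y.toFunctor v x x')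
    {j : Fin (N.arity β)} (hj : (j : ℕ) = N.pos x) : (N.perm v j : ℕ) = N.pos x' :=
  (N.exists_perm v).choose_spec h j hj

theorem exists_of_perm {β β' : Y} (v : β ⟶ β') (j : Fin (N.arity β)) :
    ∃ x x', Lift y.toFunctor v x x' ∧ (j : ℕ) = N.pos x ∧ (N.perm v j : ℕ) = N.pos x' := by
  obtain ⟨x, hx, hj⟩ := N.surj β j j.2
  obtain ⟨x', h⟩ := N.bifib.ex_tgt v x hx
  exact ⟨x, x', h, hj.symm, N.perm_eq h hj.symm⟩

/-- The functor to `ℙ` given by the cardinalities of the fibres. -/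
@[simps]
noncomputable def toPerm : Y ⥤ PermCat.{u} where
  obj β := ⟨N.arity β⟩
  map v := ⟨N.perm v⟩
  map_id β := by
    ext j
    obtain ⟨x, hx, hj⟩ := N.surj β j j.2
    exact (N.perm_eq (Lift.id _ hx) hj.symm).trans hj
  map_comp v v' := by
    ext j
    obtain ⟨x, x', h, e1, e2⟩ := N.exists_of_perm v j
    obtain ⟨z, z', h', e1', e2'⟩ := N.exists_of_perm v' (N.perm v j)
    have : z = x' := N.inj' h'.src h.tgt (e1'.symm.trans e2)
    subst this
    exact (N.perm_eq (h.comp h') e1).trans e2'.symm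

/-- The comparison functor. -/
@[simps!]
noncomputable def toPointed : X ⥤ Pointed N.toPerm :=
  Pointed.lift y.toFunctor (fun x ↦ ⟨N.pos x, N.lt x⟩)
    (fun w ↦ Fin.ext (N.perm_eq (Lift.mk _ w) rfl))

instance : N.toPointed.Faithful := ⟨fun h ↦ N.bifib.faithful (congrArg Pointed.Hom.val h)⟩

instance : N.toPointed.Full := ⟨by
  rintro x x' ⟨v, hv⟩
  obtain ⟨x'', h⟩ := N.bifib.ex_tgt v x rfl
  have : x'' = x' := by
    refine N.inj' h.tgt rfl ?_
    rw [← N.perm_eq h (j := ⟨N.pos x, N.lt x⟩) rfl]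
    exact congrArg Fin.val hv
  subst this
  obtain ⟨w, rfl⟩ := h.exists_map
  exact ⟨w, rfl⟩⟩

theorem bijective_toPointed : Function.Bijective N.toPointed.obj := by
  constructor
  · intro x x' h
    refine N.inj (congrArg Pointed.base h) ?_
    have h3 : ∀ {p q : Pointed N.toPerm}, p = q → (p.pt : ℕ) = q.pt := by rintro p _ rfl; rfl
    exact h3 h
  · rintro ⟨β, j⟩
    obtain ⟨x, rfl, hj⟩ := N.surj β j j.2
    exact ⟨x, Pointed.ext_val rfl hj⟩

theorem isPullback : IsPullback (N.toPointed ⋙ Pointed.star _).toCatHom y permU.{u}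
    (show Y ⟶ Cat.of PermCat.{u} from N.toPerm.toCatHom) := by
  have := isIso_toCatHom N.toPointed N.bijective_toPointed
  have h : IsPullback N.toPointed.toCatHom y (Pointed.proj N.toPerm).toCatHom (𝟙 Y) :=
    have : @IsIso Cat.{u, u} _ Y (Cat.of Y) (𝟙 Y) := inferInstanceAs (IsIso (𝟙 Y))
    IsPullback.of_horiz_isIso ⟨rfl⟩
  exact h.paste_horiz (Pointed.isPullback N.toPerm)

end

variable {y : X ⟶ Y}

/-- A pullback square from `y` to the forgetful functor `ℙ_* ⟶ ℙ` numbers the fibres of `y`. -/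
@[simps arity pos]
def ofIsPullback {e : X ⟶ Cat.of PermStar.{u}} {b : Y ⟶ Cat.of PermCat.{u}}
    (h : IsPullback e y permU.{u} b) : Numbering y := by
  have hK : ∃ K : X ⟶ Cat.of (Pointed (toP b)), IsIso K ∧
      K ≫ (Pointed.star (toP b)).toCatHom = e ∧
      K ≫ (Pointed.proj (toP b)).toCatHom = y :=
    have h' := Pointed.isPullback (toP b)
    ⟨(h.isoIsPullback _ _ h').hom, inferInstance, h.isoIsPullback_hom_fst _ _ h',
      h.isoIsPullback_hom_snd _ _ h'⟩
  have hn : ∀ x, ((toS e).obj x).base = (toP b).obj (y.toFunctor.obj x) := fun x ↦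
    CategoryTheory.Functor.congr_obj (congrArg Cat.Hom.toFunctor h.w) x
  exact
  { arity := fun β ↦ ((toP b).obj β).n
    pos := fun x ↦ ((toS e).obj x).pt
    bifib := by
      obtain ⟨K, hK, rfl, rfl⟩ := hK
      exact (IsDiscBifib.of_isIso K).comp (IsDiscBifib.proj _)
    lt := fun x ↦ by
      have := ((toS e).obj x).pt.2
      have h2 := congrArg PermCat.n (hn x)
      exact lt_of_lt_of_eq this h2
    inj := by
      obtain ⟨K, hK, rfl, rfl⟩ := hK
      intro x x' h1 h2
      have h3 : K.toFunctor.obj x = K.toFunctor.obj x' := Pointed.ext_val h1 h2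
      have h4 : K.toFunctor ⋙ (inv K).toFunctor = 𝟭 X :=
        congrArg Cat.Hom.toFunctor (IsIso.hom_inv_id K)
      have := congrArg (inv K).toFunctor.obj h3
      exact ((CategoryTheory.Functor.congr_obj h4 x).symm.trans this).trans
        (CategoryTheory.Functor.congr_obj h4 x')
    surj := by
      obtain ⟨K, hK, rfl, rfl⟩ := hK
      intro β j hj
      have h4 : (inv K).toFunctor ⋙ K.toFunctor = 𝟭 (Pointed (toP b)) :=
        congrArg Cat.Hom.toFunctor (IsIso.inv_hom_id K)
      have h5 := CategoryTheory.Functor.congr_obj h4 ⟨β, ⟨j, hj⟩⟩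
      refine ⟨(inv K).toFunctor.obj ⟨β, ⟨j, hj⟩⟩, congrArg Pointed.base h5, ?_⟩
      have h6 : ∀ {p q : Pointed (toP b)}, p = q → (p.pt : ℕ) = q.pt := by
        rintro p _ rfl; rfl
      exact h6 h5 }

/-- A numbering is determined by the positions. -/
theorem arity_eq {N N' : Numbering y} (h : ∀ x, N.pos x = N'.pos x) (β : Y) :
    N.arity β = N'.arity β := by
  have key : ∀ (N N' : Numbering y), (∀ x, N.pos x = N'.pos x) → ∀ j, j < N.arity β →
      j < N'.arity β := by
    intro N N' h j hj
    obtain ⟨x, rfl, rfl⟩ := N.surj β j hj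
    rw [h]
    exact N'.lt x
  exact le_antisymm (le_of_forall_lt (key N N' h)) (le_of_forall_lt (key N' N fun x ↦ (h x).symm))

end Numbering

/-- The permutations in a pullback square. -/
theorem perm_eq_of_isPullback {y : X ⟶ Y} {e : X ⟶ Cat.of PermStar.{u}} {b : Y ⟶ Cat.of PermCat.{u}}
    (h : IsPullback e y permU.{u} b) {β β' : Y} {v : β ⟶ β'} {x x' : X}
    (hv : Lift y.toFunctor v x x') {j : Fin ((toP b).obj β).n}
    (hj : (j : ℕ) = ((toS e).obj x).pt) :
    (((toP b).map v).perm j : ℕ) = ((toS e).obj x').pt := by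
  obtain ⟨w, rfl, rfl, hw⟩ := hv
  obtain rfl := eq_of_heq hw
  have h1 := ((toS e).map w).map_pt
  have h2 := permFunctor_congr (congrArg Cat.Hom.toFunctor h.w) w
    (j := ((toS e).obj x).pt) (j' := j) hj.symm
  exact h2.symm.trans (congrArg Fin.val h1)

/-- A pullback square over `ℙ_* ⟶ ℙ` is determined by the positions. -/
theorem ext_of_isPullback {y : X ⟶ Y} {e e' : X ⟶ Cat.of PermStar.{u}}
    {b b' : Y ⟶ Cat.of PermCat.{u}}
    (h : IsPullback e y permU.{u} b) (h' : IsPullback e' y permU.{u} b')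
    (H : ∀ x, (((toS e).obj x).pt : ℕ) = ((toS e').obj x).pt) : e = e' ∧ b = b' := by
  have hb : b = b' := by
    refine Cat.ext (permFunctor_ext (fun β ↦ Numbering.arity_eq
      (N := Numbering.ofIsPullback h) (N' := Numbering.ofIsPullback h') H β) ?_)
    intro β β' v j j' hj
    obtain ⟨x, x', hv, e1, -⟩ := (Numbering.ofIsPullback h).exists_of_perm v j
    rw [perm_eq_of_isPullback h hv e1, perm_eq_of_isPullback h' hv]
    · exact H x'
    · exact (hj.symm.trans e1).trans (H x)
  subst hb
  refine ⟨Cat.ext (Pointed.functor_ext ?_ H), rfl⟩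
  exact congrArg Cat.Hom.toFunctor (h.w.trans h'.w.symm)

end Numberings

end PolyOpd

namespace PolyOpd

universe u

section Exponentiability

theorem heq_comp {X : Type u} [Category.{u} X] {a b c a' b' c' : X} (ha : a = a') (hb : b = b')
    (hc : c = c') {f : a ⟶ b} {g : b ⟶ c} {f' : a' ⟶ b'} {g' : b' ⟶ c'} (hf : HEq f f')
    (hg : HEq g g') : HEq (f ≫ g) (f' ≫ g') := by
  subst ha hb hc
  obtain rfl := eq_of_heq hf
  obtain rfl := eq_of_heq hg
  rfl

theorem heq_id {X : Type u} [Category.{u} X] {a a' : X} (ha : a = a') : HEq (𝟙 a) (𝟙 a') := by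
  subst ha
  rfl

variable {W : Type u} [Category.{u} W]

/-- The sections of a category over `ℙ_*` over the fibres of `ℙ_* ⟶ ℙ`. -/
structure Sec (g : W ⥤ PermStar.{u}) : Type u where
  n : PermCat.{u}
  w : Fin n.n → W
  hw : ∀ j, g.obj (w j) = ⟨n, j⟩

@[ext]
structure Sec.Hom {g : W ⥤ PermStar.{u}} (q q' : Sec g) : Type u where
  ρ : q.n ⟶ q'.n
  f : ∀ j, q.w j ⟶ q'.w (ρ.perm j)
  hf : ∀ j, HEq (g.map (f j)).val ρ

namespace Sec

variable {g : W ⥤ PermStar.{u}}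

theorem base_eq (q : Sec g) (j : Fin q.n.n) : (g.obj (q.w j)).base = q.n :=
  congrArg Pointed.base (q.hw j)

instance : Category.{u} (Sec g) where
  Hom := Sec.Hom
  id q := ⟨𝟙 _, fun j ↦ 𝟙 (q.w j), fun j ↦
    (heq_of_eq (congrArg Pointed.Hom.val (g.map_id (q.w j)))).trans (heq_id (q.base_eq j))⟩
  comp {q q' q''} a b := ⟨a.ρ ≫ b.ρ, fun j ↦ a.f j ≫ b.f (a.ρ.perm j), fun j ↦
    (heq_of_eq (congrArg Pointed.Hom.val (g.map_comp (a.f j) (b.f (a.ρ.perm j))))).trans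
      (heq_comp (q.base_eq j) (q'.base_eq _) (q''.base_eq _) (a.hf j) (b.hf _))⟩
  id_comp _ := Sec.Hom.ext (Category.id_comp _) (heq_of_eq (funext fun _ ↦ Category.id_comp _))
  comp_id _ := Sec.Hom.ext (Category.comp_id _) (heq_of_eq (funext fun _ ↦ Category.comp_id _))
  assoc _ _ _ := Sec.Hom.ext (Category.assoc _ _ _)
    (heq_of_eq (funext fun _ ↦ Category.assoc _ _ _))

theorem obj_ext {q q' : Sec g} (h : q.n.n = q'.n.n)
    (h' : ∀ (j : Fin q.n.n) (j' : Fin q'.n.n), (j : ℕ) = j' → q.w j = q'.w j') : q = q' := by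
  obtain ⟨⟨n⟩, w, hw⟩ := q
  obtain ⟨⟨n'⟩, w', hw'⟩ := q'
  obtain rfl : n = n' := h
  obtain rfl : w = w' := funext fun j ↦ h' j j rfl
  rfl

theorem map_heq {q q' r r' : Sec g} (hq : q = q') (hr : r = r') (a : q ⟶ r) (a' : q' ⟶ r')
    (h : ∀ (j : Fin q.n.n) (j' : Fin q'.n.n), (j : ℕ) = j' → (a.ρ.perm j : ℕ) = a'.ρ.perm j')
    (h' : ∀ (j : Fin q.n.n) (j' : Fin q'.n.n), (j : ℕ) = j' → HEq (a.f j) (a'.f j')) :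
    HEq a a' := by
  subst hq hr
  obtain ⟨ρ, f, hf⟩ := a
  obtain ⟨ρ', f', hf'⟩ := a'
  obtain rfl : ρ = ρ' := by
    ext j
    exact h j j rfl
  obtain rfl : f = f' := funext fun j ↦ eq_of_heq (h' j j rfl)
  rfl

theorem f_heq {q q' r r' : Sec g} (hq : q = q') (hr : r = r') {a : q ⟶ r} {a' : q' ⟶ r'}
    (h : HEq a a') {j : Fin q.n.n} {j' : Fin q'.n.n} (hj : (j : ℕ) = j') :
    HEq (a.f j) (a'.f j') := by
  subst hq hr
  obtain rfl := eq_of_heq h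
  obtain rfl := Fin.ext hj
  rfl

theorem w_eq {q q' : Sec g} (hq : q = q') {j : Fin q.n.n} {j' : Fin q'.n.n} (hj : (j : ℕ) = j') :
    q.w j = q'.w j' := by
  subst hq
  obtain rfl := Fin.ext hj
  rfl

theorem pt_eq {b : Sec g ⥤ PermCat.{u}} {p q : Pointed b} (h : p = q) : (p.pt : ℕ) = q.pt := by
  subst h; rfl

/-- The projection to `ℙ`. -/
@[simps]
def proj (g : W ⥤ PermStar.{u}) : Sec g ⥤ PermCat.{u} where
  obj q := q.n
  map a := a.ρ

/-- Evaluation of sections. -/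
@[simps]
def ev (g : W ⥤ PermStar.{u}) : Pointed (proj g) ⥤ W where
  obj p := p.base.w p.pt
  map {p p'} a := a.val.f p.pt ≫ eqToHom (congrArg p'.base.w a.map_pt)
  map_id p := by
    change 𝟙 _ ≫ eqToHom _ = _
    simp
  map_comp {p p' p''} a b := by
    obtain ⟨q, j⟩ := p
    obtain ⟨q', j'⟩ := p'
    obtain ⟨q'', j''⟩ := p''
    obtain ⟨a, ha⟩ := a
    obtain ⟨b, hb⟩ := b
    change q ⟶ q' at a
    change a.ρ.perm j = j' at ha
    change q' ⟶ q'' at b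
    change b.ρ.perm j' = j'' at hb
    subst ha hb
    change (a.f j ≫ b.f (a.ρ.perm j)) ≫ eqToHom _ = (a.f j ≫ eqToHom _) ≫ b.f _ ≫ eqToHom _
    simp

theorem ev_map_heq {p p' : Pointed (proj g)} (a : p ⟶ p') :
    HEq ((ev g).map a) (a.val.f p.pt) := by
  obtain ⟨q, j⟩ := p
  obtain ⟨q', j'⟩ := p'
  obtain ⟨a, ha⟩ := a
  change q ⟶ q' at a
  change a.ρ.perm j = j' at ha
  subst ha
  change HEq (a.f j ≫ 𝟙 _) (a.f j)
  rw [Category.comp_id]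

theorem ev_comp (g : W ⥤ PermStar.{u}) : ev g ⋙ g = Pointed.star (proj g) := by
  have ho : ∀ p : Pointed (proj g), g.obj ((ev g).obj p) = (Pointed.star (proj g)).obj p :=
    fun p ↦ p.base.hw p.pt
  refine Pointed.functor_ext ?_ fun p ↦ ?_
  · refine CategoryTheory.Functor.hext (fun p ↦ congrArg Pointed.base (ho p)) fun p p' a ↦ ?_
    have : ∀ {x x' : W} {f f' : x ⟶ x'} , f = f' → HEq (g.map f).val (g.map f').val := by
      rintro x x' f _ rfl; rfl
    obtain ⟨q, j⟩ := p
    obtain ⟨q', j'⟩ := p'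
    obtain ⟨a, ha⟩ := a
    change q ⟶ q' at a
    change a.ρ.perm j = j' at ha
    subst ha
    exact (this (Category.comp_id (a.f j))).trans (a.hf j)
  · have h3 : ∀ {p q : PermStar.{u}}, p = q → (p.pt : ℕ) = q.pt := by rintro p _ rfl; rfl
    exact h3 (ho p)

end Sec

section Universal

variable {A A' : Cat.{u, u}} {g : W ⥤ PermStar.{u}} (a : A ⥤ W) (x : A ⟶ A') (y : A' ⥤ PermCat.{u})

theorem Sec.exists_lift
    (h : IsPullback (show A ⟶ Cat.of PermStar.{u} from (a ⋙ g).toCatHom) x permU.{u}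
      (show A' ⟶ Cat.of PermCat.{u} from y.toCatHom)) :
    ∃ (k : A ⥤ Pointed (Sec.proj g)) (l : A' ⥤ Sec g),
    k ⋙ Sec.ev g = a ∧ k ⋙ Pointed.proj _ = x.toFunctor ⋙ l ∧ l ⋙ Sec.proj g = y := by
  have hg : (a ⋙ g) ⋙ Pointed.proj _ = x.toFunctor ⋙ y := congrArg Cat.Hom.toFunctor h.w
  let N := Numbering.ofIsPullback h
  have hsurj : ∀ (β : A') (j : Fin (y.obj β).n), ∃ z, x.toFunctor.obj z = β ∧ N.pos z = j :=
    fun β j ↦ N.surj β j j.2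
  choose fib hfib hpos using hsurj
  have harr : ∀ (β β' : A') (v : β ⟶ β') (j : Fin (y.obj β).n),
      ∃ w : fib β j ⟶ fib β' ((y.map v).perm j), HEq (x.toFunctor.map w) v := by
    intro β β' v j
    obtain ⟨z', hz⟩ := N.bifib.ex_tgt v (fib β j) (hfib β j)
    have h1 := perm_eq_of_isPullback h hz (j := j) (hpos β j).symm
    have : z' = fib β' ((y.map v).perm j) := N.inj' hz.tgt (hfib _ _) (h1.symm.trans
      (hpos _ _).symm)
    subst this
    obtain ⟨w, -, -, hw⟩ := hz
    exact ⟨w, hw⟩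
  choose arr harr using harr
  have hfaith : ∀ {z z' z₁ z₁' : A} (h1 : z = z₁) (h2 : z' = z₁') {w : z ⟶ z'} {w₁ : z₁ ⟶ z₁'},
      HEq (x.toFunctor.map w) (x.toFunctor.map w₁) → HEq w w₁ := by
    intro z z' z₁ z₁' h1 h2 w w₁ hw
    subst h1 h2
    exact heq_of_eq (N.bifib.faithful (eq_of_heq hw))
  have hmap : ∀ {B D : Type u} [Category.{u} B] [Category.{u} D] (F : B ⥤ D) {z z' z₁ z₁' : B}
      (h1 : z = z₁) (h2 : z' = z₁') {w : z ⟶ z'} {w₁ : z₁ ⟶ z₁'},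
      HEq w w₁ → HEq (F.map w) (F.map w₁) := by
    intro B D _ _ F z z' z₁ z₁' h1 h2 w w₁ hw
    subst h1 h2
    obtain rfl := eq_of_heq hw
    rfl
  let l : A' ⥤ Sec g :=
    { obj := fun β ↦ ⟨y.obj β, fun j ↦ a.obj (fib β j), fun j ↦ Pointed.ext_val
        ((CategoryTheory.Functor.congr_obj hg (fib β j)).trans (congrArg y.obj (hfib β j)))
        (hpos β j)⟩
      map := fun {β β'} v ↦ ⟨y.map v, fun j ↦ a.map (arr _ _ v j), fun j ↦
        (show HEq (g.map (a.map (arr _ _ v j))).val (y.map (x.toFunctor.map (arr _ _ v j))) from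
          CategoryTheory.Functor.hcongr_hom hg (arr _ _ v j)).trans (hmap y (hfib _ _) (hfib _ _) (harr _ _ v j))⟩
      map_id := fun β ↦ by
        refine eq_of_heq (Sec.map_heq rfl rfl _ _ (fun j j' hj ↦ ?_) fun j j' hj ↦ ?_)
        · obtain rfl := Fin.ext hj
          exact congrArg (fun ρ ↦ ((PermCat.Hom.perm ρ j : Fin _) : ℕ)) (y.map_id β)
        · obtain rfl := Fin.ext hj
          have e : (y.map (𝟙 β)).perm j = j := by rw [y.map_id]; rfl
          have h1 := harr _ _ (𝟙 β) j
          have h2 : HEq (arr _ _ (𝟙 β) j) (𝟙 (fib β j)) := by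
            refine hfaith rfl (by rw [e]) (h1.trans ?_)
            rw [x.toFunctor.map_id, hfib]
          have h3 := hmap a rfl (by rw [e]) h2
          rw [a.map_id] at h3
          exact h3
      map_comp := fun {β β' β''} v v' ↦ by
        refine eq_of_heq (Sec.map_heq rfl rfl _ _ (fun j j' hj ↦ ?_) fun j j' hj ↦ ?_)
        · obtain rfl := Fin.ext hj
          exact congrArg (fun ρ ↦ ((PermCat.Hom.perm ρ j : Fin _) : ℕ)) (y.map_comp v v')
        · obtain rfl := Fin.ext hj
          have e : (y.map (v ≫ v')).perm j = (y.map v').perm ((y.map v).perm j) := by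
            rw [y.map_comp]; rfl
          have h2 : HEq (arr _ _ (v ≫ v') j) (arr _ _ v j ≫ arr _ _ v' ((y.map v).perm j)) := by
            refine hfaith rfl (by rw [e]) ((harr _ _ (v ≫ v') j).trans ?_)
            rw [x.toFunctor.map_comp]
            exact (heq_comp (hfib _ _) (hfib _ _) (hfib _ _) (harr _ _ _ _) (harr _ _ _ _)).symm
          have h3 := hmap a rfl (by rw [e]) h2
          rw [a.map_comp] at h3
          exact h3 }
  have hl : l ⋙ Sec.proj g = y := rfl
  obtain ⟨k, hk1, hk2⟩ := Pointed.exists_lift (b := Sec.proj g) (a ⋙ g) (x.toFunctor ⋙ l) hg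
  have hkpos : ∀ z, ((k.obj z).pt : ℕ) = N.pos z := by
    intro z
    have h3 : ∀ {p q : PermStar.{u}}, p = q → (p.pt : ℕ) = q.pt := by rintro p _ rfl; rfl
    exact h3 (CategoryTheory.Functor.congr_obj hk1 z)
  have hfibz : ∀ z (j : Fin (y.obj (x.toFunctor.obj z)).n), (j : ℕ) = N.pos z →
      fib (x.toFunctor.obj z) j = z := by
    intro z j hj
    exact N.inj' (hfib _ _) rfl ((hpos _ _).trans hj)
  have hkb : ∀ z, (k.obj z).base = l.obj (x.toFunctor.obj z) := fun z ↦
    CategoryTheory.Functor.congr_obj hk2 z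
  have hj : ∀ z, N.pos z < (y.obj (x.toFunctor.obj z)).n := N.lt
  refine ⟨k, l, ?_, hk2, hl⟩
  have ho : ∀ z, (k ⋙ Sec.ev g).obj z = a.obj z := by
    intro z
    refine (Sec.w_eq (hkb z) (j' := ⟨N.pos z, hj z⟩) (hkpos z)).trans ?_
    exact congrArg a.obj (hfibz z _ rfl)
  refine CategoryTheory.Functor.hext ho fun z z' w ↦ ?_
  refine (Sec.ev_map_heq (k.map w)).trans ?_
  refine (Sec.f_heq (hkb z) (hkb z') (CategoryTheory.Functor.hcongr_hom hk2 w)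
    (j' := ⟨N.pos z, hj z⟩) (hkpos z)).trans ?_
  have hp : ((y.map (x.toFunctor.map w)).perm ⟨N.pos z, hj z⟩ : ℕ) = N.pos z' :=
    perm_eq_of_isPullback h (Lift.mk _ w) rfl
  refine hmap a (hfibz z _ rfl) (hfibz z' _ hp) (hfaith (hfibz z _ rfl) (hfibz z' _ hp) ?_)
  exact harr _ _ _ _

theorem Sec.lift_unique
    (h : IsPullback (show A ⟶ Cat.of PermStar.{u} from (a ⋙ g).toCatHom) x permU.{u}
      (show A' ⟶ Cat.of PermCat.{u} from y.toCatHom))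
    {k k' : A ⥤ Pointed (Sec.proj g)} {l l' : A' ⥤ Sec g}
    (h1 : k ⋙ Sec.ev g = a) (h2 : k ⋙ Pointed.proj _ = x.toFunctor ⋙ l) (h3 : l ⋙ Sec.proj g = y)
    (h1' : k' ⋙ Sec.ev g = a) (h2' : k' ⋙ Pointed.proj _ = x.toFunctor ⋙ l')
    (h3' : l' ⋙ Sec.proj g = y) : k = k' ∧ l = l' := by
  let N := Numbering.ofIsPullback h
  have hk : ∀ {k : A ⥤ Pointed (Sec.proj g)}, k ⋙ Sec.ev g = a → ∀ z,
      ((k.obj z).pt : ℕ) = N.pos z := by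
    intro k h1 z
    have h3 : ∀ {p q : PermStar.{u}}, p = q → (p.pt : ℕ) = q.pt := by rintro p _ rfl; rfl
    have h4 : k ⋙ Pointed.star (Sec.proj g) = a ⋙ g := by rw [← Sec.ev_comp, ← h1]; rfl
    exact h3 (CategoryTheory.Functor.congr_obj h4 z)
  have hw : ∀ {k : A ⥤ Pointed (Sec.proj g)} {l : A' ⥤ Sec g}, k ⋙ Sec.ev g = a →
      k ⋙ Pointed.proj _ = x.toFunctor ⋙ l → ∀ z (j : Fin (l.obj (x.toFunctor.obj z)).n.n),
        (j : ℕ) = N.pos z → (l.obj (x.toFunctor.obj z)).w j = a.obj z := by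
    intro k l h1 h2 z j hj
    refine (Sec.w_eq (CategoryTheory.Functor.congr_obj h2 z).symm (j' := (k.obj z).pt)
      (hj.trans (hk h1 z).symm)).trans ?_
    exact CategoryTheory.Functor.congr_obj h1 z
  have hf : ∀ {k : A ⥤ Pointed (Sec.proj g)} {l : A' ⥤ Sec g}, k ⋙ Sec.ev g = a →
      k ⋙ Pointed.proj _ = x.toFunctor ⋙ l → ∀ {z z'} (w : z ⟶ z')
        (j : Fin (l.obj (x.toFunctor.obj z)).n.n),
        (j : ℕ) = N.pos z → HEq ((l.map (x.toFunctor.map w)).f j) (a.map w) := by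
    intro k l h1 h2 z z' w j hj
    refine (Sec.f_heq (CategoryTheory.Functor.congr_obj h2 z).symm
      (CategoryTheory.Functor.congr_obj h2 z').symm
      (CategoryTheory.Functor.hcongr_hom h2 w).symm (j' := (k.obj z).pt)
      (hj.trans (hk h1 z).symm)).trans ?_
    refine (Sec.ev_map_heq (k.map w)).symm.trans ?_
    exact CategoryTheory.Functor.hcongr_hom h1 w
  have hn : ∀ {l : A' ⥤ Sec g}, l ⋙ Sec.proj g = y → ∀ β, (l.obj β).n.n = N.arity β := by
    rintro l rfl β
    rfl
  have ho : ∀ β, l.obj β = l'.obj β := by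
    intro β
    refine Sec.obj_ext ((hn h3 β).trans (hn h3' β).symm) fun j j' hj ↦ ?_
    obtain ⟨z, rfl, hz⟩ := N.surj β j (lt_of_lt_of_eq j.2 (hn h3 β))
    rw [hw h1 h2 z j hz.symm, hw h1' h2' z j' (hj.symm.trans hz.symm)]
  have hl : l = l' := by
    refine CategoryTheory.Functor.hext ho fun β β' v ↦ ?_
    refine Sec.map_heq (ho β) (ho β') _ _ (fun j j' hj ↦ ?_) fun j j' hj ↦ ?_
    · exact permFunctor_congr (h3.trans h3'.symm) v hj
    · obtain ⟨z, hz, hz'⟩ := N.surj β j (lt_of_lt_of_eq j.2 (hn h3 β))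
      obtain ⟨z', hzz⟩ := N.bifib.ex_tgt v z hz
      obtain ⟨w, rfl, rfl, hv⟩ := hzz
      obtain rfl := eq_of_heq hv
      exact (hf h1 h2 w j hz'.symm).trans (hf h1' h2' w j' (hj.symm.trans hz'.symm)).symm
  refine ⟨Pointed.functor_ext (h2.trans ((congrArg _ hl).trans h2'.symm)) fun z ↦ ?_, hl⟩
  rw [hk h1, hk h1']

end Universal

theorem exponentiable_permU : Exponentiable permU.{u} := by
  refine exponentiable_of_distribPullback fun {W} g ↦ ?_
  let g' : W ⥤ PermStar.{u} := g.toFunctor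
  have he : (Sec.ev g').toCatHom ≫ g = (Pointed.star (Sec.proj g')).toCatHom :=
    Cat.ext (Sec.ev_comp g')
  refine ⟨Cat.of (Pointed (Sec.proj g')), Cat.of (Sec g'), (Sec.ev g').toCatHom,
    (Pointed.proj _).toCatHom, (Sec.proj g').toCatHom, ⟨?_, ?_⟩⟩
  · have := Pointed.isPullback (Sec.proj g')
    rw [← he] at this
    exact this
  · intro A A' a x y h
    obtain ⟨k, l, h1, h2, h3⟩ := Sec.exists_lift (g := g') a.toFunctor x y.toFunctor h
    refine ⟨(k.toCatHom, l.toCatHom), ⟨Cat.ext h1, Cat.ext h2, Cat.ext h3⟩, ?_⟩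
    rintro ⟨k', l'⟩ ⟨h1', h2', h3'⟩
    obtain ⟨e1, e2⟩ := Sec.lift_unique (g := g') a.toFunctor x y.toFunctor h
      (congrArg Cat.Hom.toFunctor h1') (congrArg Cat.Hom.toFunctor h2')
      (congrArg Cat.Hom.toFunctor h3') h1 h2 h3
    exact Prod.ext (Cat.ext e1) (Cat.ext e2)

end Exponentiability

end PolyOpd

namespace PolyOpd

universe u

section Blocks

theorem exists_block (m : ℕ → ℕ) (n l : ℕ) (h : l < ∑ i ∈ Finset.range n, m i) :
    ∃ i < n, ∃ k < m i, l = ∑ i ∈ Finset.range i, m i + k := by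
  induction n with
  | zero => simp at h
  | succ n ih =>
    by_cases h' : l < ∑ i ∈ Finset.range n, m i
    · obtain ⟨i, hi, k, hk, e⟩ := ih h'
      exact ⟨i, by omega, k, hk, e⟩
    · rw [Finset.sum_range_succ] at h
      exact ⟨n, by omega, l - ∑ i ∈ Finset.range n, m i, by omega, by omega⟩

theorem block_le (m : ℕ → ℕ) {i n : ℕ} (h : i < n) :
    ∑ i ∈ Finset.range i, m i + m i ≤ ∑ i ∈ Finset.range n, m i := by
  rw [← Finset.sum_range_succ]
  exact Finset.sum_le_sum_of_subset (Finset.range_subset_range.2 h)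

theorem block_inj (m : ℕ → ℕ) {i i' k k' : ℕ} (hk : k < m i) (hk' : k' < m i')
    (h : ∑ i ∈ Finset.range i, m i + k = ∑ i ∈ Finset.range i', m i + k') : i = i' ∧ k = k' := by
  have key : i = i' := by
    rcases lt_trichotomy i i' with h1 | h1 | h1
    · have := block_le m h1
      omega
    · exact h1
    · have := block_le m h1
      omega
  subst key
  exact ⟨rfl, by omega⟩

/-- Sums over a concatenation of blocks. -/
theorem sum_blocks (f : ℕ → ℕ) (m : ℕ → ℕ) (p q : ℕ) :
    ∑ l ∈ Finset.range (∑ i ∈ Finset.range p, m i + q), f l =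
      ∑ i ∈ Finset.range p, ∑ k ∈ Finset.range (m i), f (∑ i ∈ Finset.range i, m i + k) +
        ∑ k ∈ Finset.range q, f (∑ i ∈ Finset.range p, m i + k) := by
  rw [Finset.sum_range_add]
  congr 1
  induction p with
  | zero => simp
  | succ p ih => rw [Finset.sum_range_succ, Finset.sum_range_add, ih, Finset.sum_range_succ]

end Blocks

section NumberingComp

namespace Numbering

variable {X Y Z W : Cat.{u, u}} {x : X ⟶ Y} {y : Y ⟶ Z} {z : X ⟶ Z}

/-- The element of the fibre over `β` with number `j`. -/
noncomputable def fib (M : Numbering y) (β : Z) (j : ℕ) (h : j < M.arity β) : Y :=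
  (M.surj β j h).choose

theorem obj_fib (M : Numbering y) (β : Z) (j : ℕ) (h : j < M.arity β) :
    y.toFunctor.obj (M.fib β j h) = β :=
  (M.surj β j h).choose_spec.1

theorem pos_fib (M : Numbering y) (β : Z) (j : ℕ) (h : j < M.arity β) :
    M.pos (M.fib β j h) = j :=
  (M.surj β j h).choose_spec.2

theorem fib_eq (M : Numbering y) {β : Z} {j : ℕ} (h : j < M.arity β) {b : Y}
    (hb : y.toFunctor.obj b = β) (hp : M.pos b = j) : M.fib β j h = b :=
  M.inj' (M.obj_fib _ _ _) hb ((M.pos_fib _ _ _).trans hp.symm)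

/-- The sizes of the blocks. -/
noncomputable def block (N : Numbering x) (M : Numbering y) (ζ : Z) (i : ℕ) : ℕ :=
  if h : i < M.arity ζ then N.arity (M.fib ζ i h) else 0

theorem block_eq (N : Numbering x) (M : Numbering y) {ζ : Z} {b : Y} (h : y.toFunctor.obj b = ζ) :
    N.block M ζ (M.pos b) = N.arity b := by
  subst h
  rw [block, dif_pos (M.lt b), M.fib_eq (M.lt b) rfl rfl]

/-- The lexicographic numbering of the fibres of a composite. -/
@[simps arity pos]
noncomputable def comp (N : Numbering x) (M : Numbering y) (hz : x ≫ y = z) : Numbering z where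
  arity ζ := ∑ i ∈ Finset.range (M.arity ζ), N.block M ζ i
  pos a := ∑ i ∈ Finset.range (M.pos (x.toFunctor.obj a)), N.block M (z.toFunctor.obj a) i +
    N.pos a
  bifib := by
    subst hz
    exact N.bifib.comp M.bifib
  lt a := by
    subst hz
    refine lt_of_lt_of_le ?_ (block_le _ (M.lt (x.toFunctor.obj a)))
    rw [N.block_eq M (ζ := (x ≫ y).toFunctor.obj a) rfl]
    exact Nat.add_lt_add_left (N.lt a) _
  inj {a a'} h h' := by
    subst hz
    rw [h] at h'
    have e := N.block_eq M (ζ := y.toFunctor.obj (x.toFunctor.obj a')) (b := x.toFunctor.obj a) h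
    have e' := N.block_eq M (ζ := y.toFunctor.obj (x.toFunctor.obj a')) (b := x.toFunctor.obj a') rfl
    have l := N.lt a
    have l' := N.lt a'
    rw [← e] at l
    rw [← e'] at l'
    obtain ⟨h1, h2⟩ := block_inj _ l l' h'
    exact N.inj (M.inj h h1) h2
  surj ζ l hl := by
    subst hz
    obtain ⟨i, hi, k, hk, e⟩ := exists_block _ _ _ hl
    obtain ⟨b, rfl, rfl⟩ := M.surj ζ i hi
    rw [N.block_eq M rfl] at hk
    obtain ⟨a, rfl, rfl⟩ := N.surj b k hk
    exact ⟨a, rfl, e.symm⟩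

theorem fib_congr (M : Numbering y) {β β' : Z} {j j' : ℕ} (hβ : β = β') (hj : j = j')
    (h : j < M.arity β) (h' : j' < M.arity β') : M.fib β j h = M.fib β' j' h' := by
  subst hβ hj
  rfl

theorem comp_fib (N : Numbering x) (M : Numbering y) (hz : x ≫ y = z) {ζ : Z} {i k : ℕ}
    (hi : i < M.arity ζ) (hk : k < N.arity (M.fib ζ i hi))
    (h : ∑ l ∈ Finset.range i, N.block M ζ l + k < (N.comp M hz).arity ζ) :
    (N.comp M hz).fib ζ (∑ l ∈ Finset.range i, N.block M ζ l + k) h =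
      N.fib (M.fib ζ i hi) k hk := by
  subst hz
  apply fib_eq
  · refine (congrArg y.toFunctor.obj (N.obj_fib _ _ _)).trans (M.obj_fib _ _ _)
  · have h1 : y.toFunctor.obj (x.toFunctor.obj (N.fib (M.fib ζ i hi) k hk)) = ζ :=
      (congrArg y.toFunctor.obj (N.obj_fib _ _ _)).trans (M.obj_fib _ _ _)
    rw [comp_pos, N.obj_fib, N.pos_fib, M.pos_fib]
    change ∑ l ∈ Finset.range i, N.block M
      (y.toFunctor.obj (x.toFunctor.obj (N.fib (M.fib ζ i hi) k hk))) l + k = _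
    rw [h1]

theorem comp_block (N : Numbering x) (M : Numbering y) (hz : x ≫ y = z) {w : Z ⟶ W}
    (L : Numbering w) (ω : W) (i : ℕ) : (N.comp M hz).block L ω i =
      if h : i < L.arity ω then ∑ k ∈ Finset.range (M.arity (L.fib ω i h)),
        N.block M (L.fib ω i h) k else 0 := rfl

/-- Lexicographic numberings are associative. -/
theorem comp_assoc_pos (N : Numbering x) (M : Numbering y) {w : Z ⟶ W} (L : Numbering w)
    {yw : Y ⟶ W} {t : X ⟶ W} (hz : x ≫ y = z) (hyw : y ≫ w = yw) (ht : z ≫ w = t)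
    (ht' : x ≫ yw = t) (a : X) :
    ((N.comp M hz).comp L ht).pos a = (N.comp (M.comp L hyw) ht').pos a := by
  subst hz hyw ht
  have hfib : ∀ (ω : W) (i k : ℕ) (hi : i < L.arity ω) (hk : k < M.arity (L.fib ω i hi)),
      N.block (M.comp L rfl) ω (∑ l ∈ Finset.range i, M.block L ω l + k) =
        N.block M (L.fib ω i hi) k := by
    intro ω i k hi hk
    have hlt : ∑ l ∈ Finset.range i, M.block L ω l + k < (M.comp L rfl).arity ω := by
      refine lt_of_lt_of_le ?_ (block_le _ hi)
      rw [block, dif_pos hi]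
      exact Nat.add_lt_add_left hk _
    rw [block, dif_pos hlt, M.comp_fib L rfl hi hk, block, dif_pos hk]
  rw [comp_pos, comp_pos, comp_pos, comp_pos, sum_blocks, add_assoc]
  set c := y.toFunctor.obj (x.toFunctor.obj a) with hc
  have hb : (x ≫ y).toFunctor.obj a = c := rfl
  have hω : ((x ≫ y) ≫ w).toFunctor.obj a = w.toFunctor.obj c := rfl
  have hω' : (y ≫ w).toFunctor.obj (x.toFunctor.obj a) = w.toFunctor.obj c := rfl
  rw [hb, hω, hω']
  congr 1
  · refine Finset.sum_congr rfl fun i hi ↦ ?_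
    have hi' : i < L.arity (w.toFunctor.obj c) :=
      lt_trans (Finset.mem_range.1 hi) (L.lt c)
    rw [comp_block, dif_pos hi', show M.block L _ i = _ from dif_pos hi']
    refine Finset.sum_congr rfl fun k hk ↦ ?_
    exact (hfib _ _ _ hi' (Finset.mem_range.1 hk)).symm
  · congr 1
    refine Finset.sum_congr rfl fun k hk ↦ ?_
    have e := L.fib_eq (L.lt c) rfl rfl
    have hk' : k < M.arity c := lt_trans (Finset.mem_range.1 hk) (M.lt (x.toFunctor.obj a))
    have := hfib (w.toFunctor.obj c) _ k (L.lt c) (by rw [e]; exact hk')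
    rw [e] at this
    exact this.symm

/-- The numbering of the fibres of an identity. -/
@[simps arity pos]
def id (X : Cat.{u, u}) : Numbering (𝟙 X) where
  arity _ := 1
  pos _ := 0
  bifib := IsDiscBifib.of_isIso (𝟙 X)
  lt _ := Nat.zero_lt_one
  inj h _ := h
  surj β j hj := ⟨β, rfl, by omega⟩

theorem id_comp_pos (M : Numbering y) (a : Y) :
    ((id Y).comp M (Category.id_comp y)).pos a = M.pos a := by
  have : ∀ i < M.pos a, (id Y).block M (y.toFunctor.obj a) i = 1 := by
    intro i hi
    rw [block, dif_pos (hi.trans (M.lt a)), id_arity]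
  rw [comp_pos, Finset.sum_congr rfl (g := fun _ ↦ 1)]
  · simp
  · intro i hi
    exact this i (Finset.mem_range.1 hi)

theorem comp_id_pos (N : Numbering y) (a : Y) :
    (N.comp (id Z) (Category.comp_id y)).pos a = N.pos a := by
  simp

end Numbering

end NumberingComp

end PolyOpd

namespace PolyOpd

universe u

section Sym

/-- The terminal category. -/
abbrev oneCat : Cat.{u, u} := Cat.of (Discrete PUnit.{u + 1})

/-- The functor to the terminal category. -/
def toOne (X : Cat.{u, u}) : X ⟶ oneCat.{u} := (CategoryTheory.Functor.star X).toCatHom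

theorem toOne_ext {X : Cat.{u, u}} (f g : X ⟶ oneCat.{u}) : f = g :=
  Cat.ext (CategoryTheory.Functor.punit_ext' _ _)

/-- The polynomial `1 ⟵ ℙ_* ⟶ ℙ ⟶ 1`. -/
abbrev symPoly : Poly oneCat.{u} oneCat.{u} where
  E := Cat.of PermStar.{u}
  B := Cat.of PermCat.{u}
  s := toOne _
  p := permU
  t := toOne _
  exponentiable := exponentiable_permU

variable {X Y Z W : Cat.{u, u}} {x : X ⟶ Y} {y : Y ⟶ Z} {z : X ⟶ Z}

/-- The numbering of the fibres given by a structure for `1 ⟵ ℙ_* ⟶ ℙ ⟶ 1`. -/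
abbrev num (c : symPoly.{u}.Cell x) : Numbering x := Numbering.ofIsPullback c.isPullback

/-- The structure given by a numbering of the fibres. -/
noncomputable abbrev Numbering.cell (N : Numbering x) : symPoly.{u}.Cell x :=
  ⟨(N.toPointed ⋙ Pointed.star _).toCatHom, N.toPerm.toCatHom, N.isPullback⟩

theorem sym_cell_ext {c d : symPoly.{u}.Cell x} (h : ∀ a, (num c).pos a = (num d).pos a) : c = d := by
  obtain ⟨e, b, hc⟩ := c
  obtain ⟨e', b', hd⟩ := d
  obtain ⟨rfl, rfl⟩ := ext_of_isPullback hc hd h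
  rfl

/-- The substitution of numberings, with the lexicographic numbering. -/
noncomputable def symSubst (c : symPoly.{u}.Cell x) (d : symPoly.{u}.Cell y) (hz : x ≫ y = z) :
    symPoly.{u}.Cell z :=
  ((num c).comp (num d) hz).cell

theorem symSubst_pos (c : symPoly.{u}.Cell x) (d : symPoly.{u}.Cell y) (hz : x ≫ y = z) (a : X) :
    (num (symSubst c d hz)).pos a = ((num c).comp (num d) hz).pos a := rfl

theorem symSubst_base (c : symPoly.{u}.Cell x) (d : symPoly.{u}.Cell y) (hz : x ≫ y = z)
    {X' Y' Z' : Cat.{u, u}} {x' : X' ⟶ Y'} {y' : Y' ⟶ Z'} {z' : X' ⟶ Z'}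
    {k : X' ⟶ X} {l : Y' ⟶ Y} {m : Z' ⟶ Z} (sq₁ : IsPullback k x' x l)
    (sq₂ : IsPullback l y' y m) (sq : IsPullback k z' z m) (hz' : x' ≫ y' = z') :
    (symSubst c d hz).base sq = symSubst (c.base sq₁) (d.base sq₂) hz' := by
  apply sym_cell_ext
  intro a
  have hx : ∀ a : X', x.toFunctor.obj (k.toFunctor.obj a) = l.toFunctor.obj (x'.toFunctor.obj a) :=
    fun a ↦ CategoryTheory.Functor.congr_obj (congrArg Cat.Hom.toFunctor sq₁.w) a
  have hy : ∀ a : Y', y.toFunctor.obj (l.toFunctor.obj a) = m.toFunctor.obj (y'.toFunctor.obj a) :=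
    fun a ↦ CategoryTheory.Functor.congr_obj (congrArg Cat.Hom.toFunctor sq₂.w) a
  have hzz : ∀ a : X', z.toFunctor.obj (k.toFunctor.obj a) = m.toFunctor.obj (z'.toFunctor.obj a) :=
    fun a ↦ CategoryTheory.Functor.congr_obj (congrArg Cat.Hom.toFunctor sq.w) a
  have hb : ∀ (ζ : Z') (i : ℕ), (num (c.base sq₁)).block (num (d.base sq₂)) ζ i =
      (num c).block (num d) (m.toFunctor.obj ζ) i := by
    intro ζ i
    by_cases h : i < (num d).arity (m.toFunctor.obj ζ)
    · refine (dif_pos (show i < (num (d.base sq₂)).arity ζ from h)).trans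
        (.trans ?_ (dif_pos h).symm)
      have e : (num d).fib (m.toFunctor.obj ζ) i h = l.toFunctor.obj
          ((num (d.base sq₂)).fib ζ i h) := by
        apply Numbering.fib_eq
        · exact (hy _).trans (congrArg m.toFunctor.obj ((num (d.base sq₂)).obj_fib ζ i h))
        · exact (num (d.base sq₂)).pos_fib ζ i h
      rw [e]
      rfl
    · refine (dif_neg (show ¬ i < (num (d.base sq₂)).arity ζ from h)).trans (Eq.symm ?_)
      exact dif_neg h
  change ((num c).comp (num d) hz).pos (k.toFunctor.obj a) =
    ((num (c.base sq₁)).comp (num (d.base sq₂)) hz').pos a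
  rw [Numbering.comp_pos, Numbering.comp_pos, hx, hzz]
  congr 1
  exact Finset.sum_congr rfl fun i _ ↦ (hb _ _).symm

/-- The multiplication. -/
noncomputable def symMul : symPoly.{u}.comp symPoly.{u} ⟶ symPoly.{u} :=
  (symSubst (symPoly.compCell₁ symPoly) (symPoly.compCell₂ symPoly)
    (Poly.compLeft_compRight _ _)).toHom (toOne_ext _ _) (toOne_ext _ _)

/-- The unit. -/
noncomputable def symUnit : Poly.idPoly oneCat.{u} ⟶ symPoly.{u} :=
  ((Numbering.id oneCat.{u}).cell).toHom (toOne_ext _ _) (toOne_ext _ _)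

theorem map_symMul (c : symPoly.{u}.Cell x) (d : symPoly.{u}.Cell y)
    (h : c.b ≫ symPoly.t = d.e ≫ symPoly.s) (hz : x ≫ y = z) :
    (c.comp d h hz).map symMul = symSubst c d hz := by
  obtain ⟨sq₁, sq₂, h1, h2⟩ := c.exists_base d h hz
  rw [symMul, Poly.Cell.map_toHom, symSubst_base _ _ _ sq₁ sq₂ _ hz, ← h1, ← h2]

theorem map_symUnit (f : X ⟶ oneCat.{u}) :
    (Poly.unitCell f).map symUnit = (Numbering.id X).cell := by
  rw [symUnit, Poly.Cell.map_toHom]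
  apply sym_cell_ext
  intro a
  rfl

/-- The polynomial monad `S` for symmetric monoidal categories. -/
noncomputable def SymMnd : PolyMnd Cat.{u, u} where
  I := ⟨oneCat⟩
  P := symPoly
  mon := PolyMnd.monOfCell symPoly symUnit symMul
    (fun {X Y x} c ↦ by
      rw [map_symMul, map_symUnit]
      exact sym_cell_ext (Numbering.id_comp_pos (num c)))
    (fun {X Y x} c ↦ by
      rw [map_symMul, map_symUnit]
      exact sym_cell_ext (Numbering.comp_id_pos (num c)))
    (fun {X Y Z W x y z} c d e w w' ↦ by
      rw [map_symMul, map_symMul, map_symMul, map_symMul]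
      exact sym_cell_ext (Numbering.comp_assoc_pos (num c) (num d) (num e) rfl rfl rfl
        (Category.assoc _ _ _).symm))

end Sym

end PolyOpd

namespace PolyOpd

universe u

section Operads

/-- Collections. -/
structure Coll where
  I : Type u
  Hom : {n : ℕ} → (Fin n → I) → I → Type u
  act : {n : ℕ} → {s : Fin n → I} → {i : I} → Hom s i → (ρ : Equiv.Perm (Fin n)) → Hom (s ∘ ρ) i
  act_one : ∀ {n : ℕ} {s : Fin n → I} {i : I} (α : Hom s i), act α 1 = α
  act_act : ∀ {n : ℕ} {s : Fin n → I} {i : I} (α : Hom s i) (ρ₁ ρ₂ : Equiv.Perm (Fin n)),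
    act (act α ρ₁) ρ₂ = act α (ρ₁ * ρ₂)

/-- The arrows of a collection, with arbitrary source and target. -/
@[ext]
structure Coll.Arrow (T : Coll.{u}) : Type u where
  n : ℕ
  src : Fin n → T.I
  tgt : T.I
  hom : T.Hom src tgt

namespace Coll

/-- The action of a bijection `σ : Fin m ≃ Fin n`; here necessarily `m = n`. -/
def actEquiv (T : Coll.{u}) {m n : ℕ} {s : Fin n → T.I} {i : T.I} (α : T.Hom s i)
    (σ : Fin m ≃ Fin n) : T.Hom (s ∘ σ) i :=
  match m, Fin.equiv_iff_eq.1 ⟨σ⟩, σ with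
  | _, rfl, σ => T.act α σ

/-- The action of a bijection on an arrow. -/
@[simps n src tgt]
def Arrow.act {T : Coll.{u}} (α : T.Arrow) {m : ℕ} (σ : Fin m ≃ Fin α.n) : T.Arrow :=
  ⟨m, α.src ∘ σ, α.tgt, T.actEquiv α.hom σ⟩

end Coll

/-- The concatenation of sequences. -/
def concat {I : Type u} {n : ℕ} {m : Fin n → ℕ} (t : ∀ j, Fin (m j) → I) (l : Fin (∑ j, m j)) : I :=
  t (finSigmaFinEquiv.symm l).1 (finSigmaFinEquiv.symm l).2

/-- The permutation `ρ(τ_j)_j` of a concatenation which permutes the blocks using `ρ`, and the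
elements within the `j`-th block using `τ j`. -/
def blockPerm {n : ℕ} {m : Fin n → ℕ} (ρ : Equiv.Perm (Fin n)) (τ : ∀ j, Equiv.Perm (Fin (m j))) :
    Fin (∑ j, m (ρ j)) ≃ Fin (∑ j, m j) :=
  finSigmaFinEquiv.symm.trans ((Equiv.sigmaCongr ρ fun j ↦ τ (ρ j)).trans finSigmaFinEquiv)

/-- Coloured symmetric operads. -/
structure Opd extends Coll.{u} where
  unit : (i : I) → Hom (fun _ : Fin 1 ↦ i) i
  comp : {n : ℕ} → {s : Fin n → I} → {i : I} → Hom s i → {m : Fin n → ℕ} →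
    {t : ∀ j, Fin (m j) → I} → (∀ j, Hom (t j) (s j)) → Hom (concat t) i
  unit_comp : ∀ {n : ℕ} {s : Fin n → I} {i : I} (α : Hom s i),
    Coll.Arrow.mk (T := toColl) _ _ _ (comp (unit i) fun _ ↦ α) = ⟨_, _, _, α⟩
  comp_unit : ∀ {n : ℕ} {s : Fin n → I} {i : I} (α : Hom s i),
    Coll.Arrow.mk (T := toColl) _ _ _ (comp α fun j ↦ unit (s j)) = ⟨_, _, _, α⟩
  comp_comp : ∀ {n : ℕ} {s : Fin n → I} {i : I} (α : Hom s i) {m : Fin n → ℕ}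
    {t : ∀ j, Fin (m j) → I} (β : ∀ j, Hom (t j) (s j)) {p : ∀ j, Fin (m j) → ℕ}
    {r : ∀ j k, Fin (p j k) → I} (γ : ∀ j k, Hom (r j k) (t j k)),
    Coll.Arrow.mk (T := toColl) _ _ _ (comp α fun j ↦ comp (β j) (γ j)) =
      ⟨_, _, _, comp (comp α β) fun l ↦
        γ (finSigmaFinEquiv.symm l).1 (finSigmaFinEquiv.symm l).2⟩
  comp_act : ∀ {n : ℕ} {s : Fin n → I} {i : I} (α : Hom s i) {m : Fin n → ℕ}
    {t : ∀ j, Fin (m j) → I} (β : ∀ j, Hom (t j) (s j)) (ρ : Equiv.Perm (Fin n))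
    (τ : ∀ j, Equiv.Perm (Fin (m j))),
    Coll.Arrow.mk (T := toColl) _ _ _ (toColl.actEquiv (comp α β) (blockPerm ρ τ)) =
      ⟨_, _, _, comp (act α ρ) fun j ↦ act (β (ρ j)) (τ (ρ j))⟩

/-- Morphisms of collections. -/
@[ext]
structure Coll.Mor (S T : Coll.{u}) where
  f : S.I → T.I
  map : {n : ℕ} → {s : Fin n → S.I} → {i : S.I} → S.Hom s i → T.Hom (f ∘ s) (f i)
  map_act : ∀ {n : ℕ} {s : Fin n → S.I} {i : S.I} (α : S.Hom s i) (ρ : Equiv.Perm (Fin n)),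
    map (S.act α ρ) = T.act (map α) ρ

/-- Morphisms of operads. -/
@[ext]
structure Opd.Mor (S T : Opd.{u}) extends Coll.Mor S.toColl T.toColl where
  map_unit : ∀ i, map (S.unit i) = T.unit (f i)
  map_comp : ∀ {n : ℕ} {s : Fin n → S.I} {i : S.I} (α : S.Hom s i) {m : Fin n → ℕ}
    {t : ∀ j, Fin (m j) → S.I} (β : ∀ j, S.Hom (t j) (s j)),
    map (S.comp α β) = T.comp (map α) fun j ↦ map (β j)

instance : Category Coll.{u} where
  Hom := Coll.Mor
  id S := ⟨_root_.id, fun α ↦ α, fun _ _ ↦ rfl⟩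
  comp F G := ⟨G.f ∘ F.f, fun α ↦ G.map (F.map α), fun α ρ ↦ by rw [F.map_act, G.map_act]⟩

/-- The category of operads. -/
instance : Category Opd.{u} where
  Hom := Opd.Mor
  id S :=
    { toMor := 𝟙 S.toColl
      map_unit := fun _ ↦ rfl
      map_comp := fun _ _ _ _ ↦ rfl }
  comp F G :=
    { toMor := CategoryStruct.comp (obj := Coll) F.toMor G.toMor
      map_unit := fun i ↦ (congrArg G.map (F.map_unit i)).trans (G.map_unit _)
      map_comp := fun α _ _ β ↦ (congrArg G.map (F.map_comp α β)).trans (G.map_comp _ _) }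

end Operads

end PolyOpd

namespace PolyOpd

universe u

section CollPoly

namespace Coll

variable {T : Coll.{u}}

theorem Arrow.act_refl (α : T.Arrow) : α.act (Equiv.refl _) = α := by
  obtain ⟨n, s, i, α⟩ := α
  have : T.actEquiv α (Equiv.refl (Fin n)) = α := T.act_one α
  change Arrow.mk n (s ∘ id) i (T.actEquiv α (Equiv.refl (Fin n))) = _
  rw [this]
  rfl

theorem Arrow.act_act (α : T.Arrow) {m k : ℕ} (σ : Fin m ≃ Fin α.n) (τ : Fin k ≃ Fin m) :
    (α.act σ).act τ = α.act (τ.trans σ) := by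
  obtain ⟨n, s, i, α⟩ := α
  obtain rfl : m = n := Fin.equiv_iff_eq.1 ⟨σ⟩
  obtain rfl : k = m := Fin.equiv_iff_eq.1 ⟨τ⟩
  change Arrow.mk k _ i (T.act (T.act α σ) τ) = Arrow.mk k _ i (T.act α (σ * τ))
  rw [T.act_act]
  rfl

theorem Arrow.act_congr {α β : T.Arrow} (h : α = β) {m m' : ℕ} {σ : Fin m ≃ Fin α.n}
    {τ : Fin m' ≃ Fin β.n} (hm : m = m')
    (hσ : ∀ (j : Fin m) (j' : Fin m'), (j : ℕ) = j' → (σ j : ℕ) = τ j') :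
    α.act σ = β.act τ := by
  subst h hm
  obtain rfl : σ = τ := Equiv.ext fun j ↦ Fin.ext (hσ j j rfl)
  rfl

theorem Arrow.src_congr {α β : T.Arrow} (h : α = β) {j : Fin α.n} {j' : Fin β.n}
    (hj : (j : ℕ) = j') : α.src j = β.src j' := by
  subst h
  obtain rfl := Fin.ext hj
  rfl

/-- The morphisms `α ⟶ β` of the category `B_T` of arrows of `T`: the permutations `ρ` with
`α = βρ`. -/
@[ext]
structure Arrow.Hom (α β : T.Arrow) : Type u where
  perm : Fin α.n ≃ Fin β.n
  eq : α = β.act perm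

/-- The category `B_T`. -/
instance : Category.{u} T.Arrow where
  Hom := Arrow.Hom
  id α := ⟨Equiv.refl _, α.act_refl.symm⟩
  comp {α β γ} f g := ⟨f.perm.trans g.perm, by
    refine f.eq.trans ?_
    refine (Arrow.act_congr g.eq (τ := f.perm) rfl ?_).trans (Arrow.act_act _ _ _)
    intro j j' h
    rw [Fin.ext h]
    rfl⟩

/-- The discrete fibration `b_T : B_T ⟶ ℙ`. -/
@[simps]
def arity (T : Coll.{u}) : T.Arrow ⥤ PermCat.{u} where
  obj α := ⟨α.n⟩
  map f := ⟨f.perm⟩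

/-- The category `E_T` of pairs `(α, j)`. -/
abbrev Input (T : Coll.{u}) : Type u := Pointed T.arity

/-- The source functor `s_T`. -/
@[simps obj]
def srcFunctor (T : Coll.{u}) : T.Input ⥤ Discrete T.I where
  obj a := ⟨a.base.src a.pt⟩
  map {a a'} f := Discrete.eqToHom (by
    have h1 := f.val.eq
    have h2 := f.map_pt
    rw [← h2]
    exact Arrow.src_congr h1 rfl)
  map_id _ := Subsingleton.elim _ _
  map_comp _ _ := Subsingleton.elim _ _

/-- The target functor `t_T`. -/
@[simps obj]
def tgtFunctor (T : Coll.{u}) : T.Arrow ⥤ Discrete T.I where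
  obj α := ⟨α.tgt⟩
  map {α β} f := Discrete.eqToHom (show α.tgt = (β.act f.perm).tgt from congrArg Arrow.tgt f.eq)
  map_id _ := Subsingleton.elim _ _
  map_comp _ _ := Subsingleton.elim _ _

/-- The category of colours. -/
abbrev colours (T : Coll.{u}) : Cat.{u, u} := Cat.of (Discrete T.I)

/-- The polynomial `P_T` of a collection `T`. -/
abbrev poly (T : Coll.{u}) : Poly T.colours T.colours where
  E := Cat.of T.Input
  B := Cat.of T.Arrow
  s := T.srcFunctor.toCatHom
  p := (Pointed.proj T.arity).toCatHom
  t := T.tgtFunctor.toCatHom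
  exponentiable := exponentiable_permU.of_isPullback (Pointed.isPullback T.arity)

end Coll

theorem discreteFunctor_ext {X I : Type u} [Category.{u} X] {F G : X ⥤ Discrete I}
    (h : ∀ x, (F.obj x).as = (G.obj x).as) : F = G :=
  CategoryTheory.Functor.ext (fun x ↦ Discrete.ext (h x)) fun _ _ _ ↦ Subsingleton.elim _ _

namespace CollCell

variable {T : Coll.{u}} {X Y Z W : Cat.{u, u}} {x : X ⟶ Y} {y : Y ⟶ Z} {z : X ⟶ Z}

/-- The underlying structure for `1 ⟵ ℙ_* ⟶ ℙ ⟶ 1`. -/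
abbrev toSym (c : T.poly.Cell x) : symPoly.{u}.Cell x :=
  ⟨c.e ≫ (Pointed.star T.arity).toCatHom, c.b ≫ T.arity.toCatHom,
    c.isPullback.paste_horiz (Pointed.isPullback T.arity)⟩

/-- The arrow over an object of the base. -/
abbrev arr (c : T.poly.Cell x) (β : Y) : T.Arrow := c.b.toFunctor.obj β

/-- The input over an object. -/
abbrev inp (c : T.poly.Cell x) (a : X) : T.Input := c.e.toFunctor.obj a

theorem inp_base (c : T.poly.Cell x) (a : X) : (inp c a).base = arr c (x.toFunctor.obj a) :=
  CategoryTheory.Functor.congr_obj (congrArg Cat.Hom.toFunctor c.isPullback.w) a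

theorem inp_pt (c : T.poly.Cell x) (a : X) : ((inp c a).pt : ℕ) = (num (toSym c)).pos a := rfl

theorem src_inp (c : T.poly.Cell x) (a : X) {k : Fin (arr c (x.toFunctor.obj a)).n}
    (hk : (k : ℕ) = (num (toSym c)).pos a) :
    (inp c a).base.src (inp c a).pt = (arr c (x.toFunctor.obj a)).src k :=
  Coll.Arrow.src_congr (inp_base c a) hk.symm

theorem arrFunctor_ext {A : Type u} [Category.{u} A] {F G : A ⥤ T.Arrow}
    (h : F ⋙ T.arity = G ⋙ T.arity) (h' : ∀ β, F.obj β = G.obj β) : F = G := by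
  refine CategoryTheory.Functor.hext h' fun β β' v ↦ ?_
  have key : ∀ {α α' γ γ' : T.Arrow} (h1 : α = α') (h2 : γ = γ') (f : α ⟶ γ) (g : α' ⟶ γ'),
      (∀ (j : Fin α.n) (j' : Fin α'.n), (j : ℕ) = j' → (f.perm j : ℕ) = g.perm j') → HEq f g := by
    intro α α' γ γ' h1 h2 f g hfg
    subst h1 h2
    refine heq_of_eq (Coll.Arrow.Hom.ext (Equiv.ext fun j ↦ Fin.ext (hfg j j rfl)))
  exact key (h' β) (h' β') _ _ fun j j' hj ↦ permFunctor_congr h v hj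

theorem ext {c d : T.poly.Cell x} (h : ∀ a, (num (toSym c)).pos a = (num (toSym d)).pos a)
    (h' : ∀ β, arr c β = arr d β) : c = d := by
  have hs : toSym c = toSym d := sym_cell_ext h
  have hb : c.b = d.b := Cat.ext (arrFunctor_ext
    (congrArg Cat.Hom.toFunctor (congrArg Poly.Cell.b hs)) h')
  have he : c.e = d.e := by
    apply (Pointed.isPullback T.arity).hom_ext
    · exact congrArg Poly.Cell.e hs
    · exact c.isPullback.w.trans ((congrArg _ hb).trans d.isPullback.w.symm)
  exact Poly.Cell.ext he hb

theorem exists_cell (s : symPoly.{u}.Cell x) (A : Y → T.Arrow)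
    (h : ∀ β, (A β).n = (num s).arity β)
    (h' : ∀ {β β' : Y} (v : β ⟶ β'), ∃ σ : Fin (A β).n ≃ Fin (A β').n, A β = (A β').act σ ∧
      ∀ {a a' : X}, Lift x.toFunctor v a a' →
        ∀ j : Fin (A β).n, (j : ℕ) = (num s).pos a → (σ j : ℕ) = (num s).pos a') :
    ∃ c : T.poly.Cell x, toSym c = s ∧ ∀ β, arr c β = A β := by
  have h'' : ∀ (β β' : Y) (v : β ⟶ β'), ∃ σ : Fin (A β).n ≃ Fin (A β').n, A β = (A β').act σ ∧
      ∀ (j : Fin (A β).n) (j' : Fin ((toP s.b).obj β).n), (j : ℕ) = j' →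
        (σ j : ℕ) = ((toP s.b).map v).perm j' := by
    intro β β' v
    obtain ⟨σ, h1, h2⟩ := h' v
    refine ⟨σ, h1, fun j j' hj ↦ ?_⟩
    obtain ⟨a, a', hv, e, -⟩ := (num s).exists_of_perm v ⟨j, lt_of_lt_of_eq j.2 (h β)⟩
    rw [h2 hv j e]
    exact (perm_eq_of_isPullback s.isPullback hv (hj.symm.trans e)).symm
  choose σ hσ hval using h''
  have hid : ∀ β, σ β β (𝟙 β) = Equiv.refl _ := by
    intro β
    ext j
    rw [hval β β (𝟙 β) j (Fin.cast (h β) j) rfl, (toP s.b).map_id]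
    rfl
  have hcomp : ∀ β β' β'' (v : β ⟶ β') (v' : β' ⟶ β''),
      σ β β'' (v ≫ v') = (σ β β' v).trans (σ β' β'' v') := by
    intro β β' β'' v v'
    ext j
    have e := hval β β' v j (Fin.cast (h β) j) rfl
    rw [hval _ _ _ j (Fin.cast (h β) j) rfl, (toP s.b).map_comp]
    exact (hval _ _ v' (σ β β' v j) _ e).symm
  let b : Y ⥤ T.Arrow :=
    { obj := A
      map := fun {β β'} v ↦ ⟨σ β β' v, hσ β β' v⟩
      map_id := fun β ↦ Coll.Arrow.Hom.ext (hid β)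
      map_comp := fun v v' ↦ Coll.Arrow.Hom.ext (hcomp _ _ _ v v') }
  have hb : b ⋙ T.arity = toP s.b :=
    permFunctor_ext h fun v j j' hj ↦ hval _ _ v j j' hj
  let b' : Y ⟶ Cat.of T.Arrow := b.toCatHom
  have hb' : b' ≫ T.arity.toCatHom = s.b := Cat.ext hb
  obtain ⟨e, he1, he2⟩ := (Pointed.isPullback T.arity).exists_lift s.e (x ≫ b')
    (by rw [s.isPullback.w, Category.assoc, hb'])
  have hp : IsPullback e x (Pointed.proj T.arity).toCatHom b' := by
    refine IsPullback.of_right ?_ he2 (Pointed.isPullback T.arity)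
    rw [he1, hb']
    exact s.isPullback
  exact ⟨⟨e, b', hp⟩, Poly.Cell.ext he1 hb', fun β ↦ rfl⟩

/-- The structure for `P_T` given by a numbering of the fibres and a compatible family of
arrows. -/
noncomputable def mk (s : symPoly.{u}.Cell x) (A : Y → T.Arrow)
    (h : ∀ β, (A β).n = (num s).arity β)
    (h' : ∀ {β β' : Y} (v : β ⟶ β'), ∃ σ : Fin (A β).n ≃ Fin (A β').n, A β = (A β').act σ ∧
      ∀ {a a' : X}, Lift x.toFunctor v a a' →
        ∀ j : Fin (A β).n, (j : ℕ) = (num s).pos a → (σ j : ℕ) = (num s).pos a') :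
    T.poly.Cell x :=
  (exists_cell s A h h').choose

theorem toSym_mk (s : symPoly.{u}.Cell x) (A : Y → T.Arrow) (h h') : toSym (mk s A h h') = s :=
  (exists_cell s A h h').choose_spec.1

theorem arr_mk (s : symPoly.{u}.Cell x) (A : Y → T.Arrow) (h h') (β : Y) :
    arr (mk s A h h') β = A β :=
  (exists_cell s A h h').choose_spec.2 β

end CollCell

end CollPoly

end PolyOpd

namespace PolyOpd

universe u

section OpdArrows

namespace Opd

open Coll (Arrow)

variable {T : Opd.{u}}

/-- The identity arrows. -/
@[simps]
def unitArr (T : Opd.{u}) (i : T.I) : T.Arrow := ⟨1, fun _ ↦ i, i, T.unit i⟩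

/-- The composite of composable arrows. -/
@[simps n src tgt]
def compArr (α : T.Arrow) (β : Fin α.n → T.Arrow) (h : ∀ j, (β j).tgt = α.src j) : T.Arrow :=
  ⟨∑ j, (β j).n, concat fun j ↦ (β j).src, α.tgt, T.comp α.hom fun j ↦ h j ▸ (β j).hom⟩

theorem compArr_congr {α α' : T.Arrow} (hα : α = α') {β : Fin α.n → T.Arrow}
    {β' : Fin α'.n → T.Arrow} (hβ : ∀ (j : Fin α.n) (j' : Fin α'.n), (j : ℕ) = j' → β j = β' j')
    (h : ∀ j, (β j).tgt = α.src j) (h' : ∀ j, (β' j).tgt = α'.src j) :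
    compArr α β h = compArr α' β' h' := by
  subst hα
  obtain rfl : β = β' := funext fun j ↦ hβ j j rfl
  rfl

theorem unitArr_compArr (α : T.Arrow) (i : T.I) (h : ∀ j, α.tgt = (T.unitArr i).src j) :
    compArr (T.unitArr i) (fun _ ↦ α) h = α := by
  obtain ⟨n, s, i', α⟩ := α
  obtain rfl : i' = i := h (0 : Fin 1)
  exact T.unit_comp α

theorem compArr_unitArr (α : T.Arrow) (β : Fin α.n → T.Arrow) (hβ : ∀ j, β j = T.unitArr (α.src j))
    (h : ∀ j, (β j).tgt = α.src j) : compArr α β h = α := by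
  obtain rfl : β = fun j ↦ T.unitArr (α.src j) := funext hβ
  exact T.comp_unit α.hom

theorem compArr_compArr_aux {n : ℕ} {s : Fin n → T.I} {i : T.I} (α : T.Hom s i) {m : Fin n → ℕ}
    {t : ∀ j, Fin (m j) → T.I} {s' : Fin n → T.I} (hs : ∀ j, s' j = s j)
    (β : ∀ j, T.Hom (t j) (s' j)) {p : ∀ j, Fin (m j) → ℕ}
    {r : ∀ j k, Fin (p j k) → T.I} {t' : ∀ j, Fin (m j) → T.I} (ht : ∀ j k, t' j k = t j k)
    (γ : ∀ j k, T.Hom (r j k) (t' j k)) :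
    Arrow.mk (T := T.toColl) _ _ _ (T.comp α fun j ↦ hs j ▸
        T.comp (β j) fun k ↦ (ht j k ▸ γ j k : T.Hom (r j k) (t j k))) =
      ⟨_, _, _, T.comp (T.comp α fun j ↦ (hs j ▸ β j : T.Hom (t j) (s j))) fun l ↦
        (ht _ _ ▸ γ (finSigmaFinEquiv.symm l).1 (finSigmaFinEquiv.symm l).2 :
          T.Hom _ (concat t l))⟩ := by
  obtain rfl : s' = s := funext hs
  obtain rfl : t' = t := funext fun j ↦ funext (ht j)
  exact T.comp_comp α β γ

theorem compArr_compArr (α : T.Arrow) (β : Fin α.n → T.Arrow) (h : ∀ j, (β j).tgt = α.src j)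
    (γ : ∀ j, Fin (β j).n → T.Arrow) (hγ : ∀ j k, (γ j k).tgt = (β j).src k) :
    compArr α (fun j ↦ compArr (β j) (γ j) (hγ j)) h =
      compArr (compArr α β h)
        (fun l ↦ γ (finSigmaFinEquiv.symm l).1 (finSigmaFinEquiv.symm l).2) (fun _ ↦ hγ _ _) :=
  compArr_compArr_aux α.hom h (fun j ↦ (β j).hom) hγ fun j k ↦ (γ j k).hom

theorem compArr_act_aux {n : ℕ} {s : Fin n → T.I} {i : T.I} (α : T.Hom s i) {m : Fin n → ℕ}
    {t : ∀ j, Fin (m j) → T.I} {s' : Fin n → T.I} (hs : ∀ j, s' j = s j)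
    (β : ∀ j, T.Hom (t j) (s' j)) {n' : ℕ} (ρ : Fin n' ≃ Fin n)
    {m' : Fin n' → ℕ} (τ : ∀ j, Fin (m' j) ≃ Fin (m (ρ j)))
    (σ : Fin (∑ j, m' j) ≃ Fin (∑ j, m j))
    (hσ : ∀ j k, σ (finSigmaFinEquiv ⟨j, k⟩) = finSigmaFinEquiv ⟨ρ j, τ j k⟩)
    (hs' : ∀ j, s' (ρ j) = s (ρ j)) :
    Arrow.mk (T := T.toColl) _ _ _
        (T.actEquiv (T.comp α fun j ↦ (hs j ▸ β j : T.Hom (t j) (s j))) σ) =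
      ⟨_, _, _, T.comp (T.actEquiv α ρ) fun j ↦
        (hs' j ▸ T.actEquiv (β (ρ j)) (τ j) : T.Hom _ (s (ρ j)))⟩ := by
  obtain rfl : s' = s := funext hs
  obtain rfl : n' = n := Fin.equiv_iff_eq.1 ⟨ρ⟩
  obtain rfl : m' = fun j ↦ m (ρ j) := funext fun j ↦ Fin.equiv_iff_eq.1 ⟨τ j⟩
  obtain ⟨τ', rfl⟩ : ∃ τ' : ∀ j, Equiv.Perm (Fin (m j)), τ = fun j ↦ τ' (ρ j) := by
    refine ⟨Equiv.piCongrLeft (fun j ↦ Equiv.Perm (Fin (m j))) ρ τ, funext fun j ↦ ?_⟩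
    exact (Equiv.piCongrLeft_apply_apply (fun j ↦ Equiv.Perm (Fin (m j))) ρ τ j).symm
  have : σ = blockPerm ρ τ' := by
    ext l
    obtain ⟨⟨j, k⟩, rfl⟩ := finSigmaFinEquiv.surjective l
    rw [hσ]
    simp only [blockPerm, Equiv.trans_apply, Equiv.symm_apply_apply]
    rfl
  rw [this]
  exact T.comp_act α β ρ τ'

theorem compArr_act (α : T.Arrow) (β : Fin α.n → T.Arrow) (h : ∀ j, (β j).tgt = α.src j) {n' : ℕ}
    (ρ : Fin n' ≃ Fin α.n) {m' : Fin n' → ℕ} (τ : ∀ j, Fin (m' j) ≃ Fin (β (ρ j)).n)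
    (σ : Fin (∑ j, m' j) ≃ Fin (compArr α β h).n)
    (hσ : ∀ j k, (σ (finSigmaFinEquiv ⟨j, k⟩) : ℕ) =
      (finSigmaFinEquiv ⟨ρ j, τ j k⟩ : Fin (∑ j, (β j).n)))
    (h' : ∀ j, ((β (ρ j)).act (τ j)).tgt = (α.act ρ).src j) :
    compArr (α.act ρ) (fun j ↦ (β (ρ j)).act (τ j)) h' = (compArr α β h).act σ := by
  exact (compArr_act_aux α.hom h (fun j ↦ (β j).hom) ρ τ σ (fun j k ↦ Fin.ext (hσ j k)) h').symm

theorem finSigma_val {n : ℕ} {m : Fin n → ℕ} (f : ℕ → ℕ) (hf : ∀ j : Fin n, f j = m j) (j : Fin n)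
    (k : Fin (m j)) :
    (finSigmaFinEquiv (⟨j, k⟩ : Σ j, Fin (m j)) : ℕ) = ∑ i ∈ Finset.range j, f i + k := by
  rw [finSigmaFinEquiv_apply, Finset.sum_range]
  congr 1
  exact Finset.sum_congr rfl fun i _ ↦ (hf _).symm

end Opd

end OpdArrows

end PolyOpd

namespace PolyOpd

universe u

section OpdSubst

theorem Opd.concat_finSigma {I : Type u} {n : ℕ} {m : Fin n → ℕ} (t : ∀ j, Fin (m j) → I) (j : Fin n)
    (k : Fin (m j)) : concat t (finSigmaFinEquiv ⟨j, k⟩) = t j k := by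
  rw [concat, Equiv.symm_apply_apply]

namespace CollCell

open Opd (compArr unitArr)

theorem src_inp' {T : Coll.{u}} {Y Z : Cat.{u, u}} {y : Y ⟶ Z} (d : T.poly.Cell y) {b : Y} {ζ : Z}
    (hb : y.toFunctor.obj b = ζ) {j : Fin (arr d ζ).n} (hj : (j : ℕ) = (num (toSym d)).pos b) :
    (inp d b).base.src (inp d b).pt = (arr d ζ).src j :=
  Coll.Arrow.src_congr ((inp_base d b).trans (congrArg (arr d) hb)) hj.symm

/-- The object over `ζ` which is numbered by an input. -/
noncomputable def atInput {T : Coll.{u}} {Y Z : Cat.{u, u}} {y : Y ⟶ Z} (d : T.poly.Cell y) (ζ : Z)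
    (j : Fin (arr d ζ).n) : Y :=
  (num (toSym d)).fib ζ j j.2

section

variable {T : Opd.{u}} {X Y Z W : Cat.{u, u}} {x : X ⟶ Y} {y : Y ⟶ Z} {z : X ⟶ Z}

theorem obj_at (d : T.poly.Cell y) (ζ : Z) (j : Fin (arr d ζ).n) :
    y.toFunctor.obj (atInput d ζ j) = ζ := Numbering.obj_fib _ _ _ _

theorem pos_at (d : T.poly.Cell y) (ζ : Z) (j : Fin (arr d ζ).n) :
    (num (toSym d)).pos (atInput d ζ j) = j := Numbering.pos_fib _ _ _ _

theorem at_eq (d : T.poly.Cell y) {ζ : Z} {j : Fin (arr d ζ).n} {b : Y}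
    (h : y.toFunctor.obj b = ζ) (h' : (num (toSym d)).pos b = j) : atInput d ζ j = b :=
  Numbering.fib_eq _ _ h h'

theorem tgt_arr {c : T.poly.Cell x} {d : T.poly.Cell y} (w : c.b ≫ T.poly.t = d.e ≫ T.poly.s)
    (b : Y) : (arr c b).tgt = (inp d b).base.src (inp d b).pt :=
  congrArg Discrete.as (CategoryTheory.Functor.congr_obj (congrArg Cat.Hom.toFunctor w) b)

theorem tgt_arr' {c : T.poly.Cell x} {d : T.poly.Cell y} (w : c.b ≫ T.poly.t = d.e ≫ T.poly.s)
    {b : Y} {ζ : Z} (hb : y.toFunctor.obj b = ζ) {j : Fin (arr d ζ).n}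
    (hj : (j : ℕ) = (num (toSym d)).pos b) : (arr c b).tgt = (arr d ζ).src j :=
  (tgt_arr w b).trans (src_inp' d hb hj)

variable (c : T.poly.Cell x) (d : T.poly.Cell y) (w : c.b ≫ T.poly.t = d.e ≫ T.poly.s)
  (hz : x ≫ y = z)

/-- The composites of arrows which define the multiplication. -/
noncomputable def substArr (ζ : Z) : T.Arrow :=
  compArr (arr d ζ) (fun j ↦ arr c (atInput d ζ j))
    (fun _ ↦ tgt_arr' w (obj_at _ _ _) (pos_at _ _ _).symm)

theorem block_arr (ζ : Z) (j : Fin (arr d ζ).n) : (num (toSym c)).block (num (toSym d)) ζ j =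
    (arr c (atInput d ζ j)).n :=
  dif_pos (show (j : ℕ) < (num (toSym d)).arity ζ from j.2)

theorem substArr_n (ζ : Z) :
    (substArr c d w ζ).n = (num (symSubst (toSym c) (toSym d) hz)).arity ζ := by
  refine Eq.trans ?_ (Finset.sum_range _).symm
  change ∑ j : Fin (arr d ζ).n, (arr c (atInput d ζ j)).n = ∑ j : Fin (arr d ζ).n, _
  exact Finset.sum_congr rfl fun j _ ↦ (block_arr c d ζ j).symm

theorem finSigma_pos {a : X} {ζ : Z} {j : Fin (arr d ζ).n} {k : Fin (arr c (atInput d ζ j)).n}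
    (h1 : x.toFunctor.obj a = atInput d ζ j) (h2 : (k : ℕ) = (num (toSym c)).pos a) :
    ((finSigmaFinEquiv (⟨j, k⟩ : Σ j : Fin (arr d ζ).n, Fin (arr c (atInput d ζ j)).n) :
      Fin (∑ j : Fin (arr d ζ).n, (arr c (atInput d ζ j)).n)) : ℕ) =
      ((num (toSym c)).comp (num (toSym d)) hz).pos a := by
  rw [Opd.finSigma_val ((num (toSym c)).block (num (toSym d)) ζ) (block_arr c d ζ)]
  have h3 : z.toFunctor.obj a = ζ := by
    rw [← hz]
    exact (congrArg y.toFunctor.obj h1).trans (obj_at _ _ _)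
  rw [Numbering.comp_pos, h3, h1, pos_at, h2]

theorem exists_input (ζ : Z) (l : Fin (substArr c d w ζ).n) {a : X} (h : z.toFunctor.obj a = ζ)
    (h' : (l : ℕ) = ((num (toSym c)).comp (num (toSym d)) hz).pos a) :
    ∃ (j : Fin (arr d ζ).n) (k : Fin (arr c (atInput d ζ j)).n),
      x.toFunctor.obj a = atInput d ζ j ∧ (k : ℕ) = (num (toSym c)).pos a ∧
        l = (finSigmaFinEquiv (⟨j, k⟩ : Σ j : Fin (arr d ζ).n, Fin (arr c (atInput d ζ j)).n) :
          Fin (∑ j : Fin (arr d ζ).n, (arr c (atInput d ζ j)).n)) := by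
  have e : y.toFunctor.obj (x.toFunctor.obj a) = ζ := by
    rw [← h, ← hz]
    rfl
  subst e
  have e := at_eq d (j := ⟨_, (num (toSym d)).lt (x.toFunctor.obj a)⟩)
    (b := x.toFunctor.obj a) rfl rfl
  obtain ⟨k, hk⟩ : ∃ k : Fin (arr c (atInput d _ ⟨_, (num (toSym d)).lt (x.toFunctor.obj a)⟩)).n,
      (k : ℕ) = (num (toSym c)).pos a := by
    refine ⟨⟨_, lt_of_lt_of_eq ((num (toSym c)).lt a) ?_⟩, rfl⟩
    exact congrArg (fun b ↦ (arr c b).n) e.symm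
  exact ⟨_, k, e.symm, hk, Fin.ext (h'.trans (finSigma_pos c d hz e.symm hk).symm)⟩

theorem substArr_map {ζ ζ' : Z} (v : ζ ⟶ ζ') : ∃ σ : Fin (substArr c d w ζ).n ≃
    Fin (substArr c d w ζ').n, substArr c d w ζ = (substArr c d w ζ').act σ ∧
      ∀ {a a' : X}, Lift z.toFunctor v a a' → ∀ j : Fin (substArr c d w ζ).n,
        (j : ℕ) = (num (symSubst (toSym c) (toSym d) hz)).pos a →
          (σ j : ℕ) = (num (symSubst (toSym c) (toSym d) hz)).pos a' := by
  let N := num (symSubst (toSym c) (toSym d) hz)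
  let Nd := num (toSym d)
  let Nc := num (toSym c)
  let σ : Fin (substArr c d w ζ).n ≃ Fin (substArr c d w ζ').n :=
    (finCongr (substArr_n c d w hz ζ)).trans
      ((N.perm v).trans (finCongr (substArr_n c d w hz ζ').symm))
  have hσ : ∀ {a a' : X}, Lift z.toFunctor v a a' → ∀ j : Fin (substArr c d w ζ).n,
      (j : ℕ) = N.pos a → (σ j : ℕ) = N.pos a' := by
    intro a a' hv j hj
    exact N.perm_eq hv (j := Fin.cast (substArr_n c d w hz ζ) j) hj
  refine ⟨σ, ?_, hσ⟩
  let dv : arr d ζ ⟶ arr d ζ' := d.b.toFunctor.map v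
  have harr : ∀ j : Fin (arr d ζ).n, ∃ u : atInput d ζ j ⟶ atInput d ζ' (dv.perm j),
      HEq (y.toFunctor.map u) v := by
    intro j
    obtain ⟨b', hb⟩ := Nd.bifib.ex_tgt v (atInput d ζ j) (obj_at _ _ _)
    have h1 : (dv.perm j : ℕ) = Nd.pos b' :=
      perm_eq_of_isPullback (toSym d).isPullback hb (j := j) (pos_at _ _ _).symm
    obtain rfl : atInput d ζ' (dv.perm j) = b' := at_eq _ hb.tgt h1.symm
    obtain ⟨u, -, -, hu⟩ := hb
    exact ⟨u, hu⟩
  choose u hu using harr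
  let cu : ∀ j : Fin (arr d ζ).n, arr c (atInput d ζ j) ⟶
    arr c (atInput d ζ' (dv.perm j)) := fun j ↦ c.b.toFunctor.map (u j)
  refine Eq.trans (Opd.compArr_congr dv.eq (β' := fun j ↦
    (arr c (atInput d ζ' (dv.perm j))).act (cu j).perm) ?_ _ ?_)
    (Opd.compArr_act (arr d ζ') (fun j ↦ arr c (atInput d ζ' j)) _ dv.perm
      (fun j ↦ (cu j).perm) σ ?_ _)
  · intro j j' hj
    obtain rfl := Fin.ext hj
    exact (cu j).eq
  · exact fun _ ↦ tgt_arr' w (obj_at _ _ _) (pos_at _ _ _).symm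
  · intro j k
    obtain ⟨a, ha, hk⟩ := Nc.surj (atInput d ζ j) k k.2
    obtain ⟨a', haa⟩ := Nc.bifib.ex_tgt (u j) a ha
    have h1 := perm_eq_of_isPullback (toSym c).isPullback haa (j := k) hk.symm
    have h2 : Lift z.toFunctor v a a' := by
      rw [← hz]
      exact haa.trans (hu j) (obj_at _ _ _) (obj_at _ _ _)
    exact (hσ h2 _ (finSigma_pos c d hz ha hk.symm)).trans
      (finSigma_pos c d hz haa.tgt h1).symm

/-- The substitution of structures for `P_T`. -/
noncomputable def subst : T.poly.Cell z :=
  mk (symSubst (toSym c) (toSym d) hz) (substArr c d w) (substArr_n c d w hz)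
    (substArr_map c d w hz)

theorem toSym_subst : toSym (subst c d w hz) = symSubst (toSym c) (toSym d) hz := toSym_mk _ _ _ _

theorem arr_subst (ζ : Z) : arr (subst c d w hz) ζ = substArr c d w ζ := arr_mk _ _ _ _ _

theorem num_subst_pos (a : X) : (num (toSym (subst c d w hz))).pos a =
    ((num (toSym c)).comp (num (toSym d)) hz).pos a := by
  rw [toSym_subst]
  rfl

theorem subst_t : (subst c d w hz).b ≫ T.poly.t = d.b ≫ T.poly.t :=
  Cat.ext (discreteFunctor_ext fun ζ ↦ show (arr (subst c d w hz) ζ).tgt = (arr d ζ).tgt from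
    (congrArg Coll.Arrow.tgt (arr_subst c d w hz ζ)).trans rfl)

theorem subst_s : (subst c d w hz).e ≫ T.poly.s = c.e ≫ T.poly.s := by
  refine Cat.ext (discreteFunctor_ext fun a ↦ ?_)
  change (inp (subst c d w hz) a).base.src (inp (subst c d w hz) a).pt =
    (inp c a).base.src (inp c a).pt
  have hn := congrArg Coll.Arrow.n (arr_subst c d w hz (z.toFunctor.obj a))
  have hl : ((num (toSym c)).comp (num (toSym d)) hz).pos a <
      (substArr c d w (z.toFunctor.obj a)).n := by
    rw [← hn, ← num_subst_pos c d w hz]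
    exact (num (toSym (subst c d w hz))).lt a
  obtain ⟨j, k, h1, h2, h3⟩ := exists_input c d w hz _ ⟨_, hl⟩ rfl rfl
  have e : (inp (subst c d w hz) a).base.src (inp (subst c d w hz) a).pt =
      (substArr c d w (z.toFunctor.obj a)).src ⟨_, hl⟩ :=
    Coll.Arrow.src_congr ((inp_base _ a).trans (arr_subst c d w hz _))
      (num_subst_pos c d w hz a)
  rw [e, h3]
  refine Eq.trans ?_ (src_inp' c h1 h2).symm
  exact Opd.concat_finSigma (fun j ↦ (arr c (atInput d (z.toFunctor.obj a) j)).src) j k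

end

end CollCell

end OpdSubst

end PolyOpd

namespace PolyOpd

universe u

section OpdMonad

namespace CollCell

open Opd (compArr unitArr)

variable {T : Opd.{u}} {X Y Z W : Cat.{u, u}} {x : X ⟶ Y} {y : Y ⟶ Z} {z : X ⟶ Z}

theorem subst_congr {c c' : T.poly.Cell x} {d d' : T.poly.Cell y} (hc : c = c') (hd : d = d')
    (w : c.b ≫ T.poly.t = d.e ≫ T.poly.s) (w' : c'.b ≫ T.poly.t = d'.e ≫ T.poly.s)
    (hz : x ≫ y = z) : subst c d w hz = subst c' d' w' hz := by
  subst hc hd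
  rfl

theorem subst_base (c : T.poly.Cell x) (d : T.poly.Cell y) (w : c.b ≫ T.poly.t = d.e ≫ T.poly.s)
    (hz : x ≫ y = z) {X' Y' Z' : Cat.{u, u}} {x' : X' ⟶ Y'} {y' : Y' ⟶ Z'} {z' : X' ⟶ Z'}
    {k : X' ⟶ X} {l : Y' ⟶ Y} {m : Z' ⟶ Z} (sq₁ : IsPullback k x' x l)
    (sq₂ : IsPullback l y' y m) (sq : IsPullback k z' z m) (hz' : x' ≫ y' = z')
    (w' : (c.base sq₁).b ≫ T.poly.t = (d.base sq₂).e ≫ T.poly.s) :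
    (subst c d w hz).base sq = subst (c.base sq₁) (d.base sq₂) w' hz' := by
  apply CollCell.ext
  · intro a
    rw [num_subst_pos]
    refine (num_subst_pos c d w hz (k.toFunctor.obj a)).trans ?_
    have := symSubst_base (toSym c) (toSym d) hz sq₁ sq₂ sq hz'
    exact congrArg (fun s ↦ (num s).pos a) this
  · intro ζ
    rw [arr_subst]
    refine (arr_subst c d w hz (m.toFunctor.obj ζ)).trans ?_
    refine Opd.compArr_congr rfl ?_ _ _
    intro j j' hj
    obtain rfl := Fin.ext hj
    refine congrArg (arr c) ?_
    apply at_eq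
    · refine (CategoryTheory.Functor.congr_obj (congrArg Cat.Hom.toFunctor sq₂.w) _).trans ?_
      exact congrArg m.toFunctor.obj (obj_at (d.base sq₂) ζ j)
    · exact pos_at (d.base sq₂) ζ j

end CollCell

namespace Opd

open CollCell

variable (T : Opd.{u}) {X Y Z W : Cat.{u, u}} {x : X ⟶ Y} {y : Y ⟶ Z} {z : X ⟶ Z}

/-- The multiplication. -/
noncomputable def polyMul : Poly.comp T.poly T.poly ⟶ T.poly :=
  (subst (Poly.compCell₁ T.poly T.poly) (Poly.compCell₂ T.poly T.poly) (Poly.comp_condition _ _)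
    (Poly.compLeft_compRight _ _)).toHom (subst_s _ _ _ _) (subst_t _ _ _ _)

theorem map_polyMul (c : T.poly.Cell x) (d : T.poly.Cell y)
    (w : c.b ≫ T.poly.t = d.e ≫ T.poly.s) (hz : x ≫ y = z) :
    (c.comp d w hz).map T.polyMul = subst c d w hz := by
  obtain ⟨sq₁, sq₂, h1, h2⟩ := c.exists_base d w hz
  have w' : ((Poly.compCell₁ T.poly T.poly).base sq₁).b ≫ T.poly.t =
      ((Poly.compCell₂ T.poly T.poly).base sq₂).e ≫ T.poly.s :=
    (congrArg (fun k ↦ Poly.Cell.b k ≫ T.poly.t) h1.symm).trans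
      (w.trans (congrArg (fun k ↦ Poly.Cell.e k ≫ T.poly.s) h2))
  refine (Poly.Cell.map_toHom (c.comp d w hz) _ _ _).trans ?_
  refine (subst_base _ _ _ _ sq₁ sq₂ _ hz w').trans ?_
  exact subst_congr h1.symm h2.symm _ _ _

theorem exists_unitCell (f : X ⟶ T.colours) : ∃ c : T.poly.Cell (𝟙 X),
    toSym c = (Numbering.id X).cell ∧ ∀ β, arr c β = T.unitArr (f.toFunctor.obj β).as := by
  apply exists_cell
  · intro β
    rfl
  · intro β β' v
    refine ⟨Equiv.refl _, ?_, ?_⟩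
    · exact (congrArg T.unitArr (Discrete.eq_of_hom (f.toFunctor.map v))).trans
        (Coll.Arrow.act_refl _).symm
    · intro a a' _ j hj
      exact hj

/-- The structure for `P_T` given by identity arrows. -/
noncomputable def unitCell (f : X ⟶ T.colours) : T.poly.Cell (𝟙 X) := (T.exists_unitCell f).choose

theorem toSym_unitCell (f : X ⟶ T.colours) : toSym (T.unitCell f) = (Numbering.id X).cell :=
  (T.exists_unitCell f).choose_spec.1

theorem arr_unitCell (f : X ⟶ T.colours) (β : X) :
    arr (T.unitCell f) β = T.unitArr (f.toFunctor.obj β).as :=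
  (T.exists_unitCell f).choose_spec.2 β

theorem unitCell_s (f : X ⟶ T.colours) : (T.unitCell f).e ≫ T.poly.s = f := by
  refine Cat.ext (discreteFunctor_ext fun a ↦ ?_)
  have h := (inp_base (T.unitCell f) a).trans (T.arr_unitCell f a)
  refine (Coll.Arrow.src_congr h (j' := (0 : Fin 1)) ?_).trans rfl
  rw [inp_pt, toSym_unitCell]
  rfl

theorem unitCell_t (f : X ⟶ T.colours) : (T.unitCell f).b ≫ T.poly.t = f :=
  Cat.ext (discreteFunctor_ext fun a ↦ congrArg Coll.Arrow.tgt (T.arr_unitCell f a))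

/-- The unit. -/
noncomputable def polyUnit : Poly.idPoly T.colours ⟶ T.poly :=
  (T.unitCell (𝟙 T.colours)).toHom (T.unitCell_s _) (T.unitCell_t _)

theorem map_polyUnit (f : X ⟶ T.colours) :
    (Poly.unitCell f).map T.polyUnit = T.unitCell f := by
  refine (Poly.Cell.map_toHom (Poly.unitCell f) _ _ _).trans ?_
  apply CollCell.ext
  · intro a
    have h1 : (num (toSym (T.unitCell f))).pos a = 0 := by
      rw [toSym_unitCell]
      rfl
    have h2 : (num (toSym (T.unitCell (𝟙 T.colours)))).pos (f.toFunctor.obj a) = 0 := by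
      rw [toSym_unitCell]
      rfl
    exact h2.trans h1.symm
  · intro β
    exact (T.arr_unitCell _ _).trans (T.arr_unitCell f β).symm

theorem unit_subst (c : T.poly.Cell x) (w) :
    subst (T.unitCell (c.e ≫ T.poly.s)) c w (Category.id_comp x) = c := by
  apply CollCell.ext
  · intro a
    rw [num_subst_pos, toSym_unitCell]
    exact Numbering.id_comp_pos (num (toSym c)) a
  · intro β
    rw [arr_subst]
    apply Opd.compArr_unitArr
    intro j
    rw [arr_unitCell]
    exact congrArg T.unitArr (src_inp' c (obj_at c β j) (pos_at c β j).symm)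

theorem subst_unit (c : T.poly.Cell x) (w) :
    subst c (T.unitCell (c.b ≫ T.poly.t)) w (Category.comp_id x) = c := by
  apply CollCell.ext
  · intro a
    rw [num_subst_pos, toSym_unitCell]
    exact Numbering.comp_id_pos (num (toSym c)) a
  · intro β
    rw [arr_subst]
    refine Eq.trans (Opd.compArr_congr (T.arr_unitCell _ β) (β' := fun _ ↦ arr c β) ?_ _ ?_)
      (Opd.unitArr_compArr (arr c β) _ ?_)
    · intro j _ _
      exact congrArg (arr c) (obj_at (T.unitCell (c.b ≫ T.poly.t)) β j)
    all_goals exact fun _ ↦ rfl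

theorem subst_subst {w : Z ⟶ W} {yw : Y ⟶ W} {t : X ⟶ W} (c : T.poly.Cell x) (d : T.poly.Cell y)
    (e : T.poly.Cell w) (h : c.b ≫ T.poly.t = d.e ≫ T.poly.s)
    (h' : d.b ≫ T.poly.t = e.e ≫ T.poly.s) (hz : x ≫ y = z) (hyw : y ≫ w = yw)
    (ht : z ≫ w = t) (ht' : x ≫ yw = t) (h₁) (h₂) :
    subst (subst c d h hz) e h₁ ht = subst c (subst d e h' hyw) h₂ ht' := by
  apply CollCell.ext
  · intro a
    rw [num_subst_pos, num_subst_pos, toSym_subst, toSym_subst]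
    exact Numbering.comp_assoc_pos (num (toSym c)) (num (toSym d)) (num (toSym e)) hz hyw ht ht' a
  · intro ω
    rw [arr_subst, arr_subst]
    have tg : ∀ j k, (arr c (atInput d (atInput e ω j) k)).tgt =
        (arr d (atInput e ω j)).src k := fun j k ↦
      tgt_arr' h (obj_at _ _ _) (pos_at _ _ _).symm
    refine Eq.trans (Opd.compArr_congr rfl (β' := fun j ↦ compArr (arr d (atInput e ω j))
      (fun k ↦ arr c (atInput d (atInput e ω j) k)) (tg j)) ?_ _ ?_)
      ((Opd.compArr_compArr (arr e ω) (fun j ↦ arr d (atInput e ω j)) ?_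
        (fun j k ↦ arr c (atInput d (atInput e ω j) k)) tg).trans
        (Opd.compArr_congr (arr_subst d e h' hyw ω).symm ?_ _ _))
    · intro j j' hj
      obtain rfl := Fin.ext hj
      exact arr_subst c d h hz _
    · exact fun j ↦ tgt_arr' h' (obj_at _ _ _) (pos_at _ _ _).symm
    · exact fun j ↦ tgt_arr' h' (obj_at _ _ _) (pos_at _ _ _).symm
    · intro l l' hl
      refine congrArg (arr c) (at_eq _ ?_ ?_).symm
      · rw [← hyw]
        exact (congrArg w.toFunctor.obj (obj_at d _ _)).trans (obj_at e _ _)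
      · rw [num_subst_pos, ← hl]
        refine (finSigma_pos d e hyw (j := (finSigmaFinEquiv.symm l).1)
          (k := (finSigmaFinEquiv.symm l).2) (obj_at d _ _) (pos_at d _ _).symm).symm.trans ?_
        exact congrArg Fin.val (Equiv.apply_symm_apply finSigmaFinEquiv l)

/-- The polynomial monad of an operad. -/
noncomputable def mnd : PolyMnd Cat.{u, u} where
  I := ⟨T.colours⟩
  P := T.poly
  mon := PolyMnd.monOfCell T.poly T.polyUnit T.polyMul
    (fun c ↦ (T.map_polyMul _ _ _ _).trans
      ((subst_congr (T.map_polyUnit _) rfl _ (T.unitCell_t _) _).trans (T.unit_subst c _)))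
    (fun c ↦ (T.map_polyMul _ _ _ _).trans
      ((subst_congr rfl (T.map_polyUnit _) _ (T.unitCell_s _).symm _).trans (T.subst_unit c _)))
    (fun c d e w w' ↦ (T.map_polyMul _ _ _ _).trans
      ((subst_congr (T.map_polyMul _ _ _ _) rfl _ ((subst_t _ _ _ _).trans w') _).trans
        ((T.subst_subst c d e w w' rfl rfl rfl (Category.assoc _ _ _).symm _
          (w.trans (subst_s _ _ _ _).symm)).trans
          ((subst_congr rfl (T.map_polyMul _ _ _ _).symm _ _ _).trans
            (T.map_polyMul _ _ _ _).symm))))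

end Opd

end OpdMonad

end PolyOpd

namespace PolyOpd

universe u

section Nerve

namespace Opd

open CollCell

variable {S T : Opd.{u}}

/-- The morphism of polynomial endomorphisms with components `e_T` and `b_T`. -/
noncomputable def endToSym (T : Opd.{u}) : PolyEnd.Hom T.mnd.toEnd SymMnd.{u}.toEnd where
  f := toOne _
  φ := Poly.Hom.mk T.arity.toCatHom (Pointed.star T.arity).toCatHom (toOne_ext _ _) (toOne_ext _ _)
    (Pointed.isPullback T.arity)

/-- The morphism of polynomial monads `(e_T, b_T)`. -/
noncomputable def toSymMnd (T : Opd.{u}) : T.mnd ⟶ SymMnd.{u} :=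
  PolyMnd.Hom.ofApp T.endToSym
    (fun x ↦ (congrArg toSym (T.map_polyUnit x)).trans
      ((T.toSym_unitCell x).trans (map_symUnit _).symm))
    (fun c d w hz ↦ (congrArg toSym (T.map_polyMul c d w hz)).trans
      ((toSym_subst c d w hz).trans (map_symMul _ _ _ _).symm))

/-- The action of a morphism of operads on arrows. -/
@[simps n src tgt]
def Mor.arrow (F : S ⟶ T) (α : S.Arrow) : T.Arrow := ⟨α.n, F.f ∘ α.src, F.f α.tgt, F.map α.hom⟩

theorem Mor.arrow_act (F : S ⟶ T) (α : S.Arrow) {m : ℕ} (σ : Fin m ≃ Fin α.n) :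
    Mor.arrow F (α.act σ) = (Mor.arrow F α).act σ := by
  obtain ⟨n, s, i, α⟩ := α
  obtain rfl : m = n := Fin.equiv_iff_eq.1 ⟨σ⟩
  change Coll.Arrow.mk _ _ _ (F.map (S.act α σ)) = Coll.Arrow.mk _ _ _ (T.act (F.map α) σ)
  rw [F.map_act]
  rfl

theorem Mor.arrow_unitArr (F : S ⟶ T) (i : S.I) :
    Mor.arrow F (S.unitArr i) = T.unitArr (F.f i) := by
  change Coll.Arrow.mk _ _ _ (F.map (S.unit i)) = Coll.Arrow.mk _ _ _ _
  rw [F.map_unit]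
  rfl

theorem Mor.arrow_compArr (F : S ⟶ T) (α : S.Arrow) (β : Fin α.n → S.Arrow)
    (h : ∀ j, (β j).tgt = α.src j)
    (h' : ∀ j, (Mor.arrow F (β j)).tgt = (Mor.arrow F α).src j) :
    Mor.arrow F (compArr α β h) =
      compArr (Mor.arrow F α) (fun j ↦ Mor.arrow F (β j)) h' := by
  have key : ∀ {n : ℕ} {s : Fin n → S.I} {i : S.I} (α : S.Hom s i) {m : Fin n → ℕ}
      {t : ∀ j, Fin (m j) → S.I} {s' : Fin n → S.I} (hs : ∀ j, s' j = s j)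
      (hs' : ∀ j, F.f (s' j) = F.f (s j)) (β : ∀ j, S.Hom (t j) (s' j)),
      Coll.Arrow.mk (T := T.toColl) _ _ _
          (F.map (S.comp α fun j ↦ (hs j ▸ β j : S.Hom (t j) (s j)))) =
        ⟨_, _, _, T.comp (F.map α) fun j ↦
          (hs' j ▸ F.map (β j) : T.Hom (F.f ∘ t j) (F.f (s j)))⟩ := by
    intro n s i α m t s' hs hs' β
    obtain rfl : s' = s := funext hs
    rw [F.map_comp]
    rfl
  exact key α.hom h h' fun j ↦ (β j).hom

/-- The functor `B_S ⟶ B_T`. -/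
@[simps]
def Mor.arrowFunctor (F : S ⟶ T) : S.Arrow ⥤ T.Arrow where
  obj α := Mor.arrow F α
  map {α β} f := ⟨f.perm, (congrArg (Mor.arrow F) f.eq).trans (Mor.arrow_act F β f.perm)⟩

/-- The functor `E_S ⟶ E_T`. -/
@[simps]
def Mor.inputFunctor (F : S ⟶ T) : S.Input ⥤ T.Input where
  obj a := ⟨Mor.arrow F a.base, a.pt⟩
  map f := ⟨(Mor.arrowFunctor F).map f.val, f.map_pt⟩

/-- The functor on colours. -/
def Mor.colours (F : S ⟶ T) : S.colours ⟶ T.colours :=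
  (Discrete.functor fun i ↦ Discrete.mk (F.f i)).toCatHom

theorem Mor.isPullback (F : S ⟶ T) : IsPullback (Mor.inputFunctor F).toCatHom
    (Pointed.proj S.arity).toCatHom (Pointed.proj T.arity).toCatHom
    (Mor.arrowFunctor F).toCatHom :=
  IsPullback.of_right (h₁₂ := (Pointed.star T.arity).toCatHom) (h₂₂ := T.arity.toCatHom)
    (Pointed.isPullback S.arity) rfl (Pointed.isPullback T.arity)

/-- The morphism of polynomial endomorphisms given by a morphism of operads. -/
noncomputable def Mor.endMap (F : S ⟶ T) : PolyEnd.Hom S.mnd.toEnd T.mnd.toEnd where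
  f := Mor.colours F
  φ := Poly.Hom.mk (Mor.arrowFunctor F).toCatHom (Mor.inputFunctor F).toCatHom
    (Cat.ext (discreteFunctor_ext fun _ ↦ rfl)) (Cat.ext (discreteFunctor_ext fun _ ↦ rfl))
    (Mor.isPullback F)

theorem Mor.toSym_app (F : S ⟶ T) {X Y : Cat.{u, u}} {x : X ⟶ Y} (c : S.poly.Cell x) :
    toSym (T := T.toColl) ((Mor.endMap F).app c) = toSym c := rfl

theorem Mor.app_unitCell (F : S ⟶ T) {X : Cat.{u, u}} (x : X ⟶ S.colours) :
    (Mor.endMap F).app (S.unitCell x) = T.unitCell (x ≫ Mor.colours F) := by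
  apply CollCell.ext (T := T.toColl)
  · intro a
    rw [Mor.toSym_app, toSym_unitCell, toSym_unitCell]
  · intro β
    refine Eq.trans ?_ (T.arr_unitCell (x ≫ Mor.colours F) β).symm
    exact (congrArg (Mor.arrow F) (S.arr_unitCell x β)).trans (Mor.arrow_unitArr F _)

theorem Mor.app_subst (F : S ⟶ T) {X Y Z : Cat.{u, u}} {x : X ⟶ Y} {y : Y ⟶ Z} {z : X ⟶ Z}
    (c : S.poly.Cell x) (d : S.poly.Cell y) (w : c.b ≫ S.poly.t = d.e ≫ S.poly.s)
    (hz : x ≫ y = z) (w') :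
    (Mor.endMap F).app (subst c d w hz) =
      subst (T := T) ((Mor.endMap F).app c) ((Mor.endMap F).app d) w' hz := by
  apply CollCell.ext (T := T.toColl)
  · intro a
    exact (num_subst_pos c d w hz a).trans
      (num_subst_pos (T := T) ((Mor.endMap F).app c) ((Mor.endMap F).app d) w' hz a).symm
  · intro ζ
    refine Eq.trans ?_ (arr_subst (T := T) ((Mor.endMap F).app c) ((Mor.endMap F).app d) w' hz
      ζ).symm
    refine (congrArg (Mor.arrow F) (arr_subst c d w hz ζ)).trans ?_
    refine (Mor.arrow_compArr F _ _ _ ?_).trans (Opd.compArr_congr rfl ?_ _ _)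
    · intro j
      exact congrArg F.f (tgt_arr' w (obj_at _ _ _) (pos_at _ _ _).symm)
    · intro j j' hj
      obtain rfl := Fin.ext hj
      rfl

/-- The morphism of polynomial monads given by a morphism of operads. -/
noncomputable def Mor.mndMap (F : S ⟶ T) : S.mnd ⟶ T.mnd :=
  PolyMnd.Hom.ofApp (Mor.endMap F)
    (fun x ↦ (congrArg _ (S.map_polyUnit x)).trans
      ((Mor.app_unitCell F x).trans (T.map_polyUnit _).symm))
    (fun c d w hz ↦ (congrArg _ (S.map_polyMul c d w hz)).trans
      ((Mor.app_subst F c d w hz _).trans (T.map_polyMul _ _ _ _).symm))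

end Opd

/-- The functor from operads to polynomial monads in `Cat` over the polynomial monad `S`. -/
noncomputable def Nbar : Opd.{u} ⥤ Over SymMnd.{u} where
  obj T := Over.mk T.toSymMnd
  map F := Over.homMk (Opd.Mor.mndMap F)
    (PolyMnd.hom_ext_toHom (PolyEnd.Hom.ext_app (toOne_ext _ _) rfl))
  map_id T := by
    apply Over.OverMorphism.ext
    refine PolyMnd.hom_ext_toHom (PolyEnd.Hom.ext_app ?_ ?_)
    · exact Cat.ext (discreteFunctor_ext fun _ ↦ rfl)
    · rfl
  map_comp F G := by
    apply Over.OverMorphism.ext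
    refine PolyMnd.hom_ext_toHom (PolyEnd.Hom.ext_app ?_ ?_)
    · exact Cat.ext (discreteFunctor_ext fun _ ↦ rfl)
    · rfl

end Nerve

end PolyOpd

namespace PolyOpd

universe u

section Operadic

/-- Discrete fibrations: every arrow `u : a ⟶ b x` has a unique lift, strictly over `u`, to an
arrow with codomain `x`. -/
def IsDiscreteFibration {A B : Type u} [Category.{u} A] [Category.{u} B] (b : B ⥤ A) : Prop :=
  ∀ (x : B) {a : A} (u : a ⟶ b.obj x),
    ∃! v : Σ y : B, (y ⟶ x), ∃ h : b.obj v.1 = a, b.map v.2 = eqToHom h ≫ u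

/-- The component `b : B ⥤ ℙ` of a morphism of polynomial monads into `S`. -/
noncomputable def overB (X : Over SymMnd.{u}) : X.left.toEnd.P.B ⥤ PermCat.{u} :=
  (PolyMnd.Hom.toHom X.hom).φ.f₁.toFunctor

/-- The morphisms `(e, b)` of polynomial monads into `S` with a discrete category of colours for
which `b` is a discrete fibration. -/
def operadic : ObjectProperty (Over SymMnd.{u}) := fun X ↦
  IsDiscrete X.left.toEnd.I ∧ IsDiscreteFibration (overB X)

end Operadic

end PolyOpd

universe u

/-! The proof works with structures (`Cell`): a structure for a polynomial `P` on a functor `x` is a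
pullback square from `x` to the middle functor of `P`. Since structures for a composite polynomial
are exactly pastings of structures, a monad on `P` can be used through two operations. `mulCell`
sends structures on composable functors `x` and `y`, with matching colours in between, to a
structure on `x ≫ y`; `oneCell` produces structures on identities. Both are stable under restriction
along pullback squares, and they are unital and associative. A morphism of polynomial endomorphisms
is a morphism of monads as soon as it preserves them (`Hom.ofApp`). For `S`, a structure on `x` is a
numbering of the fibres of `x`, and the product is the lexicographic numbering. For the polynomial
of a collection `T`, a structure is such a numbering together with a compatible family of arrows of
`T` indexed by the base (`CollCell.ext`).

Stability under restriction is what makes the operations computable: they are determined by their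
values over single objects of the base. Over one object, a structure is one arrow `α`; its domain is
the discrete category of inputs of `α`, and a composable structure on top is a family of arrows `β
j` ending in the sources of `α`. Hence a multiplication of structures is the same thing as a
composition `α ∘ (β j)` (`CellMonad.arr_mul`). The unit and associativity laws of an operad are
those of the monad, read over one object. Equivariance corresponds to no law of the monad. It is the
functoriality of the base component of a product of structures, evaluated over an indiscrete
category of twists `(ρ, τ)` of a given pair `(α, β)` (`CellMonad.compArr_act`).

Full faithfulness: a morphism over `S` between the monads of two operads preserves arities and the
numbers of inputs, so it sends arrows to arrows with the expected sources and targets. It respects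
permutations because it is a functor on arrows, and identities and composites because it preserves
the operations on structures over one object (`IsOverSym.toMor`).

The monad of an operad is in the subcategory because a morphism `γ ⟶ α` with underlying permutation
`ρ` exists only if `γ` is `αρ`, so that lifts exist and are unique.

Essential surjectivity: let `I` be discrete and `b` a discrete fibration. The objects of `B` are
taken as arrows; the pullback square numbers the inputs, `s` and `t` give sources and targets, and
unique lifting of permutations gives the action (`OverSym.coll`). The category of arrows of this
collection is isomorphic to `B`, and the whole polynomial endomorphism is isomorphic to that of the
collection (`OverSym.isIso_toColl`). Transporting the monad along this isomorphism gives operations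
on the structures of a collection lying over those of `S` (`CellMonad`), hence an operad, whose
polynomial monad has the transported operations and is therefore isomorphic over `S` to the given
one. -/

namespace PolyOpd

universe v

/-! ### Polynomial monads as operations on structures -/

section PolyMndCells

variable {C : Type u} [Category.{v} C] [HasPullbacks C]

namespace Poly

variable {I J : C} {P : Poly I J}

/-- A structure whose base component factors through that of another one is a restriction. -/
theorem Cell.exists_base_eq {X Y X' Y' : C} {y : X ⟶ Y} {y' : X' ⟶ Y'} (c : P.Cell y)
    (c' : P.Cell y') (m : Y' ⟶ Y) (h : c'.b = m ≫ c.b) :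
    ∃ (k : X' ⟶ X) (sq : IsPullback k y' y m), c' = c.base sq := by
  obtain ⟨k, h1, h2⟩ := c.isPullback.exists_lift c'.e (y' ≫ m) (by
    rw [c'.isPullback.w, h, Category.assoc])
  have sq : IsPullback k y' y m := by
    refine IsPullback.of_right ?_ h2 c.isPullback
    rw [h1, ← h]
    exact c'.isPullback
  refine ⟨k, sq, ?_⟩
  ext
  · exact h1.symm
  · exact h

end Poly

namespace PolyMnd

variable (M : PolyMnd C) {X Y Z W : C} {x : X ⟶ Y} {y : Y ⟶ Z} {z : X ⟶ Z}

theorem mulCell_congr {c c' d d'} (hc : c = c') (hd : d = d')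
    (h : c.b ≫ M.toEnd.P.t = d.e ≫ M.toEnd.P.s) (h' : c'.b ≫ M.toEnd.P.t = d'.e ≫ M.toEnd.P.s)
    (hz : x ≫ y = z) : M.mulCell c d h hz = M.mulCell c' d' h' hz := by
  subst hc hd
  rfl

/-- Pasting is stable under restriction, and the multiplication acts by postcomposition. This is the
property that allows products to be computed over single objects of the base. -/
theorem mulCell_base (c : M.toEnd.P.Cell x) (d : M.toEnd.P.Cell y)
    (h : c.b ≫ M.toEnd.P.t = d.e ≫ M.toEnd.P.s)
    (hz : x ≫ y = z) {X' Y' Z' : C} {x' : X' ⟶ Y'} {y' : Y' ⟶ Z'} {z' : X' ⟶ Z'}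
    {k : X' ⟶ X} {l : Y' ⟶ Y} {m : Z' ⟶ Z} (sq₁ : IsPullback k x' x l)
    (sq₂ : IsPullback l y' y m) (sq : IsPullback k z' z m) (hz' : x' ≫ y' = z')
    (h' : (c.base sq₁).b ≫ M.toEnd.P.t = (d.base sq₂).e ≫ M.toEnd.P.s) :
    (M.mulCell c d h hz).base sq = M.mulCell (c.base sq₁) (d.base sq₂) h' hz' := by
  rw [mulCell, ← Poly.Cell.base_map, Poly.Cell.comp_base c d h hz sq₁ sq₂ sq hz']
  rfl

theorem oneCell_s (f : X ⟶ M.I.obj) : (M.oneCell f).e ≫ M.toEnd.P.s = f := by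
  simp [oneCell, M.one.w_s]

theorem oneCell_t (f : X ⟶ M.I.obj) : (M.oneCell f).b ≫ M.toEnd.P.t = f := by
  simp [oneCell, M.one.w_t]

/-- The unit law of the monad is an equality of 2-cells; it is evaluated at the pasting of `c` with
the trivial structure on an identity. The left unitor sends that pasting back to `c`. The other unit
law and associativity are obtained from the monad axioms in the same way. -/
theorem one_mulCell (c : M.toEnd.P.Cell x) (h) :
    M.mulCell (M.oneCell (c.e ≫ M.toEnd.P.s)) c h (Category.id_comp x) = c := by
  have h1 : Poly.hcomp M.one (𝟙 M.toEnd.P) ≫ M.mul = Poly.leftUnitorHom M.toEnd.P :=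
    M.mon.one_mul
  have h2 := congrArg (fun k ↦ ((Poly.unitCell (c.e ≫ M.toEnd.P.s)).comp c (by simp)
    (Category.id_comp x)).map k) h1
  dsimp only at h2
  rw [Poly.Cell.map_comp, Poly.Cell.map_hcomp, Poly.Cell.map_leftUnitorHom] at h2
  simp only [Poly.Cell.map_id] at h2
  refine h2.trans ?_
  ext <;> simp

theorem mulCell_one (c : M.toEnd.P.Cell x) (h) :
    M.mulCell c (M.oneCell (c.b ≫ M.toEnd.P.t)) h (Category.comp_id x) = c := by
  have h1 : Poly.hcomp (𝟙 M.toEnd.P) M.one ≫ M.mul = Poly.rightUnitorHom M.toEnd.P :=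
    M.mon.mul_one
  have h2 := congrArg (fun k ↦ (c.comp (Poly.unitCell (c.b ≫ M.toEnd.P.t)) (by simp)
    (Category.comp_id x)).map k) h1
  dsimp only at h2
  rw [Poly.Cell.map_comp, Poly.Cell.map_hcomp, Poly.Cell.map_rightUnitorHom] at h2
  simp only [Poly.Cell.map_id] at h2
  refine h2.trans ?_
  ext <;> simp

/-- The associativity axiom evaluated at a triple pasting, which the associator merely brackets
differently. The composites `z`, `yw`, `t` are variables with equations, so that no transport along
associativity of functors appears. -/
theorem mulCell_mulCell {w : Z ⟶ W} {yw : Y ⟶ W} {t : X ⟶ W} (c : M.toEnd.P.Cell x)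
    (d : M.toEnd.P.Cell y) (e : M.toEnd.P.Cell w) (h : c.b ≫ M.toEnd.P.t = d.e ≫ M.toEnd.P.s)
    (h' : d.b ≫ M.toEnd.P.t = e.e ≫ M.toEnd.P.s) (hz : x ≫ y = z) (hyw : y ≫ w = yw)
    (ht : z ≫ w = t) (ht' : x ≫ yw = t) (h₁) (h₂) :
    M.mulCell (M.mulCell c d h hz) e h₁ ht = M.mulCell c (M.mulCell d e h' hyw) h₂ ht' := by
  have h1 : Poly.hcomp M.mul (𝟙 M.toEnd.P) ≫ M.mul =
      Poly.assocHom M.toEnd.P M.toEnd.P M.toEnd.P ≫ Poly.hcomp (𝟙 M.toEnd.P) M.mul ≫ M.mul :=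
    M.mon.mul_assoc
  have h2 := congrArg (fun k ↦ ((c.comp d h hz).comp e (by rw [Poly.Cell.comp_t, h'])
    ht).map k) h1
  dsimp only at h2
  rw [Poly.Cell.map_comp, Poly.Cell.map_comp, Poly.Cell.map_comp, Poly.Cell.map_hcomp,
    Poly.Cell.map_assocHom _ _ _ _ _ _ _ hyw, Poly.Cell.map_hcomp] at h2
  simp only [Poly.Cell.map_id] at h2
  exact h2

end PolyMnd

/-- The inverse of a morphism of polynomial endomorphisms with invertible components. -/
theorem PolyEnd.isIso_of_components {X Y : PolyEnd C} (F : X ⟶ Y) [IsIso F.f] [IsIso F.φ.f₁]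
    [IsIso F.φ.f₂] : IsIso F := by
  refine ⟨⟨inv F.f, Poly.Hom.mk (inv F.φ.f₁) (inv F.φ.f₂) ?_ ?_ ?_⟩, ?_, ?_⟩
  · have h : F.φ.f₂ ≫ Y.P.s = X.P.s ≫ F.f := F.φ.w_s
    change inv F.φ.f₂ ≫ X.P.s = Y.P.s ≫ inv F.f
    rw [IsIso.inv_comp_eq, reassoc_of% h, IsIso.hom_inv_id, Category.comp_id]
  · have h : F.φ.f₁ ≫ Y.P.t = X.P.t ≫ F.f := F.φ.w_t
    change inv F.φ.f₁ ≫ X.P.t = Y.P.t ≫ inv F.f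
    rw [IsIso.inv_comp_eq, reassoc_of% h, IsIso.hom_inv_id, Category.comp_id]
  · have h : F.φ.f₂ ≫ Y.P.p = X.P.p ≫ F.φ.f₁ := F.φ.isPullback.w
    refine IsPullback.of_horiz_isIso ⟨?_⟩
    change inv F.φ.f₂ ≫ X.P.p = Y.P.p ≫ inv F.φ.f₁
    rw [IsIso.inv_comp_eq, reassoc_of% h, IsIso.hom_inv_id, Category.comp_id]
  · refine PolyEnd.Hom.ext_app (IsIso.hom_inv_id F.f) ?_
    ext
    · exact congrArg (_ ≫ ·) (IsIso.hom_inv_id F.φ.f₂)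
    · exact congrArg (_ ≫ ·) (IsIso.hom_inv_id F.φ.f₁)
  · refine PolyEnd.Hom.ext_app (IsIso.inv_hom_id F.f) ?_
    ext
    · exact congrArg (_ ≫ ·) (IsIso.inv_hom_id F.φ.f₂)
    · exact congrArg (_ ≫ ·) (IsIso.inv_hom_id F.φ.f₁)

/-- Isomorphisms of polynomial monads from isomorphisms of polynomial endomorphisms. -/
def PolyMnd.isoOfApp {M N : PolyMnd C} (e : M.toEnd ≅ N.toEnd)
    (h₁ : ∀ {X : C} (x : X ⟶ M.I.obj), e.hom.app (M.oneCell x) = N.oneCell (x ≫ e.hom.f))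
    (h₂ : ∀ {X Y Z : C} {x : X ⟶ Y} {y : Y ⟶ Z} {z : X ⟶ Z}
      (c : M.toEnd.P.Cell x) (d : M.toEnd.P.Cell y)
      (h : c.b ≫ M.toEnd.P.t = d.e ≫ M.toEnd.P.s) (hz : x ≫ y = z),
      e.hom.app (M.mulCell c d h hz) =
        N.mulCell (e.hom.app c) (e.hom.app d) (by rw [e.hom.app_s, e.hom.app_t, reassoc_of% h]) hz) :
    M ≅ N where
  hom := Hom.ofApp e.hom h₁ h₂
  inv := Hom.ofApp e.inv
    (fun x ↦ by
      -- The inverse preserves units because `e.hom` does: a unit of `N` is the image under `e.hom`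
      -- of the unit of `M` at `x ≫ e.inv.f`. Products are treated likewise in the next field.
      have hf : e.inv.f ≫ e.hom.f = 𝟙 _ := congrArg PolyEnd.Hom.f e.inv_hom_id
      have := h₁ (x ≫ e.inv.f)
      rw [Category.assoc, hf, Category.comp_id] at this
      rw [← this, ← PolyEnd.comp_app, e.hom_inv_id, PolyEnd.id_app])
    (fun c d h hz ↦ by
      have h' := h₂ (e.inv.app c) (e.inv.app d) (by rw [e.inv.app_s, e.inv.app_t, reassoc_of% h]) hz
      simp only [← PolyEnd.comp_app, e.inv_hom_id, PolyEnd.id_app] at h'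
      rw [← h', ← PolyEnd.comp_app, e.hom_inv_id, PolyEnd.id_app])
  hom_inv_id := hom_ext_toHom e.hom_inv_id
  inv_hom_id := hom_ext_toHom e.inv_hom_id

end PolyMndCells

end PolyOpd

/-! ### Discrete categories, and structures given by families of arrows -/

namespace PolyOpd

section DiscreteCategories

theorem functor_ext_of_isDiscrete {Z D : Type u} [Category.{u} Z] [Category.{u} D] [IsDiscrete Z]
    {F G : Z ⥤ D} (h : ∀ z, F.obj z = G.obj z) : F = G := by
  refine CategoryTheory.Functor.hext h fun z z' v ↦ ?_
  obtain rfl := obj_ext_of_isDiscrete v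
  obtain rfl : v = 𝟙 z := Subsingleton.elim _ _
  rw [F.map_id, G.map_id]
  exact heq_id (h z)

/-- The functor on a discrete category given by a family of objects. -/
def functorOfIsDiscrete {Z D : Type u} [Category.{u} Z] [Category.{u} D] [IsDiscrete Z]
    (A : Z → D) : Z ⥤ D where
  obj := A
  map v := eqToHom (congrArg A (obj_ext_of_isDiscrete v))

/-- Over one object, the inputs of an arrow again form a discrete category, so a functor on them is
just a family of objects. Iterating this handles the inputs of the inner arrows, as associativity
requires. -/
instance {Y : Type u} [Category.{u} Y] [IsDiscrete Y] (b : Y ⥤ PermCat.{u}) :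
    IsDiscrete (Pointed b) where
  subsingleton _ _ := ⟨fun _ _ ↦ Pointed.hom_ext (Subsingleton.elim _ _)⟩
  eq_of_hom {a a'} f := by
    obtain ⟨a, j⟩ := a
    obtain ⟨a', j'⟩ := a'
    obtain ⟨v, hv⟩ := f
    dsimp only at v hv
    obtain rfl := obj_ext_of_isDiscrete v
    obtain rfl : v = 𝟙 a := Subsingleton.elim _ _
    rw [b.map_id] at hv
    exact congrArg (Pointed.mk a) hv

/-- The functor on the discrete category with one object given by an object. -/
abbrev pointAt {Z : Cat.{u, u}} (ζ : Z) : oneCat.{u} ⟶ Z :=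
  (functorOfIsDiscrete (Z := Discrete PUnit.{u + 1}) fun _ ↦ ζ).toCatHom

/-- The object of the category with one object. -/
abbrev pt : oneCat.{u} := Discrete.mk PUnit.unit

end DiscreteCategories

namespace Coll

variable {T : Coll.{u}}

/-- Equations are proved between arrows with bundled source and target, where no transport is
needed; this brings them back to a fixed source and target. -/
theorem Arrow.mk_injective {n : ℕ} {s : Fin n → T.I} {i : T.I} {α β : T.Hom s i}
    (h : Arrow.mk (T := T) n s i α = ⟨n, s, i, β⟩) : α = β := by
  cases h
  rfl

/-- Sources are compared through the values of the indices, as the two index types agree only after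
rewriting by `hn`. -/
theorem Arrow.exists_hom (α : T.Arrow) {n : ℕ} {s : Fin n → T.I} {i : T.I} (hn : α.n = n)
    (hs : ∀ (j : Fin α.n) (j' : Fin n), (j : ℕ) = j' → α.src j = s j') (hi : α.tgt = i) :
    ∃ γ : T.Hom s i, Arrow.mk n s i γ = α := by
  obtain ⟨n, s, i, γ⟩ := α
  dsimp only at hn hi
  subst hn hi
  obtain rfl := funext fun j ↦ hs j j rfl
  exact ⟨γ, rfl⟩

/-- The arrow with prescribed source and target underlying `α`. -/
noncomputable def Arrow.homOf (α : T.Arrow) {n : ℕ} {s : Fin n → T.I} {i : T.I} (hn : α.n = n)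
    (hs : ∀ (j : Fin α.n) (j' : Fin n), (j : ℕ) = j' → α.src j = s j') (hi : α.tgt = i) :
    T.Hom s i :=
  (α.exists_hom hn hs hi).choose

theorem Arrow.mk_homOf (α : T.Arrow) {n : ℕ} {s : Fin n → T.I} {i : T.I} (hn : α.n = n)
    (hs : ∀ (j : Fin α.n) (j' : Fin n), (j : ℕ) = j' → α.src j = s j') (hi : α.tgt = i) :
    Arrow.mk n s i (α.homOf hn hs hi) = α :=
  (α.exists_hom hn hs hi).choose_spec

/-- The morphism from `ασ` to `α`. -/
def Arrow.actHom (α : T.Arrow) {m : ℕ} (σ : Fin m ≃ Fin α.n) : α.act σ ⟶ α := ⟨σ, rfl⟩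

/-- Morphisms of arrows are invertible. -/
def Arrow.isoOfHom {α β : T.Arrow} (f : α ⟶ β) : α ≅ β where
  hom := f
  inv := ⟨f.perm.symm, by
    -- Substituting `α = βρ`, the arrow `αρ⁻¹` becomes `βρρ⁻¹ = β`.
    rw [Arrow.act_congr f.eq (τ := f.perm.symm) rfl, Arrow.act_act, Equiv.symm_trans_self,
      Arrow.act_refl]
    intro j j' h
    rw [Fin.ext h]
    rfl⟩
  hom_inv_id := Arrow.Hom.ext f.perm.self_trans_symm
  inv_hom_id := Arrow.Hom.ext f.perm.symm_trans_self

section CellOf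

variable {Z : Type u} [Category.{u} Z]

/-- The functor `(z, j) ↦ (D z, j)`. -/
def inputOf (D : Z ⥤ T.Arrow) : Pointed (D ⋙ T.arity) ⥤ T.Input where
  obj a := ⟨D.obj a.base, a.pt⟩
  map f := ⟨D.map f.val, f.map_pt⟩

/-- The structure with base component `D` whose domain is the category of pairs `(z, j)`. -/
def cellOf (D : Z ⥤ T.Arrow) : T.poly.Cell (X := Cat.of (Pointed (D ⋙ T.arity))) (Y := Cat.of Z)
    (Pointed.proj (D ⋙ T.arity)).toCatHom where
  e := (inputOf D).toCatHom
  b := D.toCatHom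
  -- The right-hand square and the outer rectangle are both pullbacks of `ℙ_* ⟶ ℙ` of the standard
  -- form, so the left-hand square is a pullback.
  isPullback := IsPullback.of_right (h₁₂ := (Pointed.star T.arity).toCatHom)
    (h₂₂ := T.arity.toCatHom) (Pointed.isPullback (D ⋙ T.arity)) rfl (Pointed.isPullback T.arity)

/-- The colours form a discrete category, so composability of the two structures need only be
checked on objects, where it is composability of arrows. -/
theorem cellOf_condition (D : Z ⥤ T.Arrow) (C : Pointed (D ⋙ T.arity) ⥤ T.Arrow)
    (h : ∀ a, (C.obj a).tgt = (D.obj a.base).src a.pt) :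
    (cellOf C).b ≫ T.poly.t = (cellOf D).e ≫ T.poly.s :=
  Cat.ext (discreteFunctor_ext h)

end CellOf

end Coll

namespace CollCell

open Coll (cellOf)

variable {T : Coll.{u}}

theorem atInput_cellOf {Z : Type u} [Category.{u} Z] (D : Z ⥤ T.Arrow) (ζ : Z)
    (j : Fin (D.obj ζ).n) : atInput (cellOf D) ζ j = ⟨ζ, j⟩ :=
  Numbering.fib_eq _ _ rfl rfl

variable {X Y Z : Cat.{u, u}} {x : X ⟶ Y} {y : Y ⟶ Z}

theorem obj_atInput (d : T.poly.Cell y) (ζ : Z) (j : Fin (arr d ζ).n) :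
    y.toFunctor.obj (atInput d ζ j) = ζ := Numbering.obj_fib _ _ _ _

theorem pos_atInput (d : T.poly.Cell y) (ζ : Z) (j : Fin (arr d ζ).n) :
    (num (toSym d)).pos (atInput d ζ j) = j := Numbering.pos_fib _ _ _ _

theorem atInput_eq (d : T.poly.Cell y) {ζ : Z} {j : Fin (arr d ζ).n} {b : Y}
    (h : y.toFunctor.obj b = ζ) (h' : (num (toSym d)).pos b = j) : atInput d ζ j = b :=
  Numbering.fib_eq _ _ h h'

/-- The matching condition on structures, read at the `j`-th input over `ζ`, says that the arrows of
`c` there can be composed with the arrow of `d` over `ζ`. -/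
theorem tgt_arr_eq {c : T.poly.Cell x} {d : T.poly.Cell y}
    (w : c.b ≫ T.poly.t = d.e ≫ T.poly.s) (ζ : Z) (j : Fin (arr d ζ).n) :
    (arr c (atInput d ζ j)).tgt = (arr d ζ).src j :=
  (congrArg Discrete.as (CategoryTheory.Functor.congr_obj (congrArg Cat.Hom.toFunctor w)
    (atInput d ζ j))).trans (src_inp' d (obj_atInput d ζ j) (pos_atInput d ζ j).symm)

end CollCell

end PolyOpd

/-! ### Full faithfulness: morphisms over `S` come from morphisms of operads -/

namespace PolyOpd

open CollCell

/-- The polynomial endomorphism of a collection. -/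
abbrev Coll.toEnd (T : Coll.{u}) : PolyEnd Cat.{u, u} := ⟨T.colours, T.poly⟩

/-- Morphisms of polynomial endomorphisms which are compatible with the projections to
`1 ⟵ ℙ_* ⟶ ℙ ⟶ 1`. -/
structure IsOverSym {S T : Coll.{u}} (G : PolyEnd.Hom S.toEnd T.toEnd) : Prop where
  star : G.φ.f₂ ≫ (Pointed.star T.arity).toCatHom = (Pointed.star S.arity).toCatHom
  arity : G.φ.f₁ ≫ T.arity.toCatHom = S.arity.toCatHom

namespace IsOverSym

section Coll

variable {S T : Coll.{u}} (G : PolyEnd.Hom S.toEnd T.toEnd)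

/-- The action on colours. -/
def colour (i : S.I) : T.I := (G.f.toFunctor.obj ⟨i⟩).as

/-- The action on arrows. -/
def arrow (α : S.Arrow) : T.Arrow := G.φ.f₁.toFunctor.obj α

variable {G}

theorem tgt (α : S.Arrow) : (arrow G α).tgt = colour G α.tgt :=
  congrArg Discrete.as (CategoryTheory.Functor.congr_obj (congrArg Cat.Hom.toFunctor G.φ.w_t) α)

theorem n (hG : IsOverSym G) (α : S.Arrow) : (arrow G α).n = α.n :=
  congrArg PermCat.n (CategoryTheory.Functor.congr_obj (congrArg Cat.Hom.toFunctor hG.arity) α)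

/-- Compatibility with the projection to `ℙ_*` forces the input `(α, j)` to go to the `j`-th input
of the image of `α`; compatibility with the source legs then gives its colour. -/
theorem src (hG : IsOverSym G) (α : S.Arrow) (j : Fin α.n) (j' : Fin (arrow G α).n) (h : (j' : ℕ) = j) :
    (arrow G α).src j' = colour G (α.src j) := by
  let a : S.Input := ⟨α, j⟩
  have h1 : ((G.φ.f₂.toFunctor.obj a).base : T.Arrow) = arrow G α :=
    CategoryTheory.Functor.congr_obj (congrArg Cat.Hom.toFunctor G.φ.isPullback.w) a
  have h2 : ((G.φ.f₂.toFunctor.obj a).pt : ℕ) = j := by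
    have h3 : ∀ {p q : PermStar.{u}}, p = q → (p.pt : ℕ) = q.pt := by rintro p _ rfl; rfl
    exact h3 (CategoryTheory.Functor.congr_obj (congrArg Cat.Hom.toFunctor hG.star) a)
  have h4 : (G.φ.f₂.toFunctor.obj a).base.src (G.φ.f₂.toFunctor.obj a).pt =
      colour G (α.src j) :=
    congrArg Discrete.as (CategoryTheory.Functor.congr_obj (congrArg Cat.Hom.toFunctor G.φ.w_s) a)
  rw [← h4]
  exact Coll.Arrow.src_congr h1.symm (h.trans h2.symm)

/-- Equivariance is functoriality: the morphism `ασ ⟶ α` given by `σ` goes to a morphism of arrows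
of `T` with the same underlying permutation, and such a morphism is an equation between its ends.
The variables `γ` and `σ'` allow an image that is equal, but not syntactically, to `arrow G α`. -/
theorem arrow_act (hG : IsOverSym G) (α : S.Arrow) {m : ℕ} (σ : Fin m ≃ Fin α.n) {γ : T.Arrow}
    (hγ : γ = arrow G α) {m' : ℕ} (σ' : Fin m' ≃ Fin γ.n) (hm : m = m')
    (hσ : ∀ (j : Fin m) (j' : Fin m'), (j : ℕ) = j' → (σ j : ℕ) = σ' j') :
    arrow G (α.act σ) = γ.act σ' := by
  subst hγ
  let v : α.act σ ⟶ α := α.actHom σ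
  refine (G.φ.f₁.toFunctor.map v).eq.trans (Coll.Arrow.act_congr rfl ((hG.n _).trans hm) ?_)
  intro j j' hj
  have hj' : (j : ℕ) < m := lt_of_lt_of_eq j.2 (hG.n (α.act σ))
  refine (permFunctor_congr (congrArg Cat.Hom.toFunctor hG.arity) v (j := j) (j' := ⟨j, hj'⟩)
    rfl).trans (hσ ⟨j, hj'⟩ j' hj)

theorem toSym_app (hG : IsOverSym G) {X Y : Cat.{u, u}} {x : X ⟶ Y} (c : S.poly.Cell x) :
    toSym (G.app c) = toSym c := by
  apply Poly.Cell.ext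
  · exact (Category.assoc c.e G.φ.f₂ _).trans (congrArg (c.e ≫ ·) hG.star)
  · exact (Category.assoc c.b G.φ.f₁ _).trans (congrArg (c.b ≫ ·) hG.arity)

theorem exists_map (hG : IsOverSym G) {n : ℕ} {s : Fin n → S.I} {i : S.I} (α : S.Hom s i) :
    ∃ γ : T.Hom (colour G ∘ s) (colour G i), Coll.Arrow.mk _ _ _ γ = arrow G ⟨n, s, i, α⟩ :=
  Coll.Arrow.exists_hom _ (hG.n _) (fun j j' hj ↦ hG.src ⟨n, s, i, α⟩ j' j hj) (tgt _)

end Coll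

end IsOverSym

namespace IsOverSym

open Opd (unitArr compArr)

variable {S T : Opd.{u}} {G : PolyEnd.Hom S.toEnd T.toEnd}

/-- The identity arrow of `i` is the arrow of the unit structure on the one-object category with
colour `i`, so preservation of unit structures can be read there. -/
theorem arrow_unitArr (h : ∀ {X : Cat.{u, u}} (x : X ⟶ S.colours),
    G.app (S.unitCell x) = T.unitCell (x ≫ G.f)) (i : S.I) :
    arrow G (S.unitArr i) = T.unitArr (colour G i) := by
  let x : oneCat.{u} ⟶ S.colours := pointAt (Z := S.colours) ⟨i⟩
  refine (congrArg (arrow G) (S.arr_unitCell x pt)).symm.trans ?_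
  exact (congrArg (fun c ↦ arr c pt) (h x)).trans (T.arr_unitCell (x ≫ G.f) pt)

/-- A composite of arrows is realised as a product of structures over the one-object category, and
preservation of that product is then evaluated at its only object. -/
theorem arrow_compArr (hG : IsOverSym G) (h : ∀ {X Y Z : Cat.{u, u}} {x : X ⟶ Y} {y : Y ⟶ Z} {z : X ⟶ Z}
    (c : S.poly.Cell x) (d : S.poly.Cell y) (w) (hz : x ≫ y = z) (w'),
      G.app (subst c d w hz) = subst (T := T) (G.app c) (G.app d) w' hz)
    (α : S.Arrow) (β : Fin α.n → S.Arrow) (hβ : ∀ j, (β j).tgt = α.src j)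
    {γ : T.Arrow} (hγ : γ = arrow G α) (β' : Fin γ.n → T.Arrow)
    (hββ : ∀ (j : Fin α.n) (j' : Fin γ.n), (j : ℕ) = j' → β' j' = arrow G (β j))
    (hβ' : ∀ j, (β' j).tgt = γ.src j) :
    arrow G (compArr α β hβ) = compArr γ β' hβ' := by
  subst hγ
  -- `D` gives the structure consisting of the single arrow `α`; `C` puts `β j` over the `j`-th
  -- input of `α`.
  let D : Discrete PUnit.{u + 1} ⥤ S.Arrow := functorOfIsDiscrete fun _ ↦ α
  let C : Pointed (D ⋙ S.arity) ⥤ S.Arrow := functorOfIsDiscrete fun a ↦ β a.pt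
  have w := Coll.cellOf_condition D C fun a ↦ hβ a.pt
  have w' : (G.app (Coll.cellOf C)).b ≫ T.poly.t = (G.app (Coll.cellOf D)).e ≫ T.poly.s := by
    rw [G.app_s, G.app_t, reassoc_of% w]
  have h1 := congrArg (fun c ↦ arr c pt) (h (Coll.cellOf C) (Coll.cellOf D) w rfl w')
  refine Eq.trans ?_ (h1.trans ((arr_subst (T := T) (G.app (Coll.cellOf C))
    (G.app (Coll.cellOf D)) w' rfl pt).trans ?_))
  · refine (congrArg (arrow G) ?_).trans
      (congrArg (arrow G) (arr_subst (Coll.cellOf C) (Coll.cellOf D) w rfl pt)).symm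
    refine Opd.compArr_congr rfl ?_ _ _
    intro j j' hj
    obtain rfl := Fin.ext hj
    exact (congrArg C.obj (atInput_cellOf D pt j)).symm
  · refine Opd.compArr_congr rfl ?_ _ _
    intro j j' hj
    have hj' : (j : ℕ) < α.n := lt_of_lt_of_eq j.2 (hG.n α)
    -- Applying `G` leaves the numbering unchanged, so the `j`-th input over the point is still the
    -- `j`-th input of `α`.
    have h2 : atInput (G.app (Coll.cellOf D)) pt j = ⟨pt, ⟨j, hj'⟩⟩ := by
      refine atInput_eq (T := T.toColl) _ rfl ?_
      rw [hG.toSym_app]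
      rfl
    refine (congrArg (fun a ↦ arrow G (C.obj a)) h2).trans ?_
    exact (hββ ⟨j, hj'⟩ j' hj).symm

/-- The morphism of operads given by a morphism of polynomial endomorphisms. -/
noncomputable def toMor (hG : IsOverSym G)
    (h₁ : ∀ {X : Cat.{u, u}} (x : X ⟶ S.colours), G.app (S.unitCell x) = T.unitCell (x ≫ G.f))
    (h₂ : ∀ {X Y Z : Cat.{u, u}} {x : X ⟶ Y} {y : Y ⟶ Z} {z : X ⟶ Z}
      (c : S.poly.Cell x) (d : S.poly.Cell y) (w) (hz : x ≫ y = z) (w'),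
      G.app (subst c d w hz) = subst (T := T) (G.app c) (G.app d) w' hz) : S ⟶ T where
  f := colour G
  map α := (hG.exists_map α).choose
  -- Each axiom is an equation between the chosen arrows with fixed source and target; passing to
  -- bundled arrows turns it into the corresponding statement about `arrow G`.
  map_act {n s i} α ρ := by
    apply Coll.Arrow.mk_injective
    refine (hG.exists_map (S.act α ρ)).choose_spec.trans ?_
    exact hG.arrow_act ⟨n, s, i, α⟩ ρ (hG.exists_map α).choose_spec ρ rfl
      fun j j' hj ↦ by rw [Fin.ext hj]
  map_unit i := by
    apply Coll.Arrow.mk_injective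
    refine (hG.exists_map (S.unit i)).choose_spec.trans ?_
    exact arrow_unitArr h₁ i
  map_comp {n s i} α {m t} β := by
    apply Coll.Arrow.mk_injective
    refine (hG.exists_map (S.comp α β)).choose_spec.trans ?_
    refine hG.arrow_compArr h₂ ⟨n, s, i, α⟩ (fun j ↦ ⟨m j, t j, s j, β j⟩) (fun _ ↦ rfl)
      (hG.exists_map α).choose_spec (fun j ↦ ⟨m j, _, _, (hG.exists_map (β j)).choose⟩) ?_
      (fun _ ↦ rfl)
    intro j j' hj
    obtain rfl := Fin.ext hj
    exact (hG.exists_map (β j)).choose_spec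

theorem arrow_toMor (hG : IsOverSym G) (h₁) (h₂) (α : S.Arrow) :
    Opd.Mor.arrow (hG.toMor h₁ h₂) α = arrow G α :=
  (hG.exists_map α.hom).choose_spec

/-- A morphism of polynomial endomorphisms is determined by its action on colours and on the
identity structure, and a structure by its numbering and its arrows. The numberings agree because
both morphisms lie over `S`; the arrows agree by construction. -/
theorem endMap_toMor (hG : IsOverSym G) (h₁) (h₂) : Opd.Mor.endMap (hG.toMor h₁ h₂) = G := by
  have hs : ∀ {X Y : Cat.{u, u}} {x : X ⟶ Y} (c : S.poly.Cell x),
      toSym (T := T.toColl) ((Opd.Mor.endMap (hG.toMor h₁ h₂)).app c) =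
        toSym (T := T.toColl) (G.app c) :=
    fun c ↦ (Opd.Mor.toSym_app _ c).trans (hG.toSym_app c).symm
  refine PolyEnd.Hom.ext_app (Cat.ext (discreteFunctor_ext fun _ ↦ rfl)) ?_
  refine CollCell.ext (T := T.toColl) (fun a ↦ ?_) fun β ↦ hG.arrow_toMor h₁ h₂ β
  exact congrArg (fun s ↦ (num s).pos a) (hs S.poly.idCell)

end IsOverSym

namespace Opd

variable {S T : Opd.{u}}

/-- The commuting triangle over `S`, evaluated at the identity structure, yields its two components.
-/
theorem isOverSym (F : Nbar.obj S ⟶ Nbar.obj T) :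
    IsOverSym (S := S.toColl) (T := T.toColl) (PolyMnd.Hom.toHom F.left) := by
  have h : (F.left ≫ T.toSymMnd : S.mnd ⟶ SymMnd) = S.toSymMnd := Over.w F
  have h' := congrArg (fun k ↦ (PolyMnd.Hom.toHom k).app S.poly.idCell) h
  constructor
  · have := congrArg Poly.Cell.e h'
    exact (Category.id_comp (_ ≫ _)).symm.trans (this.trans (Category.id_comp _))
  · have := congrArg Poly.Cell.b h'
    exact (Category.id_comp (_ ≫ _)).symm.trans (this.trans (Category.id_comp _))

end Opd

instance : Nbar.{u}.Full where
  map_surjective {S T} F := by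
    -- The first two goals transfer the monad-morphism axioms of `F` to the operations `unitCell`
    -- and `subst`, which are the actions of the unit and multiplication of the two monads.
    refine ⟨(Opd.isOverSym F).toMor ?_ ?_, ?_⟩
    · intro X x
      refine (congrArg _ (S.map_polyUnit x)).symm.trans ?_
      exact (F.left.app_oneCell x).trans (T.map_polyUnit _)
    · intro X Y Z x y z c d w hz w'
      refine (congrArg _ (S.map_polyMul c d w hz)).symm.trans ?_
      exact (F.left.app_mulCell c d w hz).trans (T.map_polyMul _ _ _ _)
    · apply Over.OverMorphism.ext
      exact PolyMnd.hom_ext_toHom (IsOverSym.endMap_toMor _ _ _)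

instance : Nbar.{u}.Faithful where
  map_injective {S T} F G h := by
    have h1 : Opd.Mor.endMap F = Opd.Mor.endMap G :=
      congrArg (fun k : Nbar.obj S ⟶ Nbar.obj T ↦ PolyMnd.Hom.toHom k.left) h
    -- Colours and arrows are the objects of the categories in the polynomial, so a morphism of
    -- operads can be recovered from the object parts of its functors.
    have hf : F.f = G.f := funext fun i ↦ congrArg Discrete.as
      (CategoryTheory.Functor.congr_obj
        (congrArg (fun k : PolyEnd.Hom S.mnd.toEnd T.mnd.toEnd ↦ k.f.toFunctor) h1) ⟨i⟩)
    have hm : ∀ α : S.Arrow, Opd.Mor.arrow F α = Opd.Mor.arrow G α := fun α ↦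
      congrArg (fun k : PolyEnd.Hom S.toEnd T.toEnd ↦ IsOverSym.arrow k α) h1
    obtain ⟨⟨f, map, _⟩, _, _⟩ := F
    obtain ⟨⟨g, map', _⟩, _, _⟩ := G
    dsimp only at hf
    subst hf
    have : @map = @map' := by
      funext n s i α
      exact Coll.Arrow.mk_injective (hm ⟨n, s, i, α⟩)
    subst this
    rfl

end PolyOpd

/-! ### Composition of arrows from a multiplication of structures -/

namespace PolyOpd

open CollCell

/-- The functor on objects `o a` which are isomorphic to objects indexed by `q a`. -/
def functorOfIsos {X D Q : Type u} [Category.{u} X] [Category.{u} D] (o : X → D) (q : X → Q)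
    (hq : ∀ {a a'}, (a ⟶ a') → q a = q a') (β : Q → D) (f : ∀ a, o a ≅ β (q a)) : X ⥤ D where
  obj := o
  map {a a'} v := (f a).hom ≫ eqToHom (congrArg β (hq v)) ≫ (f a').inv

namespace CollCell

variable {T : Coll.{u}} {X Y Z : Cat.{u, u}} {x : X ⟶ Y} {y : Y ⟶ Z} {z : X ⟶ Z}

/-- Reconciles two forms of the lexicographic order: the numbering of a composite sums block sizes
over initial segments of `ℕ`, while concatenation in an operad uses `finSigmaFinEquiv`. The arities
are passed as variables `n` and `m`, so that sums in different but equal forms can be used. -/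
theorem comp_pos_eq_finSigma (c : T.poly.Cell x) (d : T.poly.Cell y) (hz : x ≫ y = z) {n : ℕ}
    {m : Fin n → ℕ} {ζ : Z} (hn : (arr d ζ).n = n)
    (hm : ∀ b, y.toFunctor.obj b = ζ → ∀ j : Fin n, (j : ℕ) = (num (toSym d)).pos b →
      (arr c b).n = m j)
    {a : X} (ha : z.toFunctor.obj a = ζ) (j : Fin n)
    (hj : (j : ℕ) = (num (toSym d)).pos (x.toFunctor.obj a)) (k : Fin (m j))
    (hk : (k : ℕ) = (num (toSym c)).pos a) :
    ((num (toSym c)).comp (num (toSym d)) hz).pos a =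
      (finSigmaFinEquiv (⟨j, k⟩ : Σ j, Fin (m j)) : ℕ) := by
  subst hn
  rw [Opd.finSigma_val ((num (toSym c)).block (num (toSym d)) ζ), Numbering.comp_pos, ha, hj, hk]
  intro j
  refine (dif_pos (show (j : ℕ) < (num (toSym d)).arity ζ from j.2)).trans ?_
  exact hm _ (Numbering.obj_fib _ _ _ _) j (Numbering.pos_fib _ _ _ _).symm

theorem comp_arity_eq_sum (c : T.poly.Cell x) (d : T.poly.Cell y) (hz : x ≫ y = z) {n : ℕ}
    {m : Fin n → ℕ} {ζ : Z} (hn : (arr d ζ).n = n)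
    (hm : ∀ b, y.toFunctor.obj b = ζ → ∀ j : Fin n, (j : ℕ) = (num (toSym d)).pos b →
      (arr c b).n = m j) :
    ((num (toSym c)).comp (num (toSym d)) hz).arity ζ = ∑ j, m j := by
  subst hn
  refine (Finset.sum_range _).trans (Finset.sum_congr rfl fun j _ ↦ ?_)
  refine (dif_pos (show (j : ℕ) < (num (toSym d)).arity ζ from j.2)).trans ?_
  exact hm _ (Numbering.obj_fib _ _ _ _) j (Numbering.pos_fib _ _ _ _).symm

/-- Reads the source colours of an arrow from the source leg of its structure; used for structures
whose source leg is known although their arrows are not. -/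
theorem src_arr (c : T.poly.Cell x) {f : X ⟶ T.colours} (h : c.e ≫ T.poly.s = f) {a : X} {β : Y}
    (ha : x.toFunctor.obj a = β) {j : Fin (arr c β).n} (hj : (j : ℕ) = (num (toSym c)).pos a) :
    (arr c β).src j = (f.toFunctor.obj a).as := by
  subst h
  exact (src_inp' c ha hj).symm

end CollCell

/-- Unital and associative operations on the structures for the polynomial of a collection which
lie over the operations of the polynomial monad for symmetric monoidal categories. -/
structure CellMonad (T : Coll.{u}) where
  mul : ∀ {X Y Z : Cat.{u, u}} {x : X ⟶ Y} {y : Y ⟶ Z} {z : X ⟶ Z} (c : T.poly.Cell x)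
    (d : T.poly.Cell y), c.b ≫ T.poly.t = d.e ≫ T.poly.s → x ≫ y = z → T.poly.Cell z
  one : ∀ {X : Cat.{u, u}}, (X ⟶ T.colours) → T.poly.Cell (𝟙 X)
  mul_s : ∀ {X Y Z : Cat.{u, u}} {x : X ⟶ Y} {y : Y ⟶ Z} {z : X ⟶ Z} (c : T.poly.Cell x)
    (d : T.poly.Cell y) (w) (hz : x ≫ y = z), (mul c d w hz).e ≫ T.poly.s = c.e ≫ T.poly.s
  mul_t : ∀ {X Y Z : Cat.{u, u}} {x : X ⟶ Y} {y : Y ⟶ Z} {z : X ⟶ Z} (c : T.poly.Cell x)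
    (d : T.poly.Cell y) (w) (hz : x ≫ y = z), (mul c d w hz).b ≫ T.poly.t = d.b ≫ T.poly.t
  one_s : ∀ {X : Cat.{u, u}} (f : X ⟶ T.colours), (one f).e ≫ T.poly.s = f
  one_t : ∀ {X : Cat.{u, u}} (f : X ⟶ T.colours), (one f).b ≫ T.poly.t = f
  toSym_mul : ∀ {X Y Z : Cat.{u, u}} {x : X ⟶ Y} {y : Y ⟶ Z} {z : X ⟶ Z} (c : T.poly.Cell x)
    (d : T.poly.Cell y) (w) (hz : x ≫ y = z),
    toSym (mul c d w hz) = symSubst (toSym c) (toSym d) hz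
  toSym_one : ∀ {X : Cat.{u, u}} (f : X ⟶ T.colours), toSym (one f) = (Numbering.id X).cell
  mul_base : ∀ {X Y Z : Cat.{u, u}} {x : X ⟶ Y} {y : Y ⟶ Z} {z : X ⟶ Z} (c : T.poly.Cell x)
    (d : T.poly.Cell y) (w) (hz : x ≫ y = z) {X' Y' Z' : Cat.{u, u}} {x' : X' ⟶ Y'} {y' : Y' ⟶ Z'}
    {z' : X' ⟶ Z'} {k : X' ⟶ X} {l : Y' ⟶ Y} {m : Z' ⟶ Z} (sq₁ : IsPullback k x' x l)
    (sq₂ : IsPullback l y' y m) (sq : IsPullback k z' z m) (hz' : x' ≫ y' = z') (w'),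
    (mul c d w hz).base sq = mul (c.base sq₁) (d.base sq₂) w' hz'
  one_base : ∀ {X X' : Cat.{u, u}} (f : X ⟶ T.colours) {m : X' ⟶ X}
    (sq : IsPullback m (𝟙 X') (𝟙 X) m), (one f).base sq = one (m ≫ f)
  one_mul : ∀ {X Y : Cat.{u, u}} {x : X ⟶ Y} (c : T.poly.Cell x) (w),
    mul (one (c.e ≫ T.poly.s)) c w (Category.id_comp x) = c
  mul_one : ∀ {X Y : Cat.{u, u}} {x : X ⟶ Y} (c : T.poly.Cell x) (w),
    mul c (one (c.b ≫ T.poly.t)) w (Category.comp_id x) = c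
  mul_mul : ∀ {X Y Z W : Cat.{u, u}} {x : X ⟶ Y} {y : Y ⟶ Z} {z : X ⟶ Z} {v : Z ⟶ W}
    {yv : Y ⟶ W} {t : X ⟶ W} (c : T.poly.Cell x) (d : T.poly.Cell y) (e : T.poly.Cell v)
    (h) (h') (hz : x ≫ y = z) (hyv : y ≫ v = yv) (ht : z ≫ v = t) (ht' : x ≫ yv = t) (h₁) (h₂),
    mul (mul c d h hz) e h₁ ht = mul c (mul d e h' hyv) h₂ ht'

namespace CellMonad

open Coll (Arrow cellOf)

variable {T : Coll.{u}} (A : CellMonad T)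

section Cells

variable {X Y Z : Cat.{u, u}} {x : X ⟶ Y} {y : Y ⟶ Z} {z : X ⟶ Z}

theorem mul_congr {c c' : T.poly.Cell x} {d d' : T.poly.Cell y} (hc : c = c') (hd : d = d')
    (w) (w') (hz : x ≫ y = z) : A.mul c d w hz = A.mul c' d' w' hz := by
  subst hc hd
  rfl

theorem num_mul_pos (c : T.poly.Cell x) (d : T.poly.Cell y) (w) (hz : x ≫ y = z) (a : X) :
    (num (toSym (A.mul c d w hz))).pos a = ((num (toSym c)).comp (num (toSym d)) hz).pos a := by
  rw [A.toSym_mul]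
  rfl

theorem arr_mul_n (c : T.poly.Cell x) (d : T.poly.Cell y) (w) (hz : x ≫ y = z) (ζ : Z) :
    (arr (A.mul c d w hz) ζ).n = ((num (toSym c)).comp (num (toSym d)) hz).arity ζ :=
  congrArg (fun s ↦ (num s).arity ζ) (A.toSym_mul c d w hz)

/-- The identity arrows. -/
def unitArr (i : T.I) : T.Arrow := arr (A.one (pointAt (Z := T.colours) ⟨i⟩)) pt

/-- Restricting the unit structure along the point `β` gives the unit structure at the colour of
`β`, whose arrow is the identity arrow by definition. -/
theorem arr_one (f : X ⟶ T.colours) (β : X) :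
    arr (A.one f) β = A.unitArr (f.toFunctor.obj β).as := by
  have sq : IsPullback (pointAt β) (𝟙 _) (𝟙 X) (pointAt β) := IsPullback.of_vert_isIso ⟨by simp⟩
  have h := congrArg (fun c ↦ arr c pt) (A.one_base f sq)
  have h' : pointAt β ≫ f = pointAt (Z := T.colours) (f.toFunctor.obj β) :=
    Cat.ext (discreteFunctor_ext fun _ ↦ rfl)
  rw [h'] at h
  exact h

theorem unitArr_n (i : T.I) : (A.unitArr i).n = 1 :=
  congrArg (fun s ↦ (num s).arity pt) (A.toSym_one (pointAt (Z := T.colours) ⟨i⟩))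

theorem unitArr_src (i : T.I) (j : Fin (A.unitArr i).n) : (A.unitArr i).src j = i := by
  refine src_arr (a := pt) (β := pt) (A.one (pointAt (Z := T.colours) ⟨i⟩)) (A.one_s _) rfl ?_
  rw [A.toSym_one]
  -- The identity numbering gives position `0`, and `j` is `0` because the arity is one.
  exact Nat.lt_one_iff.1 (lt_of_lt_of_eq j.2 (A.unitArr_n i))

theorem unitArr_tgt (i : T.I) : (A.unitArr i).tgt = i :=
  congrArg (fun f : oneCat ⟶ T.colours ↦ (f.toFunctor.obj pt).as)
    (A.one_t (pointAt (Z := T.colours) ⟨i⟩))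

end Cells

section Composites

/-- The functor which picks an arrow. -/
abbrev outer (α : T.Arrow) : Discrete PUnit.{u + 1} ⥤ T.Arrow := functorOfIsDiscrete fun _ ↦ α

/-- The functor which picks an arrow for each input of `α`. -/
abbrev inner {α : T.Arrow} (β : Fin α.n → T.Arrow) : Pointed (outer α ⋙ T.arity) ⥤ T.Arrow :=
  functorOfIsDiscrete fun a ↦ β a.pt

/-- The composite of composable arrows. -/
def compArr (α : T.Arrow) (β : Fin α.n → T.Arrow) (h : ∀ j, (β j).tgt = α.src j) : T.Arrow :=
  arr (A.mul (cellOf (inner β)) (cellOf (outer α))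
    (Coll.cellOf_condition _ _ fun a ↦ h a.pt) rfl) pt

theorem compArr_congr {α α' : T.Arrow} (hα : α = α') {β : Fin α.n → T.Arrow}
    {β' : Fin α'.n → T.Arrow} (hβ : ∀ (j : Fin α.n) (j' : Fin α'.n), (j : ℕ) = j' → β j = β' j')
    (h : ∀ j, (β j).tgt = α.src j) (h' : ∀ j, (β' j).tgt = α'.src j) :
    A.compArr α β h = A.compArr α' β' h' := by
  subst hα
  obtain rfl : β = β' := funext fun j ↦ hβ j j rfl
  rfl

/-- A product of structures is determined by composition of arrows: restricting both factors along
the point `ζ` leaves one arrow with a family over its inputs, and multiplication commutes with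
restriction. All axioms below are transferred through this formula. -/
theorem arr_mul {X Y Z : Cat.{u, u}} {x : X ⟶ Y} {y : Y ⟶ Z} {z : X ⟶ Z} (c : T.poly.Cell x)
    (d : T.poly.Cell y) (w) (hz : x ≫ y = z) (ζ : Z) :
    arr (A.mul c d w hz) ζ =
      A.compArr (arr d ζ) (fun j ↦ arr c (atInput d ζ j)) (tgt_arr_eq w ζ) := by
  subst hz
  -- The structure with the single arrow `arr d ζ` is the restriction of `d` along `ζ`; the
  -- comparison `l` of domains enumerates the fibre over `ζ`.
  obtain ⟨l, sq₂, h2⟩ := d.exists_base_eq (cellOf (outer (arr d ζ))) (pointAt ζ)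
    (Cat.ext (functor_ext_of_isDiscrete (Z := Discrete PUnit.{u + 1}) fun _ ↦ rfl))
  have hl : ∀ a : Pointed (outer (arr d ζ) ⋙ T.arity), l.toFunctor.obj a = atInput d ζ a.pt := by
    intro a
    refine (atInput_eq d ?_ ?_).symm
    · exact CategoryTheory.Functor.congr_obj (congrArg Cat.Hom.toFunctor sq₂.w) a
    · exact congrArg (fun c ↦ (num (toSym c)).pos a) h2.symm
  -- Along this enumeration, the restriction of `c` is the structure given by the family of its
  -- arrows at the inputs.
  obtain ⟨k, sq₁, h1⟩ := c.exists_base_eq (cellOf (inner fun j ↦ arr c (atInput d ζ j))) l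
    (Cat.ext (functor_ext_of_isDiscrete (Z := Pointed (outer (arr d ζ) ⋙ T.arity))
      fun a ↦ congrArg (arr c) (hl a).symm))
  have w' : (c.base sq₁).b ≫ T.poly.t = (d.base sq₂).e ≫ T.poly.s := by
    rw [← h1, ← h2]
    exact Coll.cellOf_condition _ _ fun a ↦ tgt_arr_eq w ζ a.pt
  have h := A.mul_base c d w rfl sq₁ sq₂ (sq₁.paste_vert sq₂) rfl w'
  exact (congrArg (fun c ↦ arr c pt) h).trans
    (congrArg (fun c ↦ arr c pt) (A.mul_congr h1.symm h2.symm _ _ _))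

variable (α : T.Arrow) (β : Fin α.n → T.Arrow) (h : ∀ j, (β j).tgt = α.src j)

theorem inner_n (b : Pointed (outer α ⋙ T.arity)) (j : Fin α.n)
    (hj : (j : ℕ) = (num (toSym (cellOf (outer α)))).pos b) : ((inner β).obj b).n = (β j).n :=
  congrArg (fun j ↦ (β j).n) (Fin.ext hj.symm)

theorem compArr_n : (A.compArr α β h).n = ∑ j, (β j).n :=
  (A.arr_mul_n _ _ _ _ _).trans (comp_arity_eq_sum _ _ _ rfl fun b _ j hj ↦ inner_n α β b j hj)

theorem compArr_tgt : (A.compArr α β h).tgt = α.tgt :=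
  congrArg (fun f : oneCat ⟶ T.colours ↦ (f.toFunctor.obj pt).as)
    (A.mul_t (cellOf (inner β)) (cellOf (outer α)) _ rfl)

/-- The input of the composite which is the `k`-th input of the `j`-th arrow. -/
abbrev innerInput (j : Fin α.n) (k : Fin (β j).n) : Cat.of (Pointed (inner β ⋙ T.arity)) :=
  (⟨⟨pt, j⟩, k⟩ : Pointed (inner β ⋙ T.arity))

theorem pos_compArr (j : Fin α.n) (k : Fin (β j).n) (w) :
    (num (toSym (A.mul (cellOf (inner β)) (cellOf (outer α)) w rfl))).pos (innerInput α β j k) =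
      (finSigmaFinEquiv (⟨j, k⟩ : Σ j, Fin (β j).n) : ℕ) :=
  (A.num_mul_pos _ _ _ _ _).trans
    (comp_pos_eq_finSigma (cellOf (inner β)) (cellOf (outer α)) rfl (m := fun j ↦ (β j).n)
      (ζ := pt) rfl (fun b _ j hj ↦ inner_n α β b j hj) (a := innerInput α β j k) rfl j rfl k rfl)

/-- The product has the source leg of its inner factor, and its input numbered by the pair `(j, k)`
is the `k`-th input of `β j`. -/
theorem compArr_src (j : Fin α.n) (k : Fin (β j).n) (l : Fin (A.compArr α β h).n)
    (hl : (l : ℕ) = (finSigmaFinEquiv (⟨j, k⟩ : Σ j, Fin (β j).n) : ℕ)) :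
    (A.compArr α β h).src l = (β j).src k := by
  let w := Coll.cellOf_condition (outer α) (inner β) fun a ↦ h a.pt
  exact src_arr (a := innerInput α β j k) (β := pt)
    (A.mul (cellOf (inner β)) (cellOf (outer α)) w rfl) (A.mul_s _ _ _ _) rfl
    (hl.trans (A.pos_compArr α β j k w).symm)

/-- The outer unit law for structures, applied to the one-arrow structure of `α`. The family `β` is
indexed by the inputs of `A.unitArr i`, whose number equals one only propositionally; hence the
hypothesis `hβ`. -/
theorem unitArr_compArr (i : T.I) (β : Fin (A.unitArr i).n → T.Arrow) (hβ : ∀ j, β j = α) (h) :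
    A.compArr (A.unitArr i) β h = α := by
  -- The unique input of the identity arrow forces the target of `α` to be `i`.
  have hi : α.tgt = i := by
    have h0 := h ⟨0, lt_of_lt_of_eq Nat.one_pos (A.unitArr_n i).symm⟩
    rwa [hβ, A.unitArr_src] at h0
  subst hi
  let c := cellOf (outer α)
  let f : oneCat.{u} ⟶ T.colours := c.b ≫ T.poly.t
  have w : c.b ≫ T.poly.t = (A.one f).e ≫ T.poly.s := (A.one_s f).symm
  have h1 : arr (A.mul c (A.one f) w (Category.comp_id _)) pt = α :=
    congrArg (fun c ↦ arr c pt) (A.mul_one c w)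
  refine Eq.trans ?_ ((A.arr_mul c (A.one f) w (Category.comp_id _) pt).symm.trans h1)
  refine A.compArr_congr (A.arr_one f pt).symm ?_ _ _
  intro j _ _
  exact hβ j

/-- The inner unit law for structures, applied to the one-arrow structure of `α`: over its inputs,
the unit structure consists of the identities of its sources. -/
theorem compArr_unitArr (hβ : ∀ j, β j = A.unitArr (α.src j)) : A.compArr α β h = α := by
  let c := cellOf (outer α)
  let f : Cat.of (Pointed (outer α ⋙ T.arity)) ⟶ T.colours := c.e ≫ T.poly.s
  have w : (A.one f).b ≫ T.poly.t = c.e ≫ T.poly.s := A.one_t f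
  have h1 : arr (A.mul (A.one f) c w (Category.id_comp _)) pt = α :=
    congrArg (fun c ↦ arr c pt) (A.one_mul c w)
  refine Eq.trans ?_ ((A.arr_mul (A.one f) c w (Category.id_comp _) pt).symm.trans h1)
  refine A.compArr_congr rfl ?_ _ _
  intro j j' hj
  obtain rfl := Fin.ext hj
  refine (hβ j).trans (Eq.trans ?_ (A.arr_one f _).symm)
  exact congrArg (fun a ↦ A.unitArr (f.toFunctor.obj a).as) (atInput_cellOf (outer α) pt j).symm

/-- Associativity of the multiplication for a tower of three structures over the one-object
category: `α`, the `β j` over its inputs, and the `γ j k` over theirs. The family `δ` on the inputs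
of the composite is specified by values of indices, because the arity of the composite equals the
sum of the arities only propositionally. -/
theorem compArr_compArr (γ : ∀ j, Fin (β j).n → T.Arrow)
    (hγ : ∀ j k, (γ j k).tgt = (β j).src k) (h') {ε : T.Arrow} (hε : ε = A.compArr α β h)
    (δ : Fin ε.n → T.Arrow)
    (hδ : ∀ j k (l : Fin ε.n),
      (l : ℕ) = (finSigmaFinEquiv (⟨j, k⟩ : Σ j, Fin (β j).n) : ℕ) → δ l = γ j k) (h'') :
    A.compArr α (fun j ↦ A.compArr (β j) (γ j) (hγ j)) h' = A.compArr ε δ h'' := by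
  subst hε
  let G : Pointed (inner β ⋙ T.arity) ⥤ T.Arrow := functorOfIsDiscrete fun a ↦ γ a.base.pt a.pt
  let c := cellOf G
  let d := cellOf (inner β)
  let e := cellOf (outer α)
  have w₁ : c.b ≫ T.poly.t = d.e ≫ T.poly.s :=
    Coll.cellOf_condition (inner β) G fun a ↦ hγ a.base.pt a.pt
  have w₂ : d.b ≫ T.poly.t = e.e ≫ T.poly.s :=
    Coll.cellOf_condition (outer α) (inner β) fun a ↦ h a.pt
  have w₃ := (A.mul_t c d w₁ rfl).trans w₂
  have w₄ := w₁.trans (A.mul_s d e w₂ rfl).symm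
  have h1 := congrArg (fun c ↦ arr c pt) (A.mul_mul c d e w₁ w₂ rfl rfl rfl rfl w₃ w₄)
  refine Eq.trans ?_ (h1.trans ?_)
  · refine Eq.trans ?_ (A.arr_mul _ e w₃ rfl pt).symm
    refine A.compArr_congr rfl ?_ _ _
    intro j j' hj
    obtain rfl := Fin.ext hj
    refine Eq.trans ?_ (congrArg (arr (A.mul c d w₁ rfl))
      (atInput_cellOf (outer α) pt j)).symm
    refine Eq.trans ?_ (A.arr_mul c d w₁ rfl _).symm
    refine A.compArr_congr rfl ?_ _ _
    intro k k' hk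
    obtain rfl := Fin.ext hk
    exact (congrArg G.obj (atInput_cellOf (inner β) ⟨pt, j⟩ k)).symm
  · refine (A.arr_mul c _ w₄ rfl pt).trans (A.compArr_congr rfl ?_ _ _)
    intro l l' hl
    obtain rfl := Fin.ext hl
    -- The `l`-th input of the composite is the `k`-th input of some `β j`, and `δ` was specified by
    -- such pairs.
    obtain ⟨⟨j, k⟩, hjk⟩ := finSigmaFinEquiv.surjective (Fin.cast (A.compArr_n α β h) l)
    have hl' : (l : ℕ) = (finSigmaFinEquiv (⟨j, k⟩ : Σ j, Fin (β j).n) : ℕ) := by rw [hjk]; rfl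
    refine Eq.trans ?_ (hδ j k l hl').symm
    refine congrArg G.obj (atInput_eq (A.mul d e w₂ rfl) (ζ := pt) (j := l)
      (b := innerInput α β j k) rfl ?_)
    exact (A.pos_compArr α β j k w₂).trans hl'.symm

end Composites

end CellMonad

end PolyOpd

/-! ### Equivariance, and the operad of a multiplication of structures -/

namespace PolyOpd

open CollCell

/-- Bijections which act on a composite of arrows. -/
structure Twist {T : Coll.{u}} (α : T.Arrow) (β : Fin α.n → T.Arrow) : Type u where
  n : ℕ
  ρ : Fin n ≃ Fin α.n
  m : Fin n → ℕ
  τ : ∀ j, Fin (m j) ≃ Fin (β (ρ j)).n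

namespace Twist

variable {T : Coll.{u}} {α : T.Arrow} {β : Fin α.n → T.Arrow}

/-- The indiscrete category: there is exactly one morphism between any two twists. A structure over
it relates every twisted composite to the untwisted one by functoriality alone. -/
instance : Category.{u} (Twist α β) where
  Hom _ _ := PUnit
  id _ := PUnit.unit
  comp _ _ := PUnit.unit

/-- The trivial twist. -/
def one (α : T.Arrow) (β : Fin α.n → T.Arrow) : Twist α β :=
  ⟨α.n, Equiv.refl _, fun j ↦ (β j).n, fun _ ↦ Equiv.refl _⟩

/-- The twisted outer arrows. -/
def outer (α : T.Arrow) (β : Fin α.n → T.Arrow) : Twist α β ⥤ T.Arrow :=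
  functorOfIsos (Q := PUnit) (fun z ↦ α.act z.ρ) (fun _ ↦ PUnit.unit) (fun _ ↦ rfl) (fun _ ↦ α)
    (fun z ↦ Coll.Arrow.isoOfHom (α.actHom z.ρ))

/-- Morphisms of twisted outer arrows pass through `α` itself, so they preserve the input of `α`
from which an input comes. This makes the twisted inner arrows functorial, since related inputs
carry twists of the same `β`. -/
theorem outer_perm {z z' : Twist α β} (v : z ⟶ z') (j : Fin z.n) :
    z'.ρ (((outer α β).map v).perm j) = z.ρ j := by
  change z'.ρ (z'.ρ.symm (z.ρ j)) = z.ρ j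
  rw [Equiv.apply_symm_apply]

/-- The twisted inner arrows. -/
def inner (α : T.Arrow) (β : Fin α.n → T.Arrow) : Pointed (outer α β ⋙ T.arity) ⥤ T.Arrow :=
  functorOfIsos (Q := ULift (Fin α.n)) (fun a ↦ (β (a.base.ρ a.pt)).act (a.base.τ a.pt))
    (fun a ↦ ⟨a.base.ρ a.pt⟩) (fun {a a'} v ↦ congrArg ULift.up
      ((outer_perm v.val a.pt).symm.trans (congrArg a'.base.ρ v.map_pt)))
    (fun k ↦ β k.down) (fun a ↦ Coll.Arrow.isoOfHom ((β _).actHom (a.base.τ a.pt)))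

end Twist

namespace CellMonad

open Coll (Arrow cellOf)

variable {T : Coll.{u}} (A : CellMonad T)

/-- The product of the twisted inner and outer structures has a functor to the category of arrows as
base component. Its value at `(ρ, τ)` is the composite of the twisted arrows, its value at the
trivial twist is the original composite, and the morphism between these twists exhibits the former
as the latter acted on by some permutation. Positions of inputs identify this permutation with `σ`.
-/
theorem compArr_act (α : T.Arrow) (β : Fin α.n → T.Arrow) (h : ∀ j, (β j).tgt = α.src j) {n' : ℕ}
    (ρ : Fin n' ≃ Fin α.n) {m' : Fin n' → ℕ} (τ : ∀ j, Fin (m' j) ≃ Fin (β (ρ j)).n)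
    {ε : T.Arrow} (hε : ε = A.compArr α β h) (σ : Fin (∑ j, m' j) ≃ Fin ε.n)
    (hσ : ∀ j k, (σ (finSigmaFinEquiv ⟨j, k⟩) : ℕ) =
      (finSigmaFinEquiv ⟨ρ j, τ j k⟩ : Fin (∑ j, (β j).n)))
    (h' : ∀ j, ((β (ρ j)).act (τ j)).tgt = (α.act ρ).src j) :
    A.compArr (α.act ρ) (fun j ↦ (β (ρ j)).act (τ j)) h' = ε.act σ := by
  subst hε
  let c := cellOf (Twist.inner α β)
  let d := cellOf (Twist.outer α β)
  have w : c.b ≫ T.poly.t = d.e ≫ T.poly.s :=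
    Coll.cellOf_condition (Twist.outer α β) (Twist.inner α β) fun a ↦ h (a.base.ρ a.pt)
  let f := A.mul c d w rfl
  let z : Twist α β := ⟨n', ρ, m', τ⟩
  let z' : Twist α β := Twist.one α β
  have hz : arr f z = A.compArr (α.act ρ) (fun j ↦ (β (ρ j)).act (τ j)) h' := by
    refine (A.arr_mul c d w rfl z).trans (A.compArr_congr rfl ?_ _ _)
    intro j j' hj
    obtain rfl := Fin.ext hj
    exact congrArg (Twist.inner α β).obj (atInput_cellOf (Twist.outer α β) z j)
  have hz' : arr f z' = A.compArr α β h := by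
    refine (A.arr_mul c d w rfl z').trans (A.compArr_congr α.act_refl ?_ _ _)
    intro j j' hj
    obtain rfl := Fin.ext hj
    exact (congrArg (Twist.inner α β).obj (atInput_cellOf (Twist.outer α β) z' j)).trans
      (β j).act_refl
  let v : z ⟶ z' := PUnit.unit
  -- A morphism in the category of arrows contains the equation that is wanted; what remains is to
  -- compute its permutation.
  have hv : arr f z = (arr f z').act (f.b.toFunctor.map v).perm := (f.b.toFunctor.map v).eq
  refine hz.symm.trans (hv.trans (Coll.Arrow.act_congr hz' ?_ ?_))
  · exact (congrArg Coll.Arrow.n hz).trans (A.compArr_n _ _ _)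
  intro l l' hl
  obtain ⟨⟨j, k⟩, rfl⟩ := finSigmaFinEquiv.surjective l'
  -- The `k`-th input of the `j`-th block over `z` is joined, over `v`, to the `τ j k`-th input of
  -- the `ρ j`-th block over the trivial twist. The permutation thus sends the position of `a` to
  -- that of `a'`.
  let a : Pointed (Twist.inner α β ⋙ T.arity) := ⟨⟨z, j⟩, k⟩
  let a' : Pointed (Twist.inner α β ⋙ T.arity) := ⟨⟨z', ρ j⟩, τ j k⟩
  let v₁ : a.base ⟶ a'.base := ⟨v, rfl⟩
  let v₂ : a ⟶ a' := ⟨v₁, rfl⟩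
  have ha : (num (toSym f)).pos a = l := by
    refine (A.num_mul_pos c d w rfl a).trans (Eq.trans ?_ hl.symm)
    refine comp_pos_eq_finSigma c d rfl (m := m') (ζ := z) rfl ?_ rfl j rfl k rfl
    rintro ⟨_, i⟩ rfl j hj
    exact congrArg m' (Fin.ext hj.symm)
  have ha' : (num (toSym f)).pos a' = σ (finSigmaFinEquiv ⟨j, k⟩) := by
    rw [hσ]
    refine (A.num_mul_pos c d w rfl a').trans ?_
    refine comp_pos_eq_finSigma c d rfl (m := fun j ↦ (β j).n) (ζ := z') rfl ?_ rfl (ρ j) rfl (τ j k) rfl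
    rintro ⟨_, i⟩ rfl j hj
    exact congrArg (fun j ↦ (β j).n) (Fin.ext hj.symm)
  rw [← ha']
  exact perm_eq_of_isPullback (toSym f).isPullback (Lift.mk _ v₂) (j := l) ha.symm

/-- The identity arrows with prescribed source and target. -/
noncomputable def unitHom (i : T.I) : T.Hom (fun _ : Fin 1 ↦ i) i :=
  (A.unitArr i).homOf (A.unitArr_n i) (fun j _ _ ↦ A.unitArr_src i j) (A.unitArr_tgt i)

theorem mk_unitHom (i : T.I) : Arrow.mk 1 _ i (A.unitHom i) = A.unitArr i :=
  Coll.Arrow.mk_homOf _ _ _ _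

section CompHom

variable {n : ℕ} {s : Fin n → T.I} {i : T.I} (α : T.Hom s i) {m : Fin n → ℕ}
  {t : ∀ j, Fin (m j) → T.I} (β : ∀ j, T.Hom (t j) (s j))

/-- The composite has the arity, sources and target required of a composite in an operad; its inputs
are compared with the concatenation pair by pair. -/
theorem exists_compHom : ∃ γ : T.Hom (concat t) i, Arrow.mk (T := T) (∑ j, m j) (concat t) i γ =
    A.compArr ⟨n, s, i, α⟩ (fun j ↦ ⟨m j, t j, s j, β j⟩) fun _ ↦ rfl := by
  refine Coll.Arrow.exists_hom _ (A.compArr_n _ _ _) ?_ (A.compArr_tgt _ _ _)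
  intro l l' hl
  obtain ⟨⟨j, k⟩, rfl⟩ := finSigmaFinEquiv.surjective l'
  rw [Opd.concat_finSigma]
  exact A.compArr_src _ _ _ j k l hl

/-- The composites with prescribed source and target. -/
noncomputable def compHom : T.Hom (concat t) i := (A.exists_compHom α β).choose

theorem mk_compHom : Arrow.mk (T := T) (∑ j, m j) (concat t) i (A.compHom α β) =
    A.compArr ⟨n, s, i, α⟩ (fun j ↦ ⟨m j, t j, s j, β j⟩) fun _ ↦ rfl :=
  (A.exists_compHom α β).choose_spec

end CompHom

/-- The operad given by operations on structures. -/
noncomputable def toOpd : Opd.{u} where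
  toColl := T
  unit i := A.unitHom i
  comp α _ _ β := A.compHom α β
  unit_comp {n s i} α := by
    refine (A.mk_compHom _ _).trans ?_
    refine Eq.trans (A.compArr_congr (A.mk_unitHom i) (β' := fun _ ↦ ⟨n, s, i, α⟩)
      (fun _ _ _ ↦ rfl) _ fun j ↦ (A.unitArr_src i j).symm) ?_
    exact A.unitArr_compArr _ i _ (fun _ ↦ rfl) _
  comp_unit {n s i} α := by
    refine (A.mk_compHom _ _).trans ?_
    exact A.compArr_unitArr _ _ _ fun j ↦ A.mk_unitHom _
  comp_comp {n s i} α {m t} β {p r} γ := by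
    refine (A.mk_compHom _ _).trans (Eq.trans ?_ (A.mk_compHom _ _).symm)
    refine Eq.trans (A.compArr_congr rfl (β' := fun j ↦ A.compArr ⟨m j, t j, s j, β j⟩
      (fun k ↦ ⟨p j k, r j k, t j k, γ j k⟩) fun _ ↦ rfl) ?_ _ fun j ↦ A.compArr_tgt _ _ _) ?_
    · intro j j' hj
      obtain rfl := Fin.ext hj
      exact A.mk_compHom _ _
    · refine A.compArr_compArr _ _ _ _ (fun _ _ ↦ rfl) _ (A.mk_compHom _ _) _ ?_ _
      intro j k l hl
      -- The operad axiom indexes the innermost arrows by decoding a position of the concatenation;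
      -- at the position of `(j, k)` this returns `γ j k`.
      obtain rfl : l = finSigmaFinEquiv ⟨j, k⟩ := Fin.ext hl
      exact congrArg (fun q : Σ j, Fin (m j) ↦
        Arrow.mk (T := T) (p q.1 q.2) (r q.1 q.2) (t q.1 q.2) (γ q.1 q.2))
        (Equiv.symm_apply_apply finSigmaFinEquiv (⟨j, k⟩ : Σ j, Fin (m j)))
  comp_act {n s i} α {m t} β ρ τ := by
    refine Eq.trans ?_ (A.mk_compHom _ _).symm
    refine (A.compArr_act ⟨n, s, i, α⟩ (fun j ↦ ⟨m j, t j, s j, β j⟩) (fun _ ↦ rfl) ρ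
      (m' := fun j ↦ m (ρ j)) (fun j ↦ τ (ρ j)) (A.mk_compHom α β) (blockPerm ρ τ) ?_
      fun _ ↦ rfl).symm
    intro j k
    simp only [blockPerm, Equiv.trans_apply, Equiv.symm_apply_apply]
    rfl

theorem toOpd_unitArr (i : T.I) : A.toOpd.unitArr i = A.unitArr i := A.mk_unitHom i

theorem toOpd_compArr (α : T.Arrow) (β : Fin α.n → T.Arrow) (h : ∀ j, (β j).tgt = α.src j) :
    Opd.compArr (T := A.toOpd) α β h = A.compArr α β h := by
  -- `Opd.compArr` transports the inner arrows along the equations `h`; with the targets as a free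
  -- family `s'`, these equations can be eliminated.
  have key : ∀ {n : ℕ} {s : Fin n → T.I} {i : T.I} (α : T.Hom s i) {m : Fin n → ℕ}
      {t : ∀ j, Fin (m j) → T.I} {s' : Fin n → T.I} (hs : ∀ j, s' j = s j)
      (β : ∀ j, T.Hom (t j) (s' j)),
      Coll.Arrow.mk (T := T) _ _ _
          (A.toOpd.comp α fun j ↦ (hs j ▸ β j : T.Hom (t j) (s j))) =
        A.compArr ⟨n, s, i, α⟩ (fun j ↦ ⟨m j, t j, s' j, β j⟩) hs := by
    intro n s i α m t s' hs β
    obtain rfl : s' = s := funext hs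
    exact A.mk_compHom _ _
  exact key α.hom h fun j ↦ (β j).hom

theorem toOpd_unitCell {X : Cat.{u, u}} (f : X ⟶ T.colours) : A.toOpd.unitCell f = A.one f := by
  apply CollCell.ext (T := T)
  · intro a
    have h1 := A.toOpd.toSym_unitCell f
    have h2 := A.toSym_one f
    exact congrArg (fun s ↦ (num s).pos a) (h1.trans h2.symm)
  · intro β
    exact (A.toOpd.arr_unitCell f β).trans ((A.toOpd_unitArr _).trans (A.arr_one f β).symm)

/-- Both structures carry the lexicographic numbering, and over each object both arrows are
composites of the same arrows. So the monad of the operad has the original multiplication of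
structures. -/
theorem toOpd_subst {X Y Z : Cat.{u, u}} {x : X ⟶ Y} {y : Y ⟶ Z} {z : X ⟶ Z} (c : T.poly.Cell x)
    (d : T.poly.Cell y) (w) (hz : x ≫ y = z) :
    subst (T := A.toOpd) c d w hz = A.mul c d w hz := by
  apply CollCell.ext (T := T)
  · intro a
    exact (num_subst_pos (T := A.toOpd) c d w hz a).trans (A.num_mul_pos c d w hz a).symm
  · intro ζ
    exact (arr_subst (T := A.toOpd) c d w hz ζ).trans
      ((A.toOpd_compArr _ _ _).trans (A.arr_mul c d w hz ζ).symm)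

end CellMonad

end PolyOpd

/-! ### The collection of a discrete fibration over `ℙ` -/

namespace PolyOpd

section DiscreteFibrations

theorem PermCat.eqToHom_perm {a a' : PermCat.{u}} (h : a = a') (j : Fin a.n) :
    (PermCat.Hom.perm (eqToHom h) j : ℕ) = j := by
  subst h
  rfl

namespace IsDiscreteFibration

variable {B : Type u} [Category.{u} B] {b : B ⥤ PermCat.{u}} (hb : IsDiscreteFibration b)

/-- Existence of lifts, with the equality of objects of `ℙ` eliminated: `eqToHom` in `ℙ` does not
change the value of an index. -/
theorem exists_hom (hb : IsDiscreteFibration b) (β : B) {m : ℕ} (σ : Fin m ≃ Fin (b.obj β).n) :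
    ∃ (γ : B) (v : γ ⟶ β), (b.obj γ).n = m ∧
      ∀ (j : Fin (b.obj γ).n) (j' : Fin m), (j : ℕ) = j' → ((b.map v).perm j : ℕ) = σ j' := by
  obtain ⟨⟨γ, v⟩, ⟨h, hv⟩, -⟩ := hb β (a := ⟨m⟩) ⟨σ⟩
  refine ⟨γ, v, congrArg PermCat.n h, fun j j' hj ↦ ?_⟩
  dsimp only at hv
  rw [hv, PermCat.comp_perm]
  exact congrArg (fun j ↦ (σ j : ℕ)) (Fin.ext ((PermCat.eqToHom_perm h j).trans hj))

/-- Uniqueness of lifts: `v` and `v'` both lift the permutation underlying `v'`, again compared by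
values of indices. -/
theorem hom_ext (hb : IsDiscreteFibration b) {β γ γ' : B} (v : γ ⟶ β) (v' : γ' ⟶ β)
    (hn : (b.obj γ).n = (b.obj γ').n)
    (h : ∀ (j : Fin (b.obj γ).n) (j' : Fin (b.obj γ').n), (j : ℕ) = j' →
      ((b.map v).perm j : ℕ) = (b.map v').perm j') :
    (⟨γ, v⟩ : Σ γ : B, (γ ⟶ β)) = ⟨γ', v'⟩ := by
  refine (hb β (b.map v')).unique ⟨PermCat.ext hn, ?_⟩ ⟨rfl, (Category.id_comp _).symm⟩
  ext j
  rw [PermCat.comp_perm]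
  exact h j _ (PermCat.eqToHom_perm _ j).symm

theorem faithful (hb : IsDiscreteFibration b) : b.Faithful where
  map_injective {γ β} v v' h := by
    have h1 := hb.hom_ext v v' rfl fun j j' hj ↦ by rw [h, Fin.ext hj]
    cases h1
    rfl

end IsDiscreteFibration

end DiscreteFibrations

/-- The polynomial endomorphism `1 ⟵ ℙ_* ⟶ ℙ ⟶ 1`. -/
abbrev symEnd : PolyEnd Cat.{u, u} := ⟨oneCat, symPoly⟩

namespace OverSym

variable {X : PolyEnd Cat.{u, u}} (F : PolyEnd.Hom X symEnd.{u})

/-- The functor to the category of permutations. -/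
abbrev arity : X.P.B ⥤ PermCat.{u} := F.φ.f₁.toFunctor

theorem isPullback : IsPullback (show X.P.E ⟶ Cat.of PermStar.{u} from F.φ.f₂) X.P.p permU.{u}
    (show X.P.B ⟶ Cat.of PermCat.{u} from F.φ.f₁) := F.φ.isPullback

/-- The numbering of the inputs. -/
abbrev numbering : Numbering X.P.p := Numbering.ofIsPullback (isPullback F)

/-- An element of the base is an arrow from `s` to `i`. -/
structure IsArrow {n : ℕ} (s : Fin n → X.I) (i : X.I) (β : X.P.B) : Prop where
  arity_eq : ((arity F).obj β).n = n
  src : ∀ a : X.P.E, X.P.p.toFunctor.obj a = β → ∀ j : Fin n, (j : ℕ) = (numbering F).pos a →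
    X.P.s.toFunctor.obj a = s j
  tgt : X.P.t.toFunctor.obj β = i

variable {F}

/-- Functors to a discrete category are constant along arrows. Thus `v` preserves the target, and
its lifts to arrows between inputs preserve source colours while moving positions by `σ`. -/
theorem IsArrow.of_hom [IsDiscrete X.I] {n m : ℕ} {s : Fin n → X.I} {i : X.I} {β γ : X.P.B}
    (h : IsArrow F s i β) (v : γ ⟶ β) (σ : Fin m → Fin n) (hn : ((arity F).obj γ).n = m)
    (hσ : ∀ (j : Fin ((arity F).obj γ).n) (j' : Fin m), (j : ℕ) = j' →
      (((arity F).map v).perm j : ℕ) = σ j') : IsArrow F (s ∘ σ) i γ := by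
  refine ⟨hn, ?_, (obj_ext_of_isDiscrete (X.P.t.toFunctor.map v)).trans h.tgt⟩
  intro a ha j hj
  obtain ⟨a', ha'⟩ := (numbering F).bifib.ex_tgt v a ha
  obtain ⟨w, -, -, -⟩ := id ha'
  refine (obj_ext_of_isDiscrete (X.P.s.toFunctor.map w)).trans (h.src a' ha'.tgt _ ?_)
  have hj' : (j : ℕ) < ((arity F).obj γ).n := lt_of_lt_of_eq j.2 hn.symm
  rw [← hσ ⟨j, hj'⟩ j rfl]
  exact perm_eq_of_isPullback (isPullback F) ha' hj

/-- The source of an arrow. -/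
noncomputable def srcOf (F : PolyEnd.Hom X symEnd.{u}) (β : X.P.B)
    (j : Fin ((arity F).obj β).n) : X.I :=
  X.P.s.toFunctor.obj ((numbering F).surj β j j.2).choose

theorem isArrow_srcOf (β : X.P.B) : IsArrow F (srcOf F β) (X.P.t.toFunctor.obj β) β := by
  refine ⟨rfl, fun a ha j hj ↦ congrArg _ ?_, rfl⟩
  have h := ((numbering F).surj β j j.2).choose_spec
  exact (numbering F).inj' ha h.1 (hj.symm.trans h.2.symm)

/-- Every position is occupied by an input, whose colour determines the source there. Hence an
object of the base is an arrow in only one way. -/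
theorem IsArrow.src_eq {n n' : ℕ} {s : Fin n → X.I} {s' : Fin n' → X.I} {i i' : X.I} {β : X.P.B}
    (h : IsArrow F s i β) (h' : IsArrow F s' i' β) {j : Fin n} {j' : Fin n'} (hj : (j : ℕ) = j') :
    s j = s' j' := by
  obtain ⟨a, ha, hj'⟩ := (numbering F).surj β j (lt_of_lt_of_eq j.2 h.arity_eq.symm)
  exact (h.src a ha j hj'.symm).symm.trans (h'.src a ha j' (hj.symm.trans hj'.symm))

variable [IsDiscrete X.I] (hb : IsDiscreteFibration (arity F))

theorem exists_act (hb : IsDiscreteFibration (arity F)) {n : ℕ} {s : Fin n → X.I} {i : X.I}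
    {β : X.P.B} (h : IsArrow F s i β) {m : ℕ} (ρ : Fin m ≃ Fin n) :
    ∃ (γ : X.P.B) (v : γ ⟶ β), IsArrow F (s ∘ ρ) i γ ∧
      ∀ (j : Fin ((arity F).obj γ).n) (j' : Fin m), (j : ℕ) = j' →
        (((arity F).map v).perm j : ℕ) = ρ j' := by
  obtain ⟨γ, v, hn, hv⟩ := hb.exists_hom β (ρ.trans (finCongr h.arity_eq.symm))
  exact ⟨γ, v, h.of_hom v ρ hn hv, hv⟩

/-- The action of permutations. -/
noncomputable def act {n : ℕ} {s : Fin n → X.I} {i : X.I} {β : X.P.B} (h : IsArrow F s i β)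
    (ρ : Equiv.Perm (Fin n)) : X.P.B :=
  (exists_act hb h ρ).choose

theorem isArrow_act {n : ℕ} {s : Fin n → X.I} {i : X.I} {β : X.P.B} (h : IsArrow F s i β)
    (ρ : Equiv.Perm (Fin n)) : IsArrow F (s ∘ ρ) i (act hb h ρ) :=
  (exists_act hb h ρ).choose_spec.choose_spec.1

theorem exists_actHom {n : ℕ} {s : Fin n → X.I} {i : X.I} {β : X.P.B} (h : IsArrow F s i β)
    (ρ : Equiv.Perm (Fin n)) : ∃ v : act hb h ρ ⟶ β,
      ∀ (j : Fin ((arity F).obj (act hb h ρ)).n) (j' : Fin n), (j : ℕ) = j' →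
        (((arity F).map v).perm j : ℕ) = ρ j' :=
  ⟨_, (exists_act hb h ρ).choose_spec.choose_spec.2⟩

/-- By uniqueness of lifts, the action is computed by any arrow over the given permutation. The laws
of an action follow by using an identity and a composite of lifts. -/
theorem act_eq {n : ℕ} {s : Fin n → X.I} {i : X.I} {β γ : X.P.B} (h : IsArrow F s i β)
    (ρ : Equiv.Perm (Fin n)) (v : γ ⟶ β) (hn : ((arity F).obj γ).n = n)
    (hv : ∀ (j : Fin ((arity F).obj γ).n) (j' : Fin n), (j : ℕ) = j' →
      (((arity F).map v).perm j : ℕ) = ρ j') : act hb h ρ = γ := by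
  obtain ⟨w, hw⟩ := exists_actHom hb h ρ
  refine congrArg Sigma.fst (hb.hom_ext w v ((isArrow_act hb h ρ).arity_eq.trans hn.symm) ?_)
  intro j j' hj
  have hj' : (j' : ℕ) < n := lt_of_lt_of_eq j'.2 hn
  exact (hw j ⟨j', hj'⟩ hj).trans (hv j' ⟨j', hj'⟩ rfl).symm

/-- The collection of arrows. -/
noncomputable def coll : Coll.{u} where
  I := X.I
  Hom s i := {β : X.P.B // IsArrow F s i β}
  act α ρ := ⟨act hb α.2 ρ, isArrow_act hb α.2 ρ⟩
  act_one α := Subtype.ext (act_eq hb α.2 1 (𝟙 _) α.2.arity_eq fun j j' hj ↦ by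
    rw [CategoryTheory.Functor.map_id]
    exact hj)
  act_act {n s i} α ρ₁ ρ₂ := by
    refine Subtype.ext (Eq.symm ?_)
    obtain ⟨v₁, h₁⟩ := exists_actHom hb α.2 ρ₁
    obtain ⟨v₂, h₂⟩ := exists_actHom hb (isArrow_act hb α.2 ρ₁) ρ₂
    refine act_eq hb α.2 (ρ₁ * ρ₂) (v₂ ≫ v₁) (isArrow_act hb (isArrow_act hb α.2 ρ₁) ρ₂).arity_eq fun j j' hj ↦ ?_
    rw [CategoryTheory.Functor.map_comp]
    exact h₁ _ _ (h₂ j j' hj)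

/-- Arity, sources and target are all determined by the object of the base, so arrows of the
collection are just objects of `B`. -/
theorem arrow_ext {α α' : (coll hb).Arrow} (h : α.hom.1 = α'.hom.1) : α = α' := by
  obtain ⟨n, s, i, β, hβ⟩ := α
  obtain ⟨n', s', i', β', hβ'⟩ := α'
  dsimp only at h
  subst h
  obtain rfl : n = n' := hβ.arity_eq.symm.trans hβ'.arity_eq
  obtain rfl : i = i' := hβ.tgt.symm.trans hβ'.tgt
  obtain rfl : s = s' := funext fun j ↦ hβ.src_eq hβ' rfl
  rfl

theorem act_hom_eq (α : (coll hb).Arrow) {m : ℕ} (σ : Fin m ≃ Fin α.n) {γ : X.P.B}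
    (v : γ ⟶ α.hom.1) (hn : ((arity F).obj γ).n = m)
    (hv : ∀ (j : Fin ((arity F).obj γ).n) (j' : Fin m), (j : ℕ) = j' →
      (((arity F).map v).perm j : ℕ) = σ j') : (α.act σ).hom.1 = γ := by
  obtain ⟨n, s, i, β⟩ := α
  obtain rfl : m = n := Fin.equiv_iff_eq.1 ⟨σ⟩
  exact act_eq hb β.2 σ v hn hv

/-- The arrows as elements of the base. -/
noncomputable def toArrow : X.P.B ⥤ (coll hb).Arrow where
  obj β := ⟨((arity F).obj β).n, srcOf F β, X.P.t.toFunctor.obj β, β, isArrow_srcOf β⟩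
  map {γ β} v := ⟨((arity F).map v).perm, arrow_ext hb (act_hom_eq hb _ _ v rfl
    fun j j' hj ↦ by rw [Fin.ext hj]).symm⟩
  map_id β := Coll.Arrow.Hom.ext (congrArg PermCat.Hom.perm ((arity F).map_id β))
  map_comp v w := Coll.Arrow.Hom.ext (congrArg PermCat.Hom.perm ((arity F).map_comp v w))

/-- Bijective on objects because an arrow of the collection is an object of `B`, faithful because a
discrete fibration is faithful, and full by lifting permutations. -/
theorem isIso_toArrow : IsIso (toArrow hb).toCatHom := by
  have := hb.faithful
  have : (toArrow hb).Faithful := ⟨fun {γ β v w} h ↦ (arity F).map_injective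
    (PermCat.Hom.ext (congrArg Coll.Arrow.Hom.perm h))⟩
  have : (toArrow hb).Full := ⟨fun {γ β} f ↦ by
    obtain ⟨γ', v, hn, hv⟩ := hb.exists_hom β f.perm
    -- The morphism `f` says that `γ` is the result of acting on `β` by a permutation; so is the
    -- source `γ'` of the lift of that permutation.
    obtain rfl : γ = γ' := (congrArg (fun α : (coll hb).Arrow ↦ α.hom.1) f.eq).trans
      (act_hom_eq hb ((toArrow hb).obj β) f.perm v hn hv)
    exact ⟨v, Coll.Arrow.Hom.ext (Equiv.ext fun j ↦ Fin.ext (hv j j rfl))⟩⟩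
  refine isIso_toCatHom _ ⟨fun β β' h ↦ ?_, fun α ↦ ⟨α.hom.1, arrow_ext hb rfl⟩⟩
  exact congrArg (fun α : (coll hb).Arrow ↦ α.hom.1) h

/-- The inputs as elements of the domain. -/
noncomputable def toInput : X.P.E ⥤ (coll hb).Input :=
  Pointed.lift (X.P.p.toFunctor ⋙ toArrow hb) (fun a ↦ ⟨(numbering F).pos a, (numbering F).lt a⟩)
    fun w ↦ Fin.ext (perm_eq_of_isPullback (isPullback F) (Lift.mk _ w) rfl)

theorem toInput_star : (toInput hb).toCatHom ≫ (Pointed.star (coll hb).arity).toCatHom =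
    (show X.P.E ⟶ Cat.of PermStar.{u} from F.φ.f₂) :=
  Cat.ext (Pointed.functor_ext (congrArg Cat.Hom.toFunctor (isPullback F).w).symm fun _ ↦ rfl)

/-- Pasted with the standard pullback of `ℙ_* ⟶ ℙ`, this square becomes the pullback square of the
given morphism to `S`. -/
theorem isPullback_toInput : IsPullback (toInput hb).toCatHom X.P.p
    (Pointed.proj (coll hb).arity).toCatHom (toArrow hb).toCatHom := by
  refine IsPullback.of_right (h₁₂ := (Pointed.star (coll hb).arity).toCatHom)
    (h₂₂ := (coll hb).arity.toCatHom) ?_ rfl (Pointed.isPullback _)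
  rw [toInput_star]
  exact isPullback F

/-- The comparison with the polynomial endomorphism of the collection. -/
noncomputable def toColl : PolyEnd.Hom X (coll hb).toEnd where
  f := (functorOfIsDiscrete fun i : X.I ↦ (⟨i⟩ : Discrete X.I)).toCatHom
  φ := Poly.Hom.mk (toArrow hb).toCatHom (toInput hb).toCatHom
    (Cat.ext (discreteFunctor_ext fun a ↦ ((isArrow_srcOf (X.P.p.toFunctor.obj a)).src a rfl _
      rfl).symm))
    (Cat.ext (discreteFunctor_ext fun _ ↦ rfl)) (isPullback_toInput hb)

theorem toSym_app {Y Z : Cat.{u, u}} {y : Y ⟶ Z} (c : X.P.Cell y) :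
    CollCell.toSym ((toColl hb).app c) = F.app c := by
  apply Poly.Cell.ext
  · exact (Category.assoc c.e (toInput hb).toCatHom _).trans
      (congrArg (c.e ≫ ·) (toInput_star hb))
  · rfl

/-- The component on the base is invertible, the one on inputs is its pullback, and a discrete
category is isomorphic to the discrete category on its set of objects. -/
theorem isIso_toColl : IsIso (X := X) (Y := (coll hb).toEnd) (toColl hb) := by
  have h₁ := isIso_toArrow hb
  have : IsIso (toColl hb).φ.f₁ := h₁
  have : IsIso (toColl hb).φ.f₂ := (isPullback_toInput hb).isIso_fst_of_isIso h₁
  have : IsIso (toColl hb).f := by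
    let D : X.I ⥤ Discrete X.I := functorOfIsDiscrete fun i : X.I ↦ (⟨i⟩ : Discrete X.I)
    have : D.Faithful := ⟨fun _ ↦ Subsingleton.elim _ _⟩
    have : D.Full := ⟨fun f ↦ ⟨eqToHom (Discrete.eq_of_hom f), Subsingleton.elim _ _⟩⟩
    exact isIso_toCatHom D ⟨fun i j h ↦ congrArg Discrete.as h, fun i ↦ ⟨i.as, rfl⟩⟩
  exact PolyEnd.isIso_of_components (toColl hb)

end OverSym

end PolyOpd

/-! ### Transport of the monad, and essential surjectivity -/

namespace PolyOpd

open CollCell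

theorem PolyEnd.Hom.app_base {C : Type*} [Category C] [HasPullbacks C] {X Y : PolyEnd C}
    (F : PolyEnd.Hom X Y) {A B A' B' : C} {x : A ⟶ B} {x' : A' ⟶ B'} {k : A' ⟶ A} {l : B' ⟶ B}
    (c : X.P.Cell x) (sq : IsPullback k x' x l) : F.app (c.base sq) = (F.app c).base sq :=
  Poly.Cell.ext (Category.assoc _ _ _) (Category.assoc _ _ _)

namespace OverSym

variable {M : PolyMnd Cat.{u, u}} (F : M ⟶ SymMnd.{u})

theorem app_mulCell {X Y Z : Cat.{u, u}} {x : X ⟶ Y} {y : Y ⟶ Z} {z : X ⟶ Z}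
    (c : M.toEnd.P.Cell x) (d : M.toEnd.P.Cell y) (h : c.b ≫ M.toEnd.P.t = d.e ≫ M.toEnd.P.s)
    (hz : x ≫ y = z) : F.app (M.mulCell c d h hz) = symSubst (F.app c) (F.app d) hz :=
  (F.app_mulCell c d h hz).trans (map_symMul _ _ _ _)

theorem app_oneCell {X : Cat.{u, u}} (f : X ⟶ M.I.obj) :
    F.app (M.oneCell f) = (Numbering.id X).cell :=
  (F.app_oneCell f).trans (map_symUnit _)

variable {F} {T : Coll.{u}} (e : M.toEnd ≅ T.toEnd)

section Transport

variable {X Y Z : Cat.{u, u}} {x : X ⟶ Y} {y : Y ⟶ Z} {z : X ⟶ Z}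

theorem app_inv_app (c : M.toEnd.P.Cell x) : e.inv.app (e.hom.app c) = c := by
  rw [← PolyEnd.comp_app, e.hom_inv_id, PolyEnd.id_app]

theorem app_hom_app (c : T.poly.Cell x) : e.hom.app (e.inv.app c) = c := by
  refine (PolyEnd.comp_app e.inv e.hom c).symm.trans ?_
  rw [e.inv_hom_id]
  exact PolyEnd.id_app (X := T.toEnd) c

theorem inv_f_hom_f : e.inv.f ≫ e.hom.f = 𝟙 T.colours := congrArg PolyEnd.Hom.f e.inv_hom_id

theorem hom_f_inv_f : e.hom.f ≫ e.inv.f = 𝟙 M.I.obj := congrArg PolyEnd.Hom.f e.hom_inv_id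

theorem inv_condition {c : T.poly.Cell x} {d : T.poly.Cell y}
    (w : c.b ≫ T.poly.t = d.e ≫ T.poly.s) :
    (e.inv.app c).b ≫ M.toEnd.P.t = (e.inv.app d).e ≫ M.toEnd.P.s := by
  have h1 := e.inv.app_t c
  have h2 := e.inv.app_s d
  refine h1.trans (Eq.trans ?_ h2.symm)
  exact (Category.assoc _ _ _).symm.trans ((congrArg (· ≫ e.inv.f) w).trans (Category.assoc _ _ _))

/-- The transported multiplication. -/
noncomputable def mulOf (c : T.poly.Cell x) (d : T.poly.Cell y)
    (w : c.b ≫ T.poly.t = d.e ≫ T.poly.s) (hz : x ≫ y = z) : T.poly.Cell z :=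
  e.hom.app (M.mulCell (e.inv.app c) (e.inv.app d) (inv_condition e w) hz)

/-- The transported unit. -/
noncomputable def oneOf (f : X ⟶ T.colours) : T.poly.Cell (𝟙 X) :=
  e.hom.app (M.oneCell (f ≫ e.inv.f))

theorem comp_inv_hom {W : Cat.{u, u}} (f : W ⟶ T.colours) : (f ≫ e.inv.f) ≫ e.hom.f = f :=
  (Category.assoc _ _ _).trans ((congrArg (f ≫ ·) (inv_f_hom_f e)).trans (Category.comp_id f))

theorem mulOf_s (c : T.poly.Cell x) (d : T.poly.Cell y) (w) (hz : x ≫ y = z) :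
    (mulOf e c d w hz).e ≫ T.poly.s = c.e ≫ T.poly.s := by
  refine (e.hom.app_s _).trans ((Category.assoc _ _ _).symm.trans ?_)
  refine (congrArg (· ≫ e.hom.f) ((M.mulCell_s _ _ _ hz).trans (e.inv.app_s c))).trans ?_
  refine (congrArg (· ≫ e.hom.f) (Category.assoc _ _ _).symm).trans ?_
  exact comp_inv_hom e _

theorem mulOf_t (c : T.poly.Cell x) (d : T.poly.Cell y) (w) (hz : x ≫ y = z) :
    (mulOf e c d w hz).b ≫ T.poly.t = d.b ≫ T.poly.t := by
  refine (e.hom.app_t _).trans ((Category.assoc _ _ _).symm.trans ?_)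
  refine (congrArg (· ≫ e.hom.f) ((M.mulCell_t _ _ _ hz).trans (e.inv.app_t d))).trans ?_
  refine (congrArg (· ≫ e.hom.f) (Category.assoc _ _ _).symm).trans ?_
  exact comp_inv_hom e _

theorem oneOf_s (f : X ⟶ T.colours) : (oneOf e f).e ≫ T.poly.s = f := by
  refine (e.hom.app_s _).trans ((Category.assoc _ _ _).symm.trans ?_)
  exact (congrArg (· ≫ e.hom.f) (M.oneCell_s _)).trans (comp_inv_hom e _)

theorem oneOf_t (f : X ⟶ T.colours) : (oneOf e f).b ≫ T.poly.t = f := by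
  refine (e.hom.app_t _).trans ((Category.assoc _ _ _).symm.trans ?_)
  exact (congrArg (· ≫ e.hom.f) (M.oneCell_t _)).trans (comp_inv_hom e _)

theorem inv_app_mulOf (c : T.poly.Cell x) (d : T.poly.Cell y) (w) (hz : x ≫ y = z) :
    e.inv.app (mulOf e c d w hz) =
      M.mulCell (e.inv.app c) (e.inv.app d) (inv_condition e w) hz := app_inv_app e _

theorem inv_app_oneOf (f : X ⟶ T.colours) : e.inv.app (oneOf e f) = M.oneCell (f ≫ e.inv.f) :=
  app_inv_app e _

theorem oneCell_base {f : X ⟶ M.I.obj} {X' : Cat.{u, u}} {m : X' ⟶ X}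
    (sq : IsPullback m (𝟙 X') (𝟙 X) m) : (M.oneCell f).base sq = M.oneCell (m ≫ f) := by
  refine (Poly.Cell.base_map _ _ _).symm.trans (congrArg (fun c ↦ Poly.Cell.map c M.one) ?_)
  exact Poly.Cell.ext rfl rfl

end Transport

/-- The operations on structures of a polynomial monad over `S` whose underlying polynomial
endomorphism is that of a collection. -/
noncomputable def cellMonad (he : ∀ {X Y : Cat.{u, u}} {x : X ⟶ Y} (c : M.toEnd.P.Cell x),
    toSym (T := T) (e.hom.app c) = F.app c) : CellMonad T where
  mul c d w hz := mulOf e c d w hz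
  one f := oneOf e f
  mul_s := mulOf_s e
  mul_t := mulOf_t e
  one_s := oneOf_s e
  one_t := oneOf_t e
  toSym_mul c d w hz := by
    -- The inverse isomorphism lies over `S` as well, so a transported product is numbered like the
    -- product in `S` of the underlying numberings.
    have he' : ∀ {X Y : Cat.{u, u}} {x : X ⟶ Y} (c : T.poly.Cell x),
        F.app (e.inv.app c) = toSym c := fun c ↦
      (he _).symm.trans (congrArg toSym (app_hom_app e c))
    refine (he _).trans ((app_mulCell F _ _ _ hz).trans ?_)
    exact congrArg₂ (fun c d ↦ symSubst c d hz) (he' c) (he' d)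
  toSym_one f := (he _).trans (app_oneCell F _)
  mul_base := by
    intro X Y Z x y z c d w hz X' Y' Z' x' y' z' k l m sq₁ sq₂ sq hz' w'
    refine (e.hom.app_base _ sq).symm.trans (congrArg e.hom.app ?_)
    refine (M.mulCell_base _ _ _ hz sq₁ sq₂ sq hz' ?_).trans ?_
    -- Morphisms act by postcomposition and restriction is precomposition, so the two commute, and
    -- composability of the restricted structures may be checked before transport.
    · rw [← PolyEnd.Hom.app_base, ← PolyEnd.Hom.app_base]
      exact inv_condition e w'
    · exact M.mulCell_congr (e.inv.app_base c sq₁).symm (e.inv.app_base d sq₂).symm _ _ _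
  one_base := by
    intro X X' f m sq
    refine (e.hom.app_base _ sq).symm.trans (congrArg e.hom.app ?_)
    exact (oneCell_base sq).trans (congrArg M.oneCell (Category.assoc _ _ _).symm)
  one_mul c w := by
    refine (congrArg e.hom.app ?_).trans (app_hom_app e c)
    refine (M.mulCell_congr ?_ rfl _ (M.oneCell_t _) _).trans (M.one_mulCell (e.inv.app c) (M.oneCell_t _))
    exact (inv_app_oneOf e _).trans (congrArg M.oneCell
      ((e.inv.app_s c).trans (Category.assoc _ _ _).symm).symm)
  mul_one c w := by
    refine (congrArg e.hom.app ?_).trans (app_hom_app e c)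
    refine (M.mulCell_congr rfl ?_ _ (M.oneCell_s _).symm _).trans (M.mulCell_one (e.inv.app c) (M.oneCell_s _).symm)
    exact (inv_app_oneOf e _).trans (congrArg M.oneCell
      ((e.inv.app_t c).trans (Category.assoc _ _ _).symm).symm)
  mul_mul c d g h h' hz hyv ht ht' h₁ h₂ := by
    have w := inv_condition e h
    have w' := inv_condition e h'
    have w₁ := (M.mulCell_t _ _ w hz).trans w'
    have w₂ := w.trans (M.mulCell_s _ _ w' hyv).symm
    -- After an inner product, `e.inv` cancels `e.hom`, which leaves associativity of the
    -- multiplication of `M`.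
    refine congrArg e.hom.app ?_
    refine (M.mulCell_congr (inv_app_mulOf e c d h hz) rfl _ w₁ ht).trans ?_
    refine (M.mulCell_mulCell _ _ _ w w' hz hyv ht ht' w₁ w₂).trans ?_
    exact (M.mulCell_congr rfl (inv_app_mulOf e d g h' hyv) _ w₂ ht').symm

variable (he : ∀ {X Y : Cat.{u, u}} {x : X ⟶ Y} (c : M.toEnd.P.Cell x),
    toSym (T := T) (e.hom.app c) = F.app c)

/-- A polynomial monad over `S` whose underlying polynomial endomorphism is that of a collection
is the polynomial monad of an operad. -/
noncomputable def isoMnd : M ≅ (cellMonad e he).toOpd.mnd :=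
  PolyMnd.isoOfApp (N := (cellMonad e he).toOpd.mnd) e
    (fun x ↦ by
      -- The monad of the operad acts on structures by the transported operations; up to cancelling
      -- `e.hom` with `e.inv`, these are preserved by definition.
      refine Eq.trans ?_ ((cellMonad e he).toOpd.map_polyUnit (x ≫ e.hom.f)).symm
      refine Eq.trans ?_ ((cellMonad e he).toOpd_unitCell (x ≫ e.hom.f)).symm
      refine congrArg e.hom.app (congrArg M.oneCell ?_)
      exact ((Category.assoc _ _ _).trans ((congrArg (x ≫ ·) (hom_f_inv_f e)).trans
        (Category.comp_id x))).symm)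
    (fun c d h hz ↦ by
      have w : (e.hom.app c).b ≫ T.poly.t = (e.hom.app d).e ≫ T.poly.s := by
        refine (e.hom.app_t c).trans (Eq.trans ?_ (e.hom.app_s d).symm)
        exact (Category.assoc _ _ _).symm.trans
          ((congrArg (· ≫ e.hom.f) h).trans (Category.assoc _ _ _))
      refine Eq.trans ?_ ((cellMonad e he).toOpd.map_polyMul (e.hom.app c) (e.hom.app d) w hz).symm
      refine Eq.trans ?_ ((cellMonad e he).toOpd_subst (e.hom.app c) (e.hom.app d) w hz).symm
      refine congrArg e.hom.app ?_
      exact M.mulCell_congr (app_inv_app e c).symm (app_inv_app e d).symm _ _ _)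

/-- The isomorphism over `S`. -/
noncomputable def isoNbar : Over.mk F ≅ Nbar.obj (cellMonad e he).toOpd :=
  Over.isoMk (isoMnd e he)
    (PolyMnd.hom_ext_toHom (PolyEnd.Hom.ext_app (toOne_ext _ _) (he M.toEnd.P.idCell)))

end OverSym

/-! ### The values of the functor, and the equivalence -/

theorem operadic_nbar (T : Opd.{u}) : operadic (Nbar.obj T) := by
  refine ⟨inferInstanceAs (IsDiscrete (Discrete T.I)), ?_⟩
  change IsDiscreteFibration T.arity
  intro α a u
  -- The lift of a permutation `u` with codomain `α` is the morphism `αu ⟶ α`. It is the only one,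
  -- because any morphism over `u` contains a proof that its domain is `αu`.
  refine ⟨⟨α.act u.perm, α.actHom u.perm⟩, ⟨rfl, (Category.id_comp _).symm⟩, ?_⟩
  rintro ⟨γ, v⟩ ⟨rfl, hv⟩
  obtain rfl : T.arity.map v = u := hv.trans (Category.id_comp u)
  -- The equation `v.eq` has `γ` on both sides, through the type of `v`, and cannot be eliminated
  -- directly; it is replaced by an equation with a free right-hand side.
  have key : ∀ {γ' : T.Arrow} (h : γ = γ') (w : γ' ⟶ α),
      (∀ (j : Fin γ.n) (j' : Fin γ'.n), (j : ℕ) = j' → v.perm j = w.perm j') →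
      (⟨γ, v⟩ : Σ γ : T.Arrow, (γ ⟶ α)) = ⟨γ', w⟩ := by
    rintro _ rfl w hw
    exact congrArg _ (Coll.Arrow.Hom.ext (Equiv.ext fun j ↦ hw j j rfl))
  exact key v.eq (α.actHom v.perm) fun j j' hj ↦ congrArg v.perm (Fin.ext hj)

/-- Both conditions enter in the collection: discreteness of the colours makes sources and targets
invariant along arrows of the base, and the discrete fibration supplies the action. The monad
structure is then transported to it. -/
theorem exists_iso_nbar (X : Over SymMnd.{u}) (hX : operadic X) :
    ∃ T : Opd.{u}, Nonempty (X ≅ Nbar.obj T) := by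
  have := hX.1
  let F : PolyEnd.Hom X.left.toEnd symEnd.{u} := PolyMnd.Hom.toHom X.hom
  have hb : IsDiscreteFibration (OverSym.arity F) := hX.2
  have := OverSym.isIso_toColl hb
  let e : X.left.toEnd ≅ (OverSym.coll hb).toEnd := asIso (OverSym.toColl hb)
  exact ⟨_, ⟨OverSym.isoNbar (F := X.hom) e fun c ↦ OverSym.toSym_app hb c⟩⟩

instance (h : ∀ T : Opd.{u}, operadic (Nbar.obj T)) : (operadic.lift Nbar.{u} h).EssSurj where
  mem_essImage X := by
    obtain ⟨T, ⟨i⟩⟩ := exists_iso_nbar X.1 X.2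
    exact ⟨T, ⟨operadic.isoMk i.symm⟩⟩

end PolyOpd

theorem mainTheorem1 :
    ∃ h : ∀ T : PolyOpd.Opd.{u}, PolyOpd.operadic (PolyOpd.Nbar.obj T),
      (PolyOpd.operadic.lift PolyOpd.Nbar.{u} h).IsEquivalence :=
  -- The lift to the full subcategory inherits fullness and faithfulness from `Nbar`; together with
  -- essential surjectivity these are found as instances.
  ⟨PolyOpd.operadic_nbar, { }⟩
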